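/- Let $X$ be a compact connected Riemann surface and let $f:X\to X$ be a holomorphic map of topological degree $\lambda\ge 2$ (every point has exactly $\lambda$ preimages, counted with multiplicity). Normalise the Laplacian so that $\Delta\log|z|=\delta_0$ in local coordinates, i.e. $\Delta=\frac1{2\pi}(\partial_x^2+\partial_y^2)$; equalities between measures and Laplacians are understood in the sense of distributions. For a measure $\nu$ on $X$ the pull-back $f^*\nu$ is defined by $\int\varphi\,d(f^*\nu)=\int\sum_{f(x)=y}d(f,x)\varphi(x)\,d\nu(y)$, where $d(f,x)$ is the local degree of $f$ at $x$. Let $\omega$ be any smooth probability measure on $X$ (a probability measure with a $C^\infty$, nonnegative density in local coordinates). Then: 1. There is a $C^\infty$ function $\gamma:X\to\mathbb R$ with $\lambda^{-1}f^*\omega=\omega+\Delta\gamma$, and there is a unique probability measure $\mu_f$ (the canonical measure of $f$) with $\mu_f=\omega+\Delta g_f$, where $g_f=\sum_{j\ge0}\lambda^{-j}\,\gamma\circ f^j$. It does not depend on the choice of $\omega$ and $\gamma$. 2. The measure $\mu_f$ is $f$-invariant and mixing: $\mu_f(f^{-n}(A)\cap B)\to\mu_f(A)\mu_f(B)$ as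 $n\to\infty$ for all Borel sets $A,B\subset X$. 3. Fix a $C^2$ norm on $X$ as follows: choose finitely many holomorphic charts of $X$ and, in the domain of each, a compact set, such that these compact sets cover $X$; let $\|\psi\|_{C^2}$ be the supremum over these compact sets of $|\psi|+\|D\psi\|+\|D^2\psi\|$ computed in the corresponding charts (different choices give equivalent norms). Then there is a constant $C>0$ such that for all $C^\infty$ functions $\varphi,\psi:X\to\mathbb R$ and all $n\ge0$, $$\left|\int_X\psi\cdot(\varphi\circ f^n)\,d\mu_f-\int_X\varphi\,d\mu_f\int_X\psi\,d\mu_f\right|\le C\,\|\psi\|_{C^2}\,\|\varphi\|_{\infty}\,\lambda^{-n},$$ where $\|\varphi\|_\infty=\sup_X|\varphi|$. -/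

import Mathlib

open MeasureTheory Filter Topology
open scoped Manifold ContDiff ENNReal

noncomputable section

namespace RiemannDynamics

variable {X : Type*} [TopologicalSpace X] [ChartedSpace ℂ X]

/-- Real `C^∞` functions on a Riemann surface `X` (test functions, as `X` is compact). -/
def IsTestFunction (φ : X → ℝ) : Prop :=
  ContMDiff 𝓘(ℝ, ℂ) 𝓘(ℝ, ℝ) ∞ φ

/-- The local degree (multiplicity) of a holomorphic map `f` at `x`: the order of vanishing at `x`
of `f - f x`, read in the charts at `x` and `f x`. It is `⊤` if `f` is constant near `x`. -/
def localDegree (f : X → X) (x : X) : ℕ∞ :=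
  analyticOrderAt
    (fun z => writtenInExtChartAt 𝓘(ℂ) 𝓘(ℂ) x f z - extChartAt 𝓘(ℂ) (f x) (f x))
    (extChartAt 𝓘(ℂ) x x)

/-- `f` has topological degree `d`: each point has exactly `d` preimages, counted with
multiplicity. -/
def HasDegree (f : X → X) (d : ℕ) : Prop :=
  ∀ y : X, ∑' x : f ⁻¹' {y}, localDegree f x = (d : ℕ∞)

variable [MeasurableSpace X]

/-- The fibre of `f` over `y` as a measure, `∑_{f x = y} d(f,x) δ_x`. -/
def fiberMeasure (f : X → X) (y : X) : Measure X :=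
  Measure.sum fun x : f ⁻¹' {y} => (localDegree f x : ℝ≥0∞) • Measure.dirac (x : X)

/-- The pull-back `f^* ν` of a measure:
`∫ φ d(f^* ν) = ∫ (∑_{f x = y} d(f,x) φ(x)) dν(y)`. -/
def pullback (f : X → X) (ν : Measure X) : Measure X :=
  ν.bind (fiberMeasure f)

/-- A smooth probability measure: in every chart it has a nonnegative `C^∞` density with respect to
Lebesgue measure. -/
structure IsSmoothProbability (ω₀ : Measure X) : Prop where
  prob : IsProbabilityMeasure ω₀
  smooth : ∀ e ∈ atlas ℂ X, ∃ ρ : ℂ → ℝ, ContDiffOn ℝ ∞ ρ e.target ∧ (∀ z ∈ e.target, 0 ≤ ρ z) ∧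
    (ω₀.restrict e.source).map e =
      (volume.restrict e.target).withDensity fun z => ENNReal.ofReal (ρ z)

/-- `μ = ω₀ + Δ g` in the sense of distributions on `X`, tested in charts. The Laplacian is
normalised by `Δ log |z| = δ_0`, i.e. it is `(2π)⁻¹ (∂²/∂x² + ∂²/∂y²)` in local coordinates
(`Laplacian.laplacian` is `∂²/∂x² + ∂²/∂y²`). -/
def EqAddLaplacian (μ ω₀ : Measure X) (g : X → ℝ) : Prop :=
  ∀ e ∈ atlas ℂ X, ∀ φ : ℂ → ℝ, ContDiff ℝ ∞ φ → HasCompactSupport φ → tsupport φ ⊆ e.target →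
    ∫ x in e.source, φ (e x) ∂μ =
      ∫ x in e.source, φ (e x) ∂ω₀ +
        (2 * Real.pi)⁻¹ * ∫ z in e.target, g (e.symm z) * Laplacian.laplacian φ z

/-- The potential `∑_{j ≥ 0} d^{-j} γ ∘ f^j`. -/
def greenPotential (f : X → X) (d : ℕ) (γ : X → ℝ) (x : X) : ℝ :=
  ∑' j : ℕ, ((d : ℝ) ^ j)⁻¹ * γ (f^[j] x)

/-- `μ` is the canonical measure of `f` (of degree `d`) obtained from the smooth probability
measure `ω₀`: it is the probability measure `ω₀ + Δ g_f` with `g_f = ∑ d^{-j} γ ∘ f^j`, where `γ` is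
a smooth function such that `d⁻¹ f^* ω₀ = ω₀ + Δ γ`. -/
def IsCanonicalMeasure (f : X → X) (d : ℕ) (ω₀ μ : Measure X) : Prop :=
  IsProbabilityMeasure μ ∧ ∃ γ : X → ℝ, IsTestFunction γ ∧
    EqAddLaplacian ((d : ℝ≥0∞)⁻¹ • pullback f ω₀) ω₀ γ ∧
    EqAddLaplacian μ ω₀ (greenPotential f d γ)

/-- `f` preserves `μ` and is (strongly) mixing for it: `μ(f^{-n}(A) ∩ B) → μ(A) μ(B)`. -/
def IsMixing (f : X → X) (μ : Measure X) : Prop :=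
  MeasurePreserving f μ μ ∧ ∀ A B : Set X, MeasurableSet A → MeasurableSet B →
    Tendsto (fun n : ℕ => μ ((f^[n]) ⁻¹' A ∩ B)) atTop (𝓝 (μ A * μ B))

/-- A finite cover of `X` by compact sets, each contained in the domain of a chart. -/
structure CompactChartCover (X : Type*) [TopologicalSpace X] [ChartedSpace ℂ X] where
  N : ℕ
  chart : Fin N → OpenPartialHomeomorph X ℂ
  chart_mem : ∀ i, chart i ∈ atlas ℂ X
  K : Fin N → Set X
  isCompact_K : ∀ i, IsCompact (K i)
  K_subset : ∀ i, K i ⊆ (chart i).source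
  cover : ⋃ i, K i = Set.univ

/-- The `C²` norm on `X` defined by a finite cover by compact pieces of charts: the supremum of
`|ψ| + ‖Dψ‖ + ‖D²ψ‖`, computed in the charts. Different covers give equivalent norms. -/
def c2Norm {X : Type*} [TopologicalSpace X] [ChartedSpace ℂ X] (𝒰 : CompactChartCover X)
    (ψ : X → ℝ) : ℝ :=
  ⨆ p : (i : Fin 𝒰.N) × 𝒰.K i, ∑ j ∈ Finset.range 3,
    ‖iteratedFDeriv ℝ j (ψ ∘ (𝒰.chart p.1).symm) (𝒰.chart p.1 p.2)‖

/-- The uniform norm. -/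
def supNorm {X : Type*} (φ : X → ℝ) : ℝ :=
  ⨆ x : X, |φ x|

end RiemannDynamics

end

/-!
A reference measure `P.vol` with smooth positive density, glued from Lebesgue measure in the charts
by a partition of unity `P : ChartPartition X`, turns measures into functions: a smooth measure
becomes its density, the distributional Laplacian becomes an operator `P.lap` on test functions
which is symmetric (`integral_mul_lap_comm`), and conformal invariance of the Laplacian reads
`Δ(u ∘ f) = (Δu ∘ f) · Jac f` (`lap_comp`). Away from the countable set of critical points `f` is
locally injective, so the change of variables formula shows that `f^*` maps the measure of density
`s` to the measure of density `(s ∘ f) · Jac f` (`pullback_smoothMeasure`). The operator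
`transfer f d`, `s ↦ d⁻¹ (s ∘ f) Jac f`, thus describes `d⁻¹ f^*`; it satisfies
`transfer (Δu) = Δ(d⁻¹ u ∘ f)`, and this factor `d⁻¹` is behind all the convergence statements.

The analytic input is Poisson's equation. A truncated logarithm (`Parametrix`) inverts the planar
Laplacian up to a smooth kernel; put together over the charts, it inverts `P.lap` up to an integral
operator `K` with continuous kernel (`exists_globalParametrix`). By the Stone–Weierstrass theorem
`K` is the sum of an operator of finite rank and of an operator of norm less than `1`, so that the
parametrix can be corrected into a right inverse modulo finite rank
(`exists_rightInverse_modulo_finiteRank`). A linear functional on test functions which vanishes on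
the range of `P.lap` is then the integration against a continuous function; by Weyl's lemma this
function is smooth and harmonic, hence constant. So `Δγ = σ` is solvable exactly when `σ` has mean
zero (`exists_lap_eq`), with a bound for `γ` by the uniform norm of `σ` (`exists_lap_eq_abs_le`).
Since the truncated logarithm is nonpositive, a lower bound on `Δh` alone bounds `h` from above
(`exists_le_of_lap_ge`).

Let `s` be the density of `ω₀` and `γ` a solution of `transfer s = s + Δγ`. Iterating,
`transfer^n s = s + Δ(∑_{j < n} d^{-j} γ ∘ f^j)`, and the sums converge uniformly to the potential
`greenPotential f d γ`. Hence the integrals of a test function against these densities converge, and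
the limit is represented by a probability measure `μ` by compactness (`IsSeed.exists_limit`); `μ` is
the canonical measure. Another smooth density differs from `s` by a Laplacian, which the iterates of
`transfer` contract to zero, so the limit is the same (`tendsto_integral_transfer_pow_sub`).
Invariance follows from `f_* f^* = d`.

For the decay of correlations, write `S_m = transfer^m s` and solve `Δu_m = (φ - c_m) S_m`, where
`c_m` is the integral of `φ` against `S_m`. These densities are not bounded uniformly in `m`, but
with `A = ‖φ‖_∞` both `(φ + A) S_m` and `(A - φ) S_m` are nonnegative, so the one-sided
bound applies to each; the sum of the two solutions is governed by the potential of `S_m`, which is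
uniformly bounded. This gives `|u_m| ≤ C ‖φ‖_∞` uniformly in `m` (`IsSeed.exists_lap_eq_sub_mul`).
Applying `transfer^n`, `(φ ∘ f^n - c_m) S_{m+n}` is the Laplacian of `d^{-n} u_m ∘ f^n`; integrating
it against `ψ`, moving the Laplacian to `ψ` and letting `m → ∞` yields the estimate
(`IsSeed.exists_abs_correlation_le`). Mixing follows by approximating indicator functions by test
functions in `L¹(μ)`.
-/

noncomputable section

namespace RiemannDynamics

set_option linter.unusedSectionVars false

open Laplacian InnerProductSpace


/-! ### The planar Laplacian -/

theorem laplacian_eq_fderiv {u : ℂ → ℝ} {z : ℂ} (hu : ContDiffAt ℝ 2 u z) :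
    Δ u z = fderiv ℝ (fun w => fderiv ℝ u w 1) z 1 +
      fderiv ℝ (fun w => fderiv ℝ u w Complex.I) z Complex.I := by
  have hd : DifferentiableAt ℝ (fderiv ℝ u) z :=
    (hu.fderiv_right (m := 1) (by norm_num)).differentiableAt (by norm_num)
  rw [laplacian_eq_iteratedFDeriv_complexPlane]
  simp only [iteratedFDeriv_two_apply]
  rw [fderiv_clm_apply hd (differentiableAt_const _), fderiv_clm_apply hd (differentiableAt_const _)]
  simp

theorem contDiff_fderiv_apply {u : ℂ → ℝ} (hu : ContDiff ℝ ∞ u) (v : ℂ) :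
    ContDiff ℝ ∞ (fun w => fderiv ℝ u w v) :=
  (hu.fderiv_right (m := ∞) (by simp)).clm_apply contDiff_const

theorem laplacian_eq_fderiv' {u : ℂ → ℝ} (hu : ContDiff ℝ ∞ u) :
    Δ u = fun z => fderiv ℝ (fun w => fderiv ℝ u w 1) z 1 +
      fderiv ℝ (fun w => fderiv ℝ u w Complex.I) z Complex.I := by
  funext z
  exact laplacian_eq_fderiv (hu.contDiffAt.of_le (WithTop.coe_le_coe.2 le_top))

theorem contDiff_laplacian {u : ℂ → ℝ} (hu : ContDiff ℝ ∞ u) : ContDiff ℝ ∞ (Δ u) := by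
  rw [laplacian_eq_fderiv' hu]
  exact (contDiff_fderiv_apply (contDiff_fderiv_apply hu _) _).add
    (contDiff_fderiv_apply (contDiff_fderiv_apply hu _) _)

theorem tsupport_laplacian_subset (u : ℂ → ℝ) : tsupport (Δ u) ⊆ tsupport u := by
  apply closure_minimal _ (isClosed_tsupport u)
  intro z hz
  by_contra h
  apply hz
  have h0 : u =ᶠ[𝓝 z] fun _ => (0 : ℝ) := notMem_tsupport_iff_eventuallyEq.mp h
  rw [(laplacian_congr_nhds h0).eq_of_nhds]
  simp

theorem hasCompactSupport_laplacian {u : ℂ → ℝ} (hu : HasCompactSupport u) :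
    HasCompactSupport (Δ u) :=
  hu.mono' (subset_closure.trans (tsupport_laplacian_subset u))

theorem hasCompactSupport_fderiv_apply {u : ℂ → ℝ} (hu : HasCompactSupport u) (v : ℂ) :
    HasCompactSupport (fun w => fderiv ℝ u w v) :=
  hu.fderiv_apply (𝕜 := ℝ) v

theorem integral_mul_fderiv_fderiv {u w : ℂ → ℝ} (hu : ContDiff ℝ ∞ u) (hw : ContDiff ℝ ∞ w)
    (hc : HasCompactSupport w) (v : ℂ) :
    ∫ z, u z * fderiv ℝ (fun z => fderiv ℝ w z v) z v =
      ∫ z, fderiv ℝ (fun z => fderiv ℝ u z v) z v * w z := by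
  have hu1 := contDiff_fderiv_apply hu v
  have hw1 := contDiff_fderiv_apply hw v
  have hu2 := contDiff_fderiv_apply hu1 v
  have hw2 := contDiff_fderiv_apply hw1 v
  have hc1 := hasCompactSupport_fderiv_apply hc v
  have hc2 := hasCompactSupport_fderiv_apply hc1 v
  have hi : ∀ {a b : ℂ → ℝ}, ContDiff ℝ ∞ a → ContDiff ℝ ∞ b → HasCompactSupport b →
      Integrable (fun z => a z * b z) := fun ha hb hcb =>
    (ha.continuous.mul hb.continuous).integrable_of_hasCompactSupport hcb.mul_left
  have hd : ∀ {a : ℂ → ℝ}, ContDiff ℝ ∞ a → Differentiable ℝ a := fun ha =>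
    ha.differentiable (by simp)
  rw [integral_mul_fderiv_eq_neg_fderiv_mul_of_integrable (hi hu1 hw1 hc1) (hi hu hw2 hc2)
    (hi hu hw1 hc1) (fun x _ => hd hu x) (fun x _ => hd hw1 x),
    integral_mul_fderiv_eq_neg_fderiv_mul_of_integrable (hi hu2 hw hc) (hi hu1 hw1 hc1)
    (hi hu1 hw hc) (fun x _ => hd hu1 x) (fun x _ => hd hw x), neg_neg]

/-- Green's second identity on the plane. -/
theorem integral_mul_laplacian {u w : ℂ → ℝ} (hu : ContDiff ℝ ∞ u) (hw : ContDiff ℝ ∞ w)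
    (hc : HasCompactSupport w) : ∫ z, u z * Δ w z = ∫ z, Δ u z * w z := by
  have hi : ∀ {a b : ℂ → ℝ}, ContDiff ℝ ∞ a → ContDiff ℝ ∞ b → HasCompactSupport b →
      Integrable (fun z => a z * b z) := fun ha hb hcb =>
    (ha.continuous.mul hb.continuous).integrable_of_hasCompactSupport hcb.mul_left
  rw [laplacian_eq_fderiv' hu, laplacian_eq_fderiv' hw]
  simp only [mul_add, add_mul]
  have h2 := fun v => contDiff_fderiv_apply (contDiff_fderiv_apply hw v) v
  have k2 := fun v => contDiff_fderiv_apply (contDiff_fderiv_apply hu v) v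
  have c2 := fun v => hasCompactSupport_fderiv_apply (hasCompactSupport_fderiv_apply hc v) v
  rw [integral_add (hi hu (h2 _) (c2 _)) (hi hu (h2 _) (c2 _)),
    integral_add (hi (k2 _) hw hc) (hi (k2 _) hw hc),
    integral_mul_fderiv_fderiv hu hw hc, integral_mul_fderiv_fderiv hu hw hc]

/-- A majorant showing that the logarithm is locally integrable in the plane. -/
theorem abs_log_norm_le {w : ℂ} : |Real.log ‖w‖| ≤ ‖w‖⁻¹ + ‖w‖ := by
  rcases eq_or_ne w 0 with rfl | hw
  · simp
  have hp : 0 < ‖w‖ := norm_pos_iff.mpr hw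
  have h1 := Real.log_le_self hp.le
  have h2 := Real.log_le_self (inv_pos.mpr hp).le
  rw [Real.log_inv] at h2
  rw [abs_le]
  constructor <;> linarith [inv_pos.mpr hp]

theorem locallyIntegrable_log_norm : LocallyIntegrable (fun w : ℂ => Real.log ‖w‖) := by
  have hinv : LocallyIntegrable (fun w : ℂ => ‖w‖⁻¹) := by
    rw [locallyIntegrable_iff]
    intro K hK
    obtain ⟨R, hR⟩ := hK.isBounded.subset_ball (0 : ℂ)
    refine IntegrableOn.mono_set ?_ hR
    refine integrableOn_ball_of_norm_le_rpow (C := 1) (α := 1) (by simp) (by simp) ?_ ?_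
    · refine Eventually.of_forall fun x => ?_
      rw [Real.rpow_neg (norm_nonneg _), Real.rpow_one]
      simp
    · exact (measurable_norm.inv).aestronglyMeasurable
  have hn : LocallyIntegrable (fun w : ℂ => ‖w‖) := continuous_norm.locallyIntegrable
  refine (hinv.add hn).mono (Real.measurable_log.comp measurable_norm).aestronglyMeasurable ?_
  refine Eventually.of_forall fun w => ?_
  rw [Real.norm_eq_abs]
  exact abs_log_norm_le.trans (le_abs_self _)

/-- The logarithm `½ log (‖w‖² + δ²)` smoothed at the origin. -/
def regLog (δ : ℝ) (w : ℂ) : ℝ := 2⁻¹ * Real.log (w.re ^ 2 + w.im ^ 2 + δ ^ 2)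

theorem contDiff_regLog {δ : ℝ} (hδ : 0 < δ) : ContDiff ℝ ∞ (regLog δ) := by
  unfold regLog
  have h1 : ContDiff ℝ ∞ (fun w : ℂ => w.re) := Complex.reCLM.contDiff
  have h2 : ContDiff ℝ ∞ (fun w : ℂ => w.im) := Complex.imCLM.contDiff
  refine contDiff_const.mul (ContDiff.log (((h1.pow 2).add (h2.pow 2)).add contDiff_const) ?_)
  intro x; positivity

/-- The Laplacian of the smoothed logarithm is the rescaling by `δ` of the integrable kernel
`2 (‖w‖² + 1)⁻²`. -/
theorem laplacian_regLog {δ : ℝ} (hδ : 0 < δ) (w : ℂ) :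
    Δ (regLog δ) w = 2 * δ ^ 2 / (‖w‖ ^ 2 + δ ^ 2) ^ 2 := by
  rw [laplacian_eq_fderiv' (contDiff_regLog hδ)]
  have hre : ∀ z : ℂ, HasFDerivAt (fun w : ℂ => w.re) Complex.reCLM z :=
    fun z => Complex.reCLM.hasFDerivAt
  have him : ∀ z : ℂ, HasFDerivAt (fun w : ℂ => w.im) Complex.imCLM z :=
    fun z => Complex.imCLM.hasFDerivAt
  have hpos : ∀ z : ℂ, 0 < z.re ^ 2 + z.im ^ 2 + δ ^ 2 := fun z => by positivity
  have hN : ∀ z : ℂ, HasFDerivAt (fun w : ℂ => w.re ^ 2 + w.im ^ 2 + δ ^ 2)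
      ((2 * z.re) • Complex.reCLM + (2 * z.im) • Complex.imCLM) z := by
    intro z
    have := (((hre z).pow 2).add ((him z).pow 2)).add_const (δ ^ 2)
    simpa using this
  have h1 : ∀ z v : ℂ, fderiv ℝ (regLog δ) z v =
      (z.re * v.re + z.im * v.im) * (z.re ^ 2 + z.im ^ 2 + δ ^ 2)⁻¹ := by
    intro z v
    have := ((hN z).log (hpos z).ne').const_mul (2⁻¹ : ℝ)
    rw [show regLog δ = fun w : ℂ => 2⁻¹ * Real.log (w.re ^ 2 + w.im ^ 2 + δ ^ 2) from rfl,
      this.fderiv]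
    simp
    field_simp
  have hnum : ∀ v z : ℂ, HasFDerivAt (fun z : ℂ => z.re * v.re + z.im * v.im)
      (v.re • Complex.reCLM + v.im • Complex.imCLM) z := fun v z =>
    ((hre z).mul_const v.re).add ((him z).mul_const v.im)
  have h2 : ∀ v : ℂ, fderiv ℝ (fun z => fderiv ℝ (regLog δ) z v) w v =
      (v.re ^ 2 + v.im ^ 2) / (w.re ^ 2 + w.im ^ 2 + δ ^ 2) -
        2 * (w.re * v.re + w.im * v.im) ^ 2 / (w.re ^ 2 + w.im ^ 2 + δ ^ 2) ^ 2 := by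
    intro v
    simp_rw [h1]
    have hinv := (hasDerivAt_inv (hpos w).ne').comp_hasFDerivAt w (hN w)
    have := (hnum v w).mul hinv
    have e : (fun z : ℂ => (z.re * v.re + z.im * v.im) * (z.re ^ 2 + z.im ^ 2 + δ ^ 2)⁻¹) =
      ((fun z : ℂ => z.re * v.re + z.im * v.im) * (Inv.inv ∘ fun w : ℂ => w.re ^ 2 + w.im ^ 2 + δ ^ 2)) := rfl
    rw [e, this.fderiv]
    have := (hpos w).ne'
    simp
    field_simp
    ring
  simp only [h2]
  have hn : ‖w‖ ^ 2 = w.re ^ 2 + w.im ^ 2 := by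
    rw [Complex.sq_norm, Complex.normSq_apply]; ring
  rw [hn]
  have := (hpos w).ne'
  simp
  field_simp
  ring

/-! ### The logarithm as a fundamental solution -/

/-- Conformal covariance of the planar Laplacian. -/
theorem laplacian_comp_holomorphic {u : ℂ → ℝ} {F : ℂ → ℂ} {z : ℂ}
    (hu : ContDiffAt ℝ 2 u (F z)) (hF : AnalyticAt ℂ F z) :
    Δ (u ∘ F) z = ‖deriv F z‖ ^ 2 * Δ u (F z) := by
  have hFc : ContDiffAt ℝ 2 F z := (hF.contDiffAt (n := 2)).restrict_scalars ℝ
  rw [laplacian_eq_fderiv (hu.comp z hFc), laplacian_eq_fderiv hu]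
  have hud : ∀ᶠ y in 𝓝 (F z), DifferentiableAt ℝ u y :=
    (hu.eventually (by simp)).mono fun y hy => hy.differentiableAt (by norm_num)
  have hFd : ∀ᶠ w in 𝓝 z, DifferentiableAt ℂ F w :=
    hF.eventually_analyticAt.mono fun w hw => hw.differentiableAt
  have h1 : ∀ v : ℂ, (fun w => fderiv ℝ (u ∘ F) w v) =ᶠ[𝓝 z]
      fun w => fderiv ℝ u (F w) (deriv F w * v) := by
    intro v
    filter_upwards [hF.continuousAt.eventually hud, hFd] with w hw1 hw2
    rw [fderiv_comp w hw1 (hw2.restrictScalars ℝ),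
      (hw2.hasDerivAt.hasFDerivAt.restrictScalars ℝ).fderiv]
    simp [mul_comm]
  set B := fderiv ℝ (fderiv ℝ u) (F z) with hB
  have hdu : HasFDerivAt (fderiv ℝ u) B (F z) :=
    ((hu.fderiv_right (m := 1) (by norm_num)).differentiableAt (by norm_num)).hasFDerivAt
  have hF1 := (hF.differentiableAt.hasDerivAt.hasFDerivAt.restrictScalars ℝ)
  have hF2 := (hF.deriv.differentiableAt.hasDerivAt.hasFDerivAt.restrictScalars ℝ)
  have h2 : ∀ v : ℂ, fderiv ℝ (fun w => fderiv ℝ (u ∘ F) w v) z v =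
      B (deriv F z * v) (deriv F z * v) + fderiv ℝ u (F z) (deriv (deriv F) z * (v * v)) := by
    intro v
    rw [(h1 v).fderiv_eq]
    have hc := hdu.comp z hF1
    have hd := hF2.mul_const' v
    have := hc.clm_apply hd
    rw [show (fun w => fderiv ℝ u (F w) (deriv F w * v)) =
      fun w => (fderiv ℝ u ∘ F) w (deriv F w * v) from rfl, this.fderiv]
    simp [mul_comm, mul_left_comm, add_comm]
  have h3 : ∀ v : ℂ, fderiv ℝ (fun w => fderiv ℝ u w v) (F z) v = B v v := by
    intro v
    have := hdu.clm_apply (hasFDerivAt_const v (F z))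
    rw [this.fderiv]
    simp
  simp only [h2, h3]
  set a := deriv F z
  have e1 : a * 1 = a.re • (1 : ℂ) + a.im • Complex.I := by
    apply Complex.ext <;> simp
  have e2 : a * Complex.I = (-a.im) • (1 : ℂ) + a.re • Complex.I := by
    apply Complex.ext <;> simp
  have hn : ‖a‖ ^ 2 = a.re ^ 2 + a.im ^ 2 := by
    rw [Complex.sq_norm, Complex.normSq_apply]; ring
  have e3 : fderiv ℝ u (F z) (deriv (deriv F) z * (1 * 1)) +
      fderiv ℝ u (F z) (deriv (deriv F) z * (Complex.I * Complex.I)) = 0 := by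
    rw [← map_add]; simp
  rw [e1, e2, hn]
  simp only [map_add, map_smul, add_apply, smul_apply,
    smul_eq_mul] at e3 ⊢
  linear_combination e3

/-- The total mass `∫ 2 (‖w‖² + 1)⁻²` of the Laplacian of `½ log (‖w‖² + 1)`, that is,
`2π`. -/
def logMass : ℝ := ∫ w : ℂ, 2 / (‖w‖ ^ 2 + 1) ^ 2

theorem integrable_logMass : Integrable fun w : ℂ => 2 / (‖w‖ ^ 2 + 1) ^ 2 := by
  have h := integrable_one_add_norm (E := ℂ) (μ := volume) (r := 4) (by simp; norm_num)
  refine (h.const_mul 8).mono' ?_ (Eventually.of_forall fun w => ?_)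
  · exact (by fun_prop : Measurable fun w : ℂ => 2 / (‖w‖ ^ 2 + 1) ^ 2).aestronglyMeasurable
  · have h0 := norm_nonneg w
    rw [Real.norm_of_nonneg (by positivity), Real.rpow_neg (by positivity),
      show (1 + ‖w‖) ^ (4 : ℝ) = (1 + ‖w‖) ^ 4 by norm_cast, ← div_eq_mul_inv,
      div_le_div_iff₀ (by positivity) (by positivity)]
    have : (1 + ‖w‖) ^ 2 ≤ 2 * (‖w‖ ^ 2 + 1) := by nlinarith [sq_nonneg (1 - ‖w‖)]
    nlinarith [mul_self_le_mul_self (by positivity) this]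

theorem logMass_pos : 0 < logMass := by
  unfold logMass
  rw [integral_pos_iff_support_of_nonneg (fun w => by positivity) integrable_logMass]
  have : Function.support (fun w : ℂ => 2 / (‖w‖ ^ 2 + 1) ^ 2) = Set.univ := by
    ext w
    simp only [Function.mem_support, Set.mem_univ, iff_true]
    positivity
  rw [this]
  simp

/-- A majorant of the smoothed logarithms which does not depend on the parameter `δ ≤ 1`. -/
theorem abs_regLog_le {δ : ℝ} (hδ : 0 < δ) (hδ1 : δ ≤ 1) {w : ℂ} (hw : w ≠ 0) :
    |regLog δ w| ≤ |Real.log ‖w‖| + ‖w‖ ^ 2 := by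
  have hp : 0 < ‖w‖ := norm_pos_iff.mpr hw
  have hn : ‖w‖ ^ 2 = w.re ^ 2 + w.im ^ 2 := by
    rw [Complex.sq_norm, Complex.normSq_apply]; ring
  have e : regLog δ w = 2⁻¹ * Real.log (‖w‖ ^ 2 + δ ^ 2) := by rw [regLog, hn]
  rw [e, abs_le]
  have h1 : Real.log (‖w‖ ^ 2) ≤ Real.log (‖w‖ ^ 2 + δ ^ 2) :=
    Real.log_le_log (by positivity) (by nlinarith)
  rw [Real.log_pow] at h1
  have h2 := Real.log_le_sub_one_of_pos (show 0 < ‖w‖ ^ 2 + δ ^ 2 by positivity)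
  have h3 := neg_abs_le (Real.log ‖w‖)
  have h4 := abs_nonneg (Real.log ‖w‖)
  push_cast at h1
  constructor <;> nlinarith

theorem tendsto_regLog {w : ℂ} (hw : w ≠ 0) :
    Tendsto (fun n : ℕ => regLog (1 / ((n : ℝ) + 1)) w) atTop (𝓝 (Real.log ‖w‖)) := by
  have hp : 0 < ‖w‖ := norm_pos_iff.mpr hw
  have hn : w.re ^ 2 + w.im ^ 2 = ‖w‖ ^ 2 := by
    rw [Complex.sq_norm, Complex.normSq_apply]; ring
  have h := (tendsto_one_div_add_atTop_nhds_zero_nat (𝕜 := ℝ)).pow 2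
  have h2 := (h.const_add (‖w‖ ^ 2)).log (by positivity)
  have h3 := h2.const_mul (2⁻¹ : ℝ)
  simp only [regLog, hn]
  convert h3 using 2
  simp [Real.log_pow]

/-- `log ‖w‖` is, up to the factor `logMass`, a fundamental solution of the Laplacian. -/
theorem integral_log_norm_mul_laplacian {φ : ℂ → ℝ} (hφ : ContDiff ℝ ∞ φ)
    (hc : HasCompactSupport φ) : ∫ w, Real.log ‖w‖ * Δ φ w = logMass * φ 0 := by
  have hΔ := contDiff_laplacian hφ
  have hΔc := hasCompactSupport_laplacian hc
  have hpos : ∀ n : ℕ, 0 < 1 / ((n : ℝ) + 1) := fun n => by positivity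
  have hle : ∀ n : ℕ, 1 / ((n : ℝ) + 1) ≤ 1 := fun n => by
    rw [div_le_one (by positivity)]; linarith [n.cast_nonneg (α := ℝ)]
  have hne : ∀ᵐ w : ℂ, w ≠ 0 := by
    simp [ae_iff]
  have hint : Integrable fun w => (|Real.log ‖w‖| + ‖w‖ ^ 2) * |Δ φ w| := by
    have h1 : LocallyIntegrable fun w : ℂ => |Real.log ‖w‖| + ‖w‖ ^ 2 :=
      (locallyIntegrable_log_norm.mono
        (Real.measurable_log.comp measurable_norm).norm.aestronglyMeasurable
        (Eventually.of_forall fun w => by simp)).add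
        (continuous_norm.pow 2 : Continuous fun w : ℂ => ‖w‖ ^ 2).locallyIntegrable
    have := h1.integrable_smul_right_of_hasCompactSupport (g := fun w => |Δ φ w|)
      hΔ.continuous.abs hΔc.norm
    simpa using this
  have lim1 : Tendsto (fun n : ℕ => ∫ w, regLog (1 / ((n : ℝ) + 1)) w * Δ φ w) atTop
      (𝓝 (∫ w, Real.log ‖w‖ * Δ φ w)) := by
    refine tendsto_integral_of_dominated_convergence _ (fun n => ?_) hint (fun n => ?_) ?_
    · exact ((contDiff_regLog (hpos n)).continuous.mul hΔ.continuous).aestronglyMeasurable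
    · filter_upwards [hne] with w hw
      rw [norm_mul, Real.norm_eq_abs, Real.norm_eq_abs]
      exact mul_le_mul_of_nonneg_right (abs_regLog_le (hpos n) (hle n) hw) (abs_nonneg _)
    · filter_upwards [hne] with w hw
      exact (tendsto_regLog hw).mul_const _
  -- rescaling `w = δ u` turns the Laplacian of the smoothed logarithm into a fixed kernel
  have heq : ∀ n : ℕ, ∫ w, regLog (1 / ((n : ℝ) + 1)) w * Δ φ w =
      ∫ u : ℂ, 2 / (‖u‖ ^ 2 + 1) ^ 2 * φ ((1 / ((n : ℝ) + 1)) • u) := by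
    intro n
    set δ := 1 / ((n : ℝ) + 1)
    have hδ : 0 < δ := hpos n
    rw [integral_mul_laplacian (contDiff_regLog hδ) hφ hc]
    have := Measure.integral_comp_smul (volume : Measure ℂ)
      (fun w => Δ (regLog δ) w * φ w) δ
    rw [Complex.finrank_real_complex, abs_of_pos (by positivity), smul_eq_mul] at this
    rw [show ∫ w, Δ (regLog δ) w * φ w = δ ^ 2 * ∫ x : ℂ, Δ (regLog δ) (δ • x) * φ (δ • x) by
      rw [this]; field_simp, ← integral_const_mul]
    congr 1
    funext x
    rw [laplacian_regLog hδ, norm_smul, Real.norm_of_nonneg hδ.le]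
    field_simp
  have lim2 : Tendsto (fun n : ℕ => ∫ u : ℂ, 2 / (‖u‖ ^ 2 + 1) ^ 2 *
      φ ((1 / ((n : ℝ) + 1)) • u)) atTop (𝓝 (logMass * φ 0)) := by
    obtain ⟨C, hC⟩ := hc.exists_bound_of_continuous hφ.continuous
    rw [logMass, ← integral_mul_const]
    refine tendsto_integral_of_dominated_convergence
      (fun u => 2 / (‖u‖ ^ 2 + 1) ^ 2 * C) (fun n => ?_) (integrable_logMass.mul_const C)
      (fun n => Eventually.of_forall fun u => ?_) (Eventually.of_forall fun u => ?_)
    · exact integrable_logMass.aestronglyMeasurable.mul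
        (hφ.continuous.comp (continuous_const_smul _)).aestronglyMeasurable
    · rw [norm_mul, Real.norm_of_nonneg (by positivity)]
      exact mul_le_mul_of_nonneg_left (hC _) (by positivity)
    · refine Tendsto.const_mul _ ?_
      refine (hφ.continuous.tendsto 0).comp ?_
      have := (tendsto_one_div_add_atTop_nhds_zero_nat (𝕜 := ℝ)).smul_const u
      simpa using this
  exact tendsto_nhds_unique lim1 (by simpa only [heq] using lim2)

/-! ### Truncated fundamental solutions and Weyl's lemma -/

/-- A truncated fundamental solution of the planar Laplacian at scale `ε`: a kernel `ℓ ≤ 0`,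
supported in the disc of radius `ε`, with `Δ ℓ = δ₀ + r` where the error `r` is smooth. -/
structure Parametrix (ε : ℝ) where
  /-- the singular kernel -/
  ℓ : ℂ → ℝ
  /-- the smooth error -/
  r : ℂ → ℝ
  locallyIntegrable : LocallyIntegrable ℓ
  nonpos : ∀ w, ℓ w ≤ 0
  ℓ_eq_zero : ∀ w, ε ≤ ‖w‖ → ℓ w = 0
  contDiff : ContDiff ℝ ∞ r
  r_eq_zero : ∀ w, ε ≤ ‖w‖ → r w = 0
  integral_mul_laplacian : ∀ φ : ℂ → ℝ, ContDiff ℝ ∞ φ → HasCompactSupport φ →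
    ∫ w, ℓ w * Δ φ w = φ 0 + ∫ w, r w * φ w

theorem hasCompactSupport_of_eq_zero {g : ℂ → ℝ} {ε : ℝ} (h : ∀ w, ε ≤ ‖w‖ → g w = 0) :
    HasCompactSupport g :=
  HasCompactSupport.intro (isCompact_closedBall (0 : ℂ) ε) fun w hw => h w (by
    simp at hw; exact hw.le)

/-- The kernel is `ℓ = η log ‖w‖ / logMass` with a bump function `η`; the error is `r = -Δ((1 - η)
log ‖w‖) / logMass`, which is smooth and vanishes where `η = 0` because the logarithm is harmonic
away from the origin. -/
theorem exists_parametrix {ε : ℝ} (hε : 0 < ε) (hε1 : ε ≤ 1) : Nonempty (Parametrix ε) := by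
  let η : ContDiffBump (0 : ℂ) := ⟨ε / 4, ε / 2, by positivity, by linarith⟩
  have hη0 : ∀ w : ℂ, ε / 2 ≤ ‖w‖ → η w = 0 := fun w hw =>
    η.zero_of_le_dist (by simpa using hw)
  -- the smooth part of the logarithm, away from the origin
  set g : ℂ → ℝ := fun w => (1 - η w) * Real.log ‖w‖ with hg
  have hgs : ContDiff ℝ ∞ g := by
    rw [contDiff_iff_contDiffAt]
    intro w
    rcases eq_or_ne w 0 with rfl | hw
    · have : g =ᶠ[𝓝 0] fun _ => 0 := by
        filter_upwards [η.eventuallyEq_one] with w hw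
        simp [hg, hw]
      exact contDiffAt_const.congr_of_eventuallyEq this
    · refine (contDiffAt_const.sub η.contDiffAt).mul ?_
      exact ((contDiffAt_norm ℝ hw)).log (norm_ne_zero_iff.mpr hw)
  have hli : LocallyIntegrable fun w => logMass⁻¹ * (η w * Real.log ‖w‖) := by
    refine (locallyIntegrable_log_norm.smul logMass⁻¹).mono ?_ ?_
    · exact ((η.continuous.measurable.mul
        (Real.measurable_log.comp measurable_norm)).const_mul _).aestronglyMeasurable
    · refine Eventually.of_forall fun w => ?_
      simp only [norm_mul, Pi.smul_apply, smul_eq_mul]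
      gcongr
      rw [Real.norm_of_nonneg η.nonneg]
      exact mul_le_of_le_one_left (norm_nonneg _) η.le_one
  refine ⟨{ ℓ := fun w => logMass⁻¹ * (η w * Real.log ‖w‖)
            r := fun w => - (logMass⁻¹ * Δ g w)
            locallyIntegrable := hli
            nonpos := ?_
            ℓ_eq_zero := fun w hw => by simp [hη0 w (by linarith)]
            contDiff := (contDiff_const.mul (contDiff_laplacian hgs)).neg
            r_eq_zero := ?_
            integral_mul_laplacian := ?_ }⟩
  · intro w
    rcases le_or_gt (ε / 2) ‖w‖ with h | h
    · simp [hη0 w h]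
    · refine mul_nonpos_of_nonneg_of_nonpos (inv_pos.mpr logMass_pos).le
        (mul_nonpos_of_nonneg_of_nonpos η.nonneg
          (Real.log_nonpos (norm_nonneg _) (by linarith)))
  · intro w hw
    have hw0 : w ≠ 0 := by rintro rfl; simp at hw; linarith
    have hev : g =ᶠ[𝓝 w] (Real.log ‖id ·‖) := by
      have : ∀ᶠ v : ℂ in 𝓝 w, ε / 2 < ‖v‖ :=
        continuous_norm.continuousAt.eventually (lt_mem_nhds (by linarith))
      filter_upwards [this] with v hv
      simp [hg, hη0 v hv.le]
    have := (analyticAt_id (𝕜 := ℂ)).harmonicAt_log_norm hw0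
    rw [(laplacian_congr_nhds hev).eq_of_nhds, this.2.eq_of_nhds]
    simp
  · intro φ hφ hc
    have hΔ := contDiff_laplacian hφ
    have hΔc := hasCompactSupport_laplacian hc
    have h1 := integral_log_norm_mul_laplacian hφ hc
    have h2 := integral_mul_laplacian hgs hφ hc
    have i1 : Integrable fun w => Real.log ‖w‖ * Δ φ w := by
      simpa using locallyIntegrable_log_norm.integrable_smul_right_of_hasCompactSupport
        hΔ.continuous hΔc
    have i2 : Integrable fun w => g w * Δ φ w :=
      (hgs.continuous.mul hΔ.continuous).integrable_of_hasCompactSupport hΔc.mul_left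
    have h3 : ∫ w, logMass⁻¹ * (η w * Real.log ‖w‖) * Δ φ w =
        logMass⁻¹ * (∫ w, Real.log ‖w‖ * Δ φ w) - logMass⁻¹ * ∫ w, g w * Δ φ w := by
      rw [← mul_sub, ← integral_sub i1 i2, ← integral_const_mul]
      congr 1; funext w
      simp only [hg]; ring
    rw [h3, h1, h2, ← mul_assoc, inv_mul_cancel₀ logMass_pos.ne', one_mul, sub_eq_add_neg]
    congr 1
    rw [← integral_const_mul, ← integral_neg]
    congr 1; funext w; ring

theorem locallyIntegrable_indicator {h : ℂ → ℝ} {K : Set ℂ} (hK : IsCompact K)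
    (hh : ContinuousOn h K) : Integrable (K.indicator h) :=
  (integrable_indicator_iff hK.measurableSet).mpr (hh.integrableOn_compact hK)

namespace Parametrix

variable {ε : ℝ} (P : Parametrix ε)

theorem hasCompactSupport_ℓ : HasCompactSupport P.ℓ := hasCompactSupport_of_eq_zero P.ℓ_eq_zero

theorem hasCompactSupport_r : HasCompactSupport P.r := hasCompactSupport_of_eq_zero P.r_eq_zero

theorem integrable_ℓ : Integrable P.ℓ := by
  have h := P.locallyIntegrable.integrableOn_isCompact P.hasCompactSupport_ℓ.isCompact
  rwa [integrableOn_iff_integrable_of_support_subset (subset_tsupport _)] at h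

/-- The potential `ℓ * s` of a function `s`. -/
def potential (s : ℂ → ℝ) (z : ℂ) : ℝ := ∫ w, P.ℓ w * s (z - w)

/-- The smoothing error term `r * s`. -/
def error (s : ℂ → ℝ) (z : ℂ) : ℝ := ∫ w, P.r w * s (z - w)

theorem error_eq (s : ℂ → ℝ) (z : ℂ) : P.error s z = ∫ w, P.r (z - w) * s w := by
  rw [error, ← integral_sub_left_eq_self _ volume z]
  simp

theorem contDiff_potential {s : ℂ → ℝ} (hs : ContDiff ℝ ∞ s) (hc : HasCompactSupport s) :
    ContDiff ℝ ∞ (P.potential s) :=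
  hc.contDiff_convolution_right (n := ⊤) (ContinuousLinearMap.mul ℝ ℝ) P.locallyIntegrable hs

theorem contDiff_error {s : ℂ → ℝ} (hs : LocallyIntegrable s) :
    ContDiff ℝ ∞ (P.error s) :=
  P.hasCompactSupport_r.contDiff_convolution_left (n := ⊤) (ContinuousLinearMap.mul ℝ ℝ)
    P.contDiff hs

theorem potential_eq_zero {s : ℂ → ℝ} {z : ℂ} (h : ∀ w ∈ Metric.ball z ε, s w = 0) :
    P.potential s z = 0 := by
  rw [potential, integral_eq_zero_of_ae]
  refine Eventually.of_forall fun w => ?_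
  rcases le_or_gt ε ‖w‖ with h' | h'
  · simp [P.ℓ_eq_zero w h']
  · simp [h (z - w) (by simpa using h')]

theorem error_eq_zero {s : ℂ → ℝ} {z : ℂ} (h : ∀ w ∈ Metric.ball z ε, s w = 0) :
    P.error s z = 0 := by
  rw [error, integral_eq_zero_of_ae]
  refine Eventually.of_forall fun w => ?_
  rcases le_or_gt ε ‖w‖ with h' | h'
  · simp [P.r_eq_zero w h']
  · simp [h (z - w) (by simpa using h')]

theorem potential_laplacian {s : ℂ → ℝ} (hs : ContDiff ℝ ∞ s) (hc : HasCompactSupport s) (z : ℂ) :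
    P.potential (Δ s) z = s z + P.error s z := by
  have hF : ∀ w : ℂ, AnalyticAt ℂ (fun w => z - w) w := fun w => by fun_prop
  have h := P.integral_mul_laplacian (fun w => s (z - w)) (hs.comp (contDiff_const.sub contDiff_id))
    (hc.comp_homeomorph (Homeomorph.subLeft z))
  have h2 : ∀ w, Δ (fun w => s (z - w)) w = Δ s (z - w) := by
    intro w
    have := laplacian_comp_holomorphic (u := s) (F := fun w => z - w) (z := w)
      (hs.contDiffAt.of_le (WithTop.coe_le_coe.2 le_top)) (hF w)
    rw [show deriv (fun w : ℂ => z - w) w = -1 by simp] at this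
    simpa [Function.comp_def] using this
  simp only [h2, sub_zero] at h
  exact h

theorem fderiv_potential {s : ℂ → ℝ} (hs : ContDiff ℝ ∞ s) (hc : HasCompactSupport s) (z v : ℂ) :
    fderiv ℝ (P.potential s) z v = P.potential (fun w => fderiv ℝ s w v) z := by
  have h := hc.hasFDerivAt_convolution_right (μ := volume) (ContinuousLinearMap.mul ℝ ℝ)
    P.locallyIntegrable (hs.of_le (by exact_mod_cast le_top)) z
  have : fderiv ℝ (P.potential s) z = _ := h.fderiv
  rw [this, convolution_precompR_apply _ P.locallyIntegrable (hc.fderiv ℝ)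
    (hs.continuous_fderiv (by simp))]
  rfl

/-- The potential solves the Poisson equation up to a smoothing error. -/
theorem laplacian_potential {s : ℂ → ℝ} (hs : ContDiff ℝ ∞ s) (hc : HasCompactSupport s) (z : ℂ) :
    Δ (P.potential s) z = s z + P.error s z := by
  rw [← P.potential_laplacian hs hc, laplacian_eq_fderiv' (P.contDiff_potential hs hc),
    laplacian_eq_fderiv' hs]
  have h1 : ∀ v, fderiv ℝ (fun w => fderiv ℝ (P.potential s) w v) z v =
      P.potential (fun w => fderiv ℝ (fun w => fderiv ℝ s w v) w v) z := by
    intro v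
    simp only [P.fderiv_potential hs hc]
    exact P.fderiv_potential (contDiff_fderiv_apply hs v) (hasCompactSupport_fderiv_apply hc v) z v
  simp only [h1]
  have i : ∀ v, Integrable fun w => P.ℓ w * fderiv ℝ (fun w => fderiv ℝ s w v) (z - w) v := by
    intro v
    have h2 := contDiff_fderiv_apply (contDiff_fderiv_apply hs v) v
    have c2 := hasCompactSupport_fderiv_apply (hasCompactSupport_fderiv_apply hc v) v
    simpa using P.locallyIntegrable.integrable_smul_right_of_hasCompactSupport
      (h2.continuous.comp (continuous_const.sub continuous_id))
      (c2.comp_homeomorph (Homeomorph.subLeft z))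
  simp only [potential, mul_add]
  rw [integral_add (i _) (i _)]

end Parametrix

/-- **Weyl's lemma** for continuous functions. -/
theorem contDiffOn_of_weakly_harmonic {U : Set ℂ} (hU : IsOpen U) {h : ℂ → ℝ}
    (hh : ContinuousOn h U)
    (hw : ∀ φ : ℂ → ℝ, ContDiff ℝ ∞ φ → HasCompactSupport φ → tsupport φ ⊆ U →
      ∫ z, h z * Δ φ z = 0) : ContDiffOn ℝ ∞ h U := by
  intro z₀ hz₀
  obtain ⟨R, hR, hRU⟩ := Metric.nhds_basis_closedBall.mem_iff.mp (hU.mem_nhds hz₀)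
  set ε := min 1 (R / 3) with hε
  have hε0 : 0 < ε := by positivity
  have hε3 : 3 * ε ≤ R := by linarith [min_le_right 1 (R / 3)]
  -- Testing `h` against the potentials of functions supported near `z₀` shows that `h` coincides
  -- near `z₀` with `-Q`, where `Q` is the convolution of `h` with the smooth error kernel.
  -- Everything happens in the ball of radius `3ε`.
  obtain ⟨P⟩ := exists_parametrix hε0 (min_le_left _ _)
  set K := Metric.closedBall z₀ (3 * ε)
  have hKU : K ⊆ U := (Metric.closedBall_subset_closedBall hε3).trans hRU
  have hK : IsCompact K := isCompact_closedBall _ _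
  set H := K.indicator h
  have hH : Integrable H := locallyIntegrable_indicator hK (hh.mono hKU)
  set Q : ℂ → ℝ := fun w => ∫ z, P.r (z - w) * H z with hQ
  have hQs : ContDiff ℝ ∞ Q := by
    have h1 : HasCompactSupport fun w => P.r (-w) :=
      P.hasCompactSupport_r.comp_homeomorph (Homeomorph.neg ℂ)
    have h2 := h1.contDiff_convolution_left (n := ⊤) (μ := volume) (ContinuousLinearMap.mul ℝ ℝ)
      (P.contDiff.comp contDiff_neg) hH.locallyIntegrable
    have h3 : Q = MeasureTheory.convolution (fun w => P.r (-w)) H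
        (ContinuousLinearMap.mul ℝ ℝ) volume := by
      funext w
      rw [convolution_eq_swap]
      simp [hQ]
    rw [h3]
    exact h2
  obtain ⟨C, hC⟩ := P.hasCompactSupport_r.exists_bound_of_continuous P.contDiff.continuous
  -- the identity `h = -Q`, in the weak sense
  have key : ∀ s : ℂ → ℝ, ContDiff ℝ ∞ s → HasCompactSupport s → tsupport s ⊆ Metric.ball z₀ ε →
      ∫ w, s w • (H w + Q w) = 0 := by
    intro s hs hc hsub
    have hs0 : ∀ w, w ∉ Metric.ball z₀ ε → s w = 0 := fun w hw =>
      image_eq_zero_of_notMem_tsupport fun h => hw (hsub h)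
    have hpot0 : ∀ z, z ∉ Metric.closedBall z₀ (2 * ε) → P.potential s z = 0 := by
      intro z hz
      refine P.potential_eq_zero fun w hw => hs0 w fun hw' => hz ?_
      simp only [Metric.mem_ball, Metric.mem_closedBall] at *
      linarith [dist_triangle_left z z₀ w]
    have hts : tsupport (P.potential s) ⊆ Metric.closedBall z₀ (2 * ε) :=
      closure_minimal (fun z hz => by
        by_contra h'; exact hz (hpot0 z h')) Metric.isClosed_closedBall
    have hpc : HasCompactSupport (P.potential s) :=
      HasCompactSupport.intro (isCompact_closedBall _ _) hpot0
    have hsubK : Metric.closedBall z₀ (2 * ε) ⊆ K :=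
      Metric.closedBall_subset_closedBall (by linarith)
    have h1 := hw _ (P.contDiff_potential hs hc) hpc (hts.trans (hsubK.trans hKU))
    have h2 : ∫ z, H z * (s z + P.error s z) = 0 := by
      rw [← h1]
      congr 1; funext z
      rw [← P.laplacian_potential hs hc]
      by_cases hz : z ∈ K
      · simp [H, hz]
      · have : Δ (P.potential s) z = 0 := image_eq_zero_of_notMem_tsupport fun h' =>
          hz (hsubK (hts (tsupport_laplacian_subset _ h')))
        simp [this]
    obtain ⟨D, hD⟩ := hc.exists_bound_of_continuous hs.continuous
    have hsi : Integrable s := hs.continuous.integrable_of_hasCompactSupport hc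
    have iHs : Integrable fun z => H z * s z := hH.mul_bdd (c := D) hs.continuous.aestronglyMeasurable
      (Eventually.of_forall hD)
    have iprod : Integrable (Function.uncurry fun z w => H z * (P.r (z - w) * s w))
        (volume.prod volume) := by
      have := (hH.mul_prod hsi).mul_bdd (c := C) (g := fun p : ℂ × ℂ => P.r (p.1 - p.2))
        (P.contDiff.continuous.comp (continuous_fst.sub continuous_snd)).aestronglyMeasurable
        (Eventually.of_forall fun p => hC _)
      refine this.congr (Eventually.of_forall fun p => ?_)
      simp [Function.uncurry]; ring
    have hsw := integral_integral_swap iprod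
    have e1 : ∫ z, ∫ w, H z * (P.r (z - w) * s w) = ∫ z, H z * P.error s z := by
      congr 1; funext z
      rw [integral_const_mul, P.error_eq]
    have e2 : ∫ w, ∫ z, H z * (P.r (z - w) * s w) = ∫ w, s w * Q w := by
      congr 1; funext w
      rw [← integral_const_mul]
      congr 1; funext z; ring
    have iHe : Integrable fun z => H z * P.error s z := by
      refine (iprod.integral_prod_left).congr (Eventually.of_forall fun z => ?_)
      simp only [Function.uncurry]
      rw [integral_const_mul, P.error_eq]
    have iQ : Integrable fun w => s w * Q w :=
      (hs.continuous.mul hQs.continuous).integrable_of_hasCompactSupport hc.mul_right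
    simp only [mul_add] at h2
    rw [integral_add iHs iHe, ← e1, hsw, e2] at h2
    simp only [smul_eq_mul, mul_add]
    rw [integral_add (by simpa [mul_comm] using iHs) iQ]
    simpa [mul_comm] using h2
  have hball : Metric.ball z₀ ε ⊆ K :=
    Metric.ball_subset_closedBall.trans (Metric.closedBall_subset_closedBall (by linarith))
  have hae := Metric.isOpen_ball.ae_eq_zero_of_integral_contDiff_smul_eq_zero
    (f := fun w => H w + Q w) (μ := volume)
    ((hH.locallyIntegrable.add hQs.continuous.locallyIntegrable).locallyIntegrableOn _) key
  have hHc : ContinuousOn H (Metric.ball z₀ ε) :=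
    (hh.mono (hball.trans hKU)).congr fun w hw => by simp [H, hball hw]
  have heq : Set.EqOn (fun w => H w + Q w) (fun _ => 0) (Metric.ball z₀ ε) := by
    refine Measure.eqOn_open_of_ae_eq (μ := volume) ?_ Metric.isOpen_ball
      (hHc.add hQs.continuous.continuousOn) continuousOn_const
    rw [EventuallyEq, ae_restrict_iff' measurableSet_ball]
    exact hae
  refine ContDiffAt.contDiffWithinAt ?_
  refine (hQs.neg.contDiffAt (x := z₀)).congr_of_eventuallyEq ?_
  filter_upwards [Metric.ball_mem_nhds z₀ hε0] with w hw
  have := heq hw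
  simp only [H, Set.indicator_of_mem (hball hw)] at this
  linarith

/-! ### Test functions and charts -/

section Charts

variable {X : Type*} [TopologicalSpace X] [ChartedSpace ℂ X] [IsManifold 𝓘(ℂ) ω X]

theorem analyticAt_chart_comp {f : X → X} (hf : MDifferentiable 𝓘(ℂ) 𝓘(ℂ) f)
    {e e' : OpenPartialHomeomorph X ℂ} (he : e ∈ atlas ℂ X) (he' : e' ∈ atlas ℂ X) {x : X}
    (hx : x ∈ e.source) (hfx : f x ∈ e'.source) : AnalyticAt ℂ (e' ∘ f ∘ e.symm) (e x) := by
  have : IsManifold 𝓘(ℂ) 1 X := IsManifold.of_le (n := ω) le_top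
  have hopen : IsOpen (e.target ∩ e.symm ⁻¹' (f ⁻¹' e'.source)) :=
    e.isOpen_inter_preimage_symm (e'.open_source.preimage hf.continuous)
  have hd : DifferentiableOn ℂ (e' ∘ f ∘ e.symm) (e.target ∩ e.symm ⁻¹' (f ⁻¹' e'.source)) := by
    intro z hz
    have h1 := mdifferentiableAt_atlas_symm (I := 𝓘(ℂ)) he hz.1
    have h2 := mdifferentiableAt_atlas (I := 𝓘(ℂ)) he' hz.2
    have h3 := h2.comp z ((hf _).comp z h1)
    exact (mdifferentiableAt_iff_differentiableAt.mp h3).differentiableWithinAt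
  refine hd.analyticAt (hopen.mem_nhds ⟨e.map_source hx, ?_⟩)
  simpa [e.left_inv hx] using hfx

instance isManifold_real : IsManifold 𝓘(ℝ, ℂ) ∞ X := by
  apply isManifold_of_contDiffOn
  intro e e' he he' z hz
  have hz' : z ∈ e.target ∧ e.symm z ∈ e'.source := by simpa using hz
  have := analyticAt_chart_comp (f := id) mdifferentiable_id he he' (e.map_target hz'.1) hz'.2
  rw [e.right_inv hz'.1] at this
  exact (this.contDiffAt.restrict_scalars ℝ).contDiffWithinAt

theorem mem_maximalAtlas_real {e : OpenPartialHomeomorph X ℂ} (he : e ∈ atlas ℂ X) :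
    e ∈ IsManifold.maximalAtlas 𝓘(ℝ, ℂ) ∞ X :=
  IsManifold.subset_maximalAtlas he

theorem contMDiffAt_iff_chart {u : X → ℝ} {e : OpenPartialHomeomorph X ℂ} (he : e ∈ atlas ℂ X)
    {x : X} (hx : x ∈ e.source) :
    ContMDiffAt 𝓘(ℝ, ℂ) 𝓘(ℝ, ℝ) ∞ u x ↔ ContDiffAt ℝ ∞ (u ∘ e.symm) (e x) := by
  constructor
  · intro h
    have h1 := contMDiffAt_symm_of_mem_maximalAtlas (mem_maximalAtlas_real he) (e.map_source hx)
    rw [← e.left_inv hx] at h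
    exact (h.comp (e x) h1).contDiffAt
  · intro h
    have h1 := contMDiffAt_of_mem_maximalAtlas (mem_maximalAtlas_real he) hx
    refine (h.contMDiffAt.comp x h1).congr_of_eventuallyEq ?_
    filter_upwards [e.open_source.mem_nhds hx] with y hy
    simp [e.left_inv hy]

theorem IsTestFunction.contDiffAt {u : X → ℝ} (hu : IsTestFunction u)
    {e : OpenPartialHomeomorph X ℂ} (he : e ∈ atlas ℂ X) {z : ℂ} (hz : z ∈ e.target) :
    ContDiffAt ℝ ∞ (u ∘ e.symm) z := by
  have := (contMDiffAt_iff_chart he (e.map_target hz)).mp (hu _)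
  rwa [e.right_inv hz] at this

theorem isTestFunction_of_chart {u : X → ℝ}
    (h : ∀ x : X, ContDiffAt ℝ ∞ (u ∘ (chartAt ℂ x).symm) (chartAt ℂ x x)) : IsTestFunction u :=
  fun x => (contMDiffAt_iff_chart (chart_mem_atlas ℂ x) (mem_chart_source ℂ x)).mpr (h x)

omit [IsManifold 𝓘(ℂ) ω X] in
theorem IsTestFunction.continuous {u : X → ℝ} (hu : IsTestFunction u) : Continuous u :=
  ContMDiff.continuous hu

omit [IsManifold 𝓘(ℂ) ω X] in
theorem isTestFunction_const (c : ℝ) : IsTestFunction fun _ : X => c := contMDiff_const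

omit [IsManifold 𝓘(ℂ) ω X] in
theorem IsTestFunction.add {u v : X → ℝ} (hu : IsTestFunction u) (hv : IsTestFunction v) :
    IsTestFunction fun x => u x + v x := ContMDiff.add hu hv

omit [IsManifold 𝓘(ℂ) ω X] in
theorem IsTestFunction.sub {u v : X → ℝ} (hu : IsTestFunction u) (hv : IsTestFunction v) :
    IsTestFunction fun x => u x - v x := ContMDiff.sub hu hv

omit [IsManifold 𝓘(ℂ) ω X] in
theorem IsTestFunction.mul {u v : X → ℝ} (hu : IsTestFunction u) (hv : IsTestFunction v) :
    IsTestFunction fun x => u x * v x := ContMDiff.mul hu hv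

omit [IsManifold 𝓘(ℂ) ω X] in
theorem IsTestFunction.const_mul {u : X → ℝ} (hu : IsTestFunction u) (c : ℝ) :
    IsTestFunction fun x => c * u x := (isTestFunction_const c).mul hu

omit [IsManifold 𝓘(ℂ) ω X] in
theorem IsTestFunction.sum {ι : Type*} {s : Finset ι} {u : ι → X → ℝ}
    (hu : ∀ i ∈ s, IsTestFunction (u i)) : IsTestFunction fun x => ∑ i ∈ s, u i x :=
  contMDiff_finsetSum hu

theorem IsTestFunction.comp_holomorphic {u : X → ℝ} (hu : IsTestFunction u) {f : X → X}
    (hf : MDifferentiable 𝓘(ℂ) 𝓘(ℂ) f) : IsTestFunction fun x => u (f x) := by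
  refine isTestFunction_of_chart fun x => ?_
  have hx := mem_chart_source ℂ x
  have ha := analyticAt_chart_comp hf (chart_mem_atlas ℂ x) (chart_mem_atlas ℂ (f x)) hx
    (mem_chart_source ℂ (f x))
  have hu' := (contMDiffAt_iff_chart (chart_mem_atlas ℂ (f x)) (mem_chart_source ℂ (f x))).mp
    (hu (f x))
  have hfx : (chartAt ℂ (f x) ∘ f ∘ (chartAt ℂ x).symm) (chartAt ℂ x x) = chartAt ℂ (f x) (f x) := by
    simp
  rw [← hfx] at hu'
  refine (hu'.comp _ (ha.contDiffAt.restrict_scalars ℝ)).congr_of_eventuallyEq ?_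
  have hcont : ContinuousAt (f ∘ (chartAt ℂ x).symm) (chartAt ℂ x x) :=
    hf.continuous.continuousAt.comp ((chartAt ℂ x).continuousAt_symm (mem_chart_target ℂ x))
  have : ∀ᶠ z in 𝓝 (chartAt ℂ x x), (f ∘ (chartAt ℂ x).symm) z ∈ (chartAt ℂ (f x)).source :=
    hcont.eventually_mem ((chartAt ℂ (f x)).open_source.mem_nhds (by simp))
  filter_upwards [this] with z hz
  simp only [Function.comp_apply] at hz ⊢
  rw [(chartAt ℂ (f x)).left_inv hz]

/-- Transport of a function from the plane to the surface by a chart, extended by zero. -/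
def chartPull (e : OpenPartialHomeomorph X ℂ) (w : ℂ → ℝ) : X → ℝ :=
  e.source.indicator fun x => w (e x)

/-- Transport of a function from the surface to the plane by a chart, extended by zero. -/
def chartPush (e : OpenPartialHomeomorph X ℂ) (u : X → ℝ) : ℂ → ℝ :=
  e.target.indicator fun z => u (e.symm z)

omit [ChartedSpace ℂ X] [IsManifold 𝓘(ℂ) ω X] in
theorem chartPull_apply {e : OpenPartialHomeomorph X ℂ} {w : ℂ → ℝ} {x : X} (hx : x ∈ e.source) :
    chartPull e w x = w (e x) := Set.indicator_of_mem hx _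

omit [ChartedSpace ℂ X] [IsManifold 𝓘(ℂ) ω X] in
theorem chartPush_apply {e : OpenPartialHomeomorph X ℂ} {u : X → ℝ} {z : ℂ} (hz : z ∈ e.target) :
    chartPush e u z = u (e.symm z) := Set.indicator_of_mem hz _

omit [ChartedSpace ℂ X] [IsManifold 𝓘(ℂ) ω X] in
theorem chartPush_eq_zero {e : OpenPartialHomeomorph X ℂ} {u : X → ℝ} {z : ℂ}
    (hz : z ∉ e '' tsupport u) : chartPush e u z = 0 := by
  by_cases h : z ∈ e.target
  · rw [chartPush_apply h]
    exact image_eq_zero_of_notMem_tsupport fun h' => hz ⟨_, h', e.right_inv h⟩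
  · exact Set.indicator_of_notMem h _

omit [ChartedSpace ℂ X] [IsManifold 𝓘(ℂ) ω X] in
theorem isCompact_image_tsupport [CompactSpace X] {e : OpenPartialHomeomorph X ℂ} {u : X → ℝ}
    (hu : tsupport u ⊆ e.source) : IsCompact (e '' tsupport u) :=
  (isClosed_tsupport u).isCompact.image_of_continuousOn (e.continuousOn.mono hu)

omit [ChartedSpace ℂ X] [IsManifold 𝓘(ℂ) ω X] in
theorem image_tsupport_subset {e : OpenPartialHomeomorph X ℂ} {u : X → ℝ}
    (hu : tsupport u ⊆ e.source) : e '' tsupport u ⊆ e.target := by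
  rintro _ ⟨x, hx, rfl⟩
  exact e.map_source (hu hx)

omit [ChartedSpace ℂ X] [IsManifold 𝓘(ℂ) ω X] in
theorem hasCompactSupport_chartPush [CompactSpace X] {e : OpenPartialHomeomorph X ℂ} {u : X → ℝ}
    (hu : tsupport u ⊆ e.source) : HasCompactSupport (chartPush e u) :=
  HasCompactSupport.intro (isCompact_image_tsupport hu) fun _ hz => chartPush_eq_zero hz

omit [ChartedSpace ℂ X] [IsManifold 𝓘(ℂ) ω X] in
theorem tsupport_chartPush_subset [CompactSpace X] {e : OpenPartialHomeomorph X ℂ} {u : X → ℝ}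
    (hu : tsupport u ⊆ e.source) : tsupport (chartPush e u) ⊆ e.target := by
  refine Set.Subset.trans (closure_minimal ?_ (isCompact_image_tsupport hu).isClosed)
    (image_tsupport_subset hu)
  intro z hz
  by_contra h
  exact hz (chartPush_eq_zero h)

omit [ChartedSpace ℂ X] [IsManifold 𝓘(ℂ) ω X] in
theorem chartPush_eventuallyEq {e : OpenPartialHomeomorph X ℂ} (u : X → ℝ) {z : ℂ}
    (hz : z ∈ e.target) : chartPush e u =ᶠ[𝓝 z] u ∘ e.symm := by
  filter_upwards [e.open_target.mem_nhds hz] with w hw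
  exact chartPush_apply hw

theorem contDiff_chartPush [CompactSpace X] {e : OpenPartialHomeomorph X ℂ} (he : e ∈ atlas ℂ X)
    {u : X → ℝ} (hu : IsTestFunction u) (hs : tsupport u ⊆ e.source) :
    ContDiff ℝ ∞ (chartPush e u) := by
  rw [contDiff_iff_contDiffAt]
  intro z
  by_cases hz : z ∈ e.target
  · exact (hu.contDiffAt he hz).congr_of_eventuallyEq (chartPush_eventuallyEq u hz)
  · have : z ∉ tsupport (chartPush e u) := fun h => hz (tsupport_chartPush_subset hs h)
    exact contDiffAt_const.congr_of_eventuallyEq (notMem_tsupport_iff_eventuallyEq.mp this)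

omit [ChartedSpace ℂ X] [IsManifold 𝓘(ℂ) ω X] in
theorem continuous_chartPush [CompactSpace X] {e : OpenPartialHomeomorph X ℂ}
    {u : X → ℝ} (hu : Continuous u) (hs : tsupport u ⊆ e.source) :
    Continuous (chartPush e u) := by
  rw [continuous_iff_continuousAt]
  intro z
  by_cases hz : z ∈ e.target
  · exact (hu.continuousAt.comp (e.continuousAt_symm hz)).congr
      (chartPush_eventuallyEq u hz).symm
  · have : z ∉ tsupport (chartPush e u) := fun h => hz (tsupport_chartPush_subset hs h)
    exact continuousAt_const.congr (notMem_tsupport_iff_eventuallyEq.mp this).symm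

omit [ChartedSpace ℂ X] [IsManifold 𝓘(ℂ) ω X] in
theorem tsupport_chartPull_subset [T2Space X] {e : OpenPartialHomeomorph X ℂ}
    {w : ℂ → ℝ} (hc : HasCompactSupport w) (hs : tsupport w ⊆ e.target) :
    tsupport (chartPull e w) ⊆ e.source := by
  have hK : IsCompact (e.symm '' tsupport w) :=
    hc.isCompact.image_of_continuousOn (e.continuousOn_symm.mono hs)
  refine Set.Subset.trans (closure_minimal ?_ hK.isClosed) ?_
  · intro x hx
    have hxs : x ∈ e.source := by
      by_contra h; exact hx (Set.indicator_of_notMem h _)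
    refine ⟨e x, subset_tsupport _ ?_, e.left_inv hxs⟩
    rwa [Function.mem_support, chartPull_apply hxs] at hx
  · rintro _ ⟨z, hz, rfl⟩
    exact e.map_target (hs hz)

/-- A smooth function with compact support in the target of a chart extends by zero to a smooth
function on the surface. -/
theorem isTestFunction_chartPull [T2Space X] {e : OpenPartialHomeomorph X ℂ} (he : e ∈ atlas ℂ X)
    {w : ℂ → ℝ} (hw : ContDiff ℝ ∞ w) (hc : HasCompactSupport w) (hs : tsupport w ⊆ e.target) :
    IsTestFunction (chartPull e w) := by
  intro x
  by_cases hx : x ∈ e.source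
  · rw [contMDiffAt_iff_chart he hx]
    refine hw.contDiffAt.congr_of_eventuallyEq ?_
    filter_upwards [e.open_target.mem_nhds (e.map_source hx)] with z hz
    simp [chartPull_apply (e.map_target hz), e.right_inv hz]
  · have : x ∉ tsupport (chartPull e w) := fun h => hx (tsupport_chartPull_subset hc hs h)
    exact contMDiffAt_const.congr_of_eventuallyEq (notMem_tsupport_iff_eventuallyEq.mp this)

/-- The conformal factor `|f'|²` of a map at a point, read in two charts. -/
def conformalFactor (e e' : OpenPartialHomeomorph X ℂ) (f : X → X) (x : X) : ℝ :=
  ‖deriv (e' ∘ f ∘ e.symm) (e x)‖ ^ 2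

omit [ChartedSpace ℂ X] [IsManifold 𝓘(ℂ) ω X] in
theorem conformalFactor_nonneg (e e' : OpenPartialHomeomorph X ℂ) (f : X → X) (x : X) :
    0 ≤ conformalFactor e e' f x := by unfold conformalFactor; positivity

/-- The chain rule. -/
theorem conformalFactor_comp {f g : X → X} (hf : MDifferentiable 𝓘(ℂ) 𝓘(ℂ) f)
    (hg : MDifferentiable 𝓘(ℂ) 𝓘(ℂ) g) {e e' e'' : OpenPartialHomeomorph X ℂ}
    (he : e ∈ atlas ℂ X) (he' : e' ∈ atlas ℂ X) (he'' : e'' ∈ atlas ℂ X) {x : X}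
    (hx : x ∈ e.source) (hfx : f x ∈ e'.source) (hgx : g (f x) ∈ e''.source) :
    conformalFactor e e'' (fun y => g (f y)) x =
      conformalFactor e' e'' g (f x) * conformalFactor e e' f x := by
  have h1 := (analyticAt_chart_comp hf he he' hx hfx).differentiableAt
  have h2 := (analyticAt_chart_comp hg he' he'' hfx hgx).differentiableAt
  have hval : (e' ∘ f ∘ e.symm) (e x) = e' (f x) := by simp [e.left_inv hx]
  rw [← hval] at h2
  have h3 : (e'' ∘ (fun y => g (f y)) ∘ e.symm) =ᶠ[𝓝 (e x)]
      (e'' ∘ g ∘ e'.symm) ∘ (e' ∘ f ∘ e.symm) := by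
    have hcont : ContinuousAt (f ∘ e.symm) (e x) :=
      hf.continuous.continuousAt.comp (e.continuousAt_symm (e.map_source hx))
    have : ∀ᶠ z in 𝓝 (e x), (f ∘ e.symm) z ∈ e'.source :=
      hcont.eventually_mem (e'.open_source.mem_nhds (by simpa [e.left_inv hx] using hfx))
    filter_upwards [this] with z hz
    simp only [Function.comp_apply] at hz ⊢
    rw [e'.left_inv hz]
  unfold conformalFactor
  rw [h3.deriv_eq, deriv_comp _ h2 h1, norm_mul, hval]
  ring

omit [ChartedSpace ℂ X] [IsManifold 𝓘(ℂ) ω X] in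
theorem conformalFactor_id_self {e : OpenPartialHomeomorph X ℂ} {x : X} (hx : x ∈ e.source) :
    conformalFactor e e (fun y => y) x = 1 := by
  have h3 : (e ∘ (fun y => y) ∘ e.symm) =ᶠ[𝓝 (e x)] id := by
    filter_upwards [e.open_target.mem_nhds (e.map_source hx)] with z hz
    simp [e.right_inv hz]
  unfold conformalFactor
  rw [h3.deriv_eq]
  simp

theorem conformalFactor_id_pos {e e' : OpenPartialHomeomorph X ℂ} (he : e ∈ atlas ℂ X)
    (he' : e' ∈ atlas ℂ X) {x : X} (hx : x ∈ e.source) (hx' : x ∈ e'.source) :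
    0 < conformalFactor e e' (fun y => y) x := by
  have h := conformalFactor_comp (f := fun y => y) (g := fun y => y) mdifferentiable_id
    mdifferentiable_id he he' he hx hx' hx
  rw [conformalFactor_id_self hx] at h
  refine lt_of_le_of_ne (conformalFactor_nonneg _ _ _ _) fun h0 => ?_
  rw [← h0] at h
  simp at h

theorem contMDiffAt_conformalFactor {f : X → X} (hf : MDifferentiable 𝓘(ℂ) 𝓘(ℂ) f)
    {e e' : OpenPartialHomeomorph X ℂ} (he : e ∈ atlas ℂ X) (he' : e' ∈ atlas ℂ X) {x : X}
    (hx : x ∈ e.source) (hfx : f x ∈ e'.source) :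
    ContMDiffAt 𝓘(ℝ, ℂ) 𝓘(ℝ, ℝ) ∞ (conformalFactor e e' f) x := by
  rw [contMDiffAt_iff_chart he hx]
  have h1 := (analyticAt_chart_comp hf he he' hx hfx).deriv
  have h2 : ContDiffAt ℝ ∞ (fun z => ‖deriv (e' ∘ f ∘ e.symm) z‖ ^ 2) (e x) :=
    (contDiff_norm_sq ℝ).contDiffAt.comp _ (h1.contDiffAt.restrict_scalars ℝ)
  refine h2.congr_of_eventuallyEq ?_
  filter_upwards [e.open_target.mem_nhds (e.map_source hx)] with z hz
  simp [conformalFactor, e.right_inv hz]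

end Charts

/-! ### The reference measure -/

/-- A finite smooth partition of unity subordinate to the preferred charts; the functions are
indexed by the base points of these charts. -/
structure ChartPartition (X : Type*) [TopologicalSpace X] [ChartedSpace ℂ X] where
  /-- the base points of the charts in use -/
  index : Finset X
  /-- the functions of the partition -/
  χ : X → X → ℝ
  isTestFunction : ∀ i, IsTestFunction (χ i)
  nonneg : ∀ i x, 0 ≤ χ i x
  sum_eq_one : ∀ x, ∑ i ∈ index, χ i x = 1
  tsupport_subset : ∀ i, tsupport (χ i) ⊆ (chartAt ℂ i).source

theorem exists_chartPartition (X : Type*) [TopologicalSpace X] [T2Space X] [CompactSpace X]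
    [ChartedSpace ℂ X] [IsManifold 𝓘(ℂ) ω X] : Nonempty (ChartPartition X) := by
  obtain ⟨F, hF⟩ := SmoothPartitionOfUnity.exists_isSubordinate_chartAt_source 𝓘(ℝ, ℂ) X
  have hfin : {i | (Function.support (F i)).Nonempty}.Finite :=
    F.locallyFinite.finite_nonempty_of_compact
  refine ⟨⟨hfin.toFinset, fun i => F i, fun i => (F i).contMDiff, fun i x => F.nonneg i x,
    fun x => ?_, fun i => hF i⟩⟩
  rw [← F.sum_eq_one (Set.mem_univ x)]
  refine (finsum_eq_sum_of_support_subset _ fun i hi => ?_).symm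
  simp only [Set.Finite.coe_toFinset, Set.mem_ofPred_eq]
  exact ⟨x, hi⟩

theorem polishSpace_of_surface (X : Type*) [TopologicalSpace X] [T2Space X] [CompactSpace X]
    [ChartedSpace ℂ X] : PolishSpace X := by
  have := ChartedSpace.secondCountable_of_sigmaCompact ℂ X
  let _ := TopologicalSpace.metrizableSpaceMetric X
  infer_instance

section ChartVolume

variable {X : Type*} [TopologicalSpace X] [MeasurableSpace X] [BorelSpace X]

/-- Lebesgue measure transported to the surface by a chart. -/
def chartVolume (e : OpenPartialHomeomorph X ℂ) : Measure X :=
  (volume.restrict e.target).map e.symm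

theorem measurableSet_chart_image (e : OpenPartialHomeomorph X ℂ) {B : Set X}
    (hB : MeasurableSet B) (hBe : B ⊆ e.source) : MeasurableSet (e '' B) := by
  rw [e.image_eq_target_inter_inv_preimage hBe]
  have h : Measurable (e.target.domRestrict e.symm) :=
    (continuousOn_iff_continuous_domRestrict.mp e.continuousOn_symm).measurable
  have : e.target ∩ e.symm ⁻¹' B = Subtype.val '' ((e.target.domRestrict e.symm) ⁻¹' B) := by
    ext z; simp [and_comm]
  rw [this]
  exact e.open_target.measurableSet.subtype_image (h hB)

theorem aemeasurable_chart_symm (e : OpenPartialHomeomorph X ℂ) {S : Set ℂ} (hS : MeasurableSet S)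
    (h : S ⊆ e.target) : AEMeasurable e.symm (volume.restrict S) :=
  (e.continuousOn_symm.mono h).aemeasurable hS

theorem restrict_chartVolume (e : OpenPartialHomeomorph X ℂ) {B : Set X}
    (hB : MeasurableSet B) (hBe : B ⊆ e.source) :
    (chartVolume e).restrict B = (volume.restrict (e '' B)).map e.symm := by
  have hsub : e '' B ⊆ e.target := by
    rintro _ ⟨x, hx, rfl⟩; exact e.map_source (hBe hx)
  have hm := measurableSet_chart_image e hB hBe
  ext A hA
  rw [Measure.restrict_apply hA, chartVolume,
    Measure.map_apply_of_aemeasurable (aemeasurable_chart_symm e e.open_target.measurableSet le_rfl)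
      (hA.inter hB),
    Measure.map_apply_of_aemeasurable (aemeasurable_chart_symm e hm hsub) hA,
    Measure.restrict_apply' e.open_target.measurableSet, Measure.restrict_apply' hm]
  congr 1
  rw [e.image_eq_target_inter_inv_preimage hBe]
  ext z
  simp only [Set.mem_inter_iff, Set.mem_preimage]
  tauto

theorem aemeasurable_chartVolume {β : Type*} [TopologicalSpace β] [MeasurableSpace β] [BorelSpace β]
    (e : OpenPartialHomeomorph X ℂ) {B : Set X} (hB : MeasurableSet B) {g : X → β}
    (hg : ContinuousOn g B) : AEMeasurable g ((chartVolume e).restrict B) :=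
  hg.aemeasurable hB

theorem setLIntegral_chartVolume (e : OpenPartialHomeomorph X ℂ) {B : Set X}
    (hB : MeasurableSet B) (hBe : B ⊆ e.source) {g : X → ℝ≥0∞}
    (hg : AEMeasurable g ((chartVolume e).restrict B)) :
    ∫⁻ x in B, g x ∂chartVolume e = ∫⁻ z in e '' B, g (e.symm z) := by
  have hsub : e '' B ⊆ e.target := by
    rintro _ ⟨x, hx, rfl⟩; exact e.map_source (hBe hx)
  rw [restrict_chartVolume e hB hBe] at hg ⊢
  rw [lintegral_map' hg
    (aemeasurable_chart_symm e (measurableSet_chart_image e hB hBe) hsub)]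

end ChartVolume

theorem det_restrictScalars_toSpanSingleton (a : ℂ) :
    |((ContinuousLinearMap.toSpanSingleton ℂ a).restrictScalars ℝ : ℂ →L[ℝ] ℂ).det| = ‖a‖ ^ 2 := by
  have h : (((ContinuousLinearMap.toSpanSingleton ℂ a).restrictScalars ℝ : ℂ →L[ℝ] ℂ) : ℂ →ₗ[ℝ] ℂ) =
      Algebra.lmul ℝ ℂ a := by
    ext
    simp [mul_comm]
  rw [ContinuousLinearMap.det, h]
  have := Algebra.norm_complex_apply a
  rw [Algebra.norm_apply] at this
  rw [this, Complex.sq_norm, abs_of_nonneg (Complex.normSq_nonneg a)]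

section ChangeOfVariables

variable {X : Type*} [TopologicalSpace X] [ChartedSpace ℂ X] [IsManifold 𝓘(ℂ) ω X]
  [MeasurableSpace X] [BorelSpace X]

theorem continuousOn_conformalFactor {f : X → X} (hf : MDifferentiable 𝓘(ℂ) 𝓘(ℂ) f)
    {e e' : OpenPartialHomeomorph X ℂ} (he : e ∈ atlas ℂ X) (he' : e' ∈ atlas ℂ X) {B : Set X}
    (hBe : B ⊆ e.source) (hBe' : B ⊆ f ⁻¹' e'.source) :
    ContinuousOn (conformalFactor e e' f) B := fun _ hx =>
  (contMDiffAt_conformalFactor hf he he' (hBe hx) (hBe' hx)).continuousAt.continuousWithinAt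

/-- Change of variables by an injective holomorphic map. -/
theorem setLIntegral_chartVolume_image {f : X → X} (hf : MDifferentiable 𝓘(ℂ) 𝓘(ℂ) f)
    {e e' : OpenPartialHomeomorph X ℂ} (he : e ∈ atlas ℂ X) (he' : e' ∈ atlas ℂ X) {B : Set X}
    (hB : MeasurableSet B) (hBe : B ⊆ e.source) (hBe' : B ⊆ f ⁻¹' e'.source)
    (hinj : Set.InjOn f B) (hfB : MeasurableSet (f '' B)) {g : X → ℝ≥0∞} (hg : Measurable g) :
    ∫⁻ y in f '' B, g y ∂chartVolume e' =
      ∫⁻ x in B, ENNReal.ofReal (conformalFactor e e' f x) * g (f x) ∂chartVolume e := by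
  have hfe' : f '' B ⊆ e'.source := by
    rintro _ ⟨x, hx, rfl⟩; exact hBe' hx
  rw [setLIntegral_chartVolume e' hfB hfe' hg.aemeasurable,
    setLIntegral_chartVolume e hB hBe
      (g := fun x => ENNReal.ofReal (conformalFactor e e' f x) * g (f x)) ((ENNReal.measurable_ofReal.comp_aemeasurable (aemeasurable_chartVolume e hB
        (continuousOn_conformalFactor hf he he' hBe hBe'))).mul
        (hg.comp hf.continuous.measurable).aemeasurable)]
  set F : ℂ → ℂ := e' ∘ f ∘ e.symm with hF
  have himg : e' '' (f '' B) = F '' (e '' B) := by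
    rw [Set.image_image, Set.image_image]
    refine Set.image_congr fun x hx => ?_
    simp [hF, e.left_inv (hBe hx)]
  have hd : ∀ z ∈ e '' B, HasFDerivWithinAt F
      ((ContinuousLinearMap.toSpanSingleton ℂ (deriv F z)).restrictScalars ℝ) (e '' B) z := by
    rintro _ ⟨x, hx, rfl⟩
    have := (analyticAt_chart_comp hf he he' (hBe hx) (hBe' hx)).differentiableAt
    exact (this.hasDerivAt.hasFDerivAt.restrictScalars ℝ).hasFDerivWithinAt
  have hinj' : Set.InjOn F (e '' B) := by
    rintro _ ⟨x, hx, rfl⟩ _ ⟨y, hy, rfl⟩ hxy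
    simp only [hF, Function.comp_apply, e.left_inv (hBe hx), e.left_inv (hBe hy)] at hxy
    rw [hinj hx hy (e'.injOn (hBe' hx) (hBe' hy) hxy)]
  have hm := measurableSet_chart_image e hB hBe
  rw [himg, lintegral_image_eq_lintegral_abs_det_fderiv_mul volume hm hd hinj']
  refine setLIntegral_congr_fun hm ?_
  rintro _ ⟨x, hx, rfl⟩
  simp only [det_restrictScalars_toSpanSingleton, conformalFactor, e.left_inv (hBe hx)]
  congr 2
  simp [hF, e.left_inv (hBe hx), e'.left_inv (hBe' hx)]

theorem setLIntegral_chartVolume_transition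
    {e e' : OpenPartialHomeomorph X ℂ} (he : e ∈ atlas ℂ X) (he' : e' ∈ atlas ℂ X) {B : Set X}
    (hB : MeasurableSet B) (hBe : B ⊆ e.source) (hBe' : B ⊆ e'.source)
    {g : X → ℝ≥0∞} (hg : Measurable g) :
    ∫⁻ y in B, g y ∂chartVolume e' =
      ∫⁻ x in B, ENNReal.ofReal (conformalFactor e e' (fun y => y) x) * g x ∂chartVolume e := by
  have := setLIntegral_chartVolume_image (f := fun y => y) mdifferentiable_id he he' hB hBe hBe'
    (fun _ _ _ _ h => h) (by simpa using hB) hg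
  simpa using this

end ChangeOfVariables

namespace ChartPartition

section Density

variable {X : Type*} [TopologicalSpace X] [ChartedSpace ℂ X]
  (P : ChartPartition X)

theorem χ_eq_zero {i x : X} (h : x ∉ (chartAt ℂ i).source) : P.χ i x = 0 :=
  image_eq_zero_of_notMem_tsupport fun h' => h (P.tsupport_subset i h')

/-- The density, read in a chart, of the reference measure of a partition of unity. -/
def volDensity (e : OpenPartialHomeomorph X ℂ) (x : X) : ℝ :=
  ∑ i ∈ P.index, P.χ i x * conformalFactor e (chartAt ℂ i) (fun y => y) x

theorem volDensity_nonneg (e : OpenPartialHomeomorph X ℂ) (x : X) : 0 ≤ P.volDensity e x :=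
  Finset.sum_nonneg fun i _ => mul_nonneg (P.nonneg i x) (conformalFactor_nonneg _ _ _ _)

theorem exists_χ_pos (x : X) : ∃ i ∈ P.index, 0 < P.χ i x := by
  by_contra! h
  have := Finset.sum_nonpos h
  rw [P.sum_eq_one] at this
  linarith

variable [IsManifold 𝓘(ℂ) ω X]

theorem volDensity_pos {e : OpenPartialHomeomorph X ℂ} (he : e ∈ atlas ℂ X) {x : X}
    (hx : x ∈ e.source) : 0 < P.volDensity e x := by
  obtain ⟨i, hi, hpos⟩ := P.exists_χ_pos x
  have hxi : x ∈ (chartAt ℂ i).source := by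
    by_contra h; rw [P.χ_eq_zero h] at hpos; exact lt_irrefl _ hpos
  refine Finset.sum_pos' (fun i _ => mul_nonneg (P.nonneg i x) (conformalFactor_nonneg _ _ _ _))
    ⟨i, hi, mul_pos hpos (conformalFactor_id_pos he (chart_mem_atlas ℂ i) hx hxi)⟩

/-- The densities in two charts differ by the conformal factor of the transition map. -/
theorem volDensity_eq {e e' : OpenPartialHomeomorph X ℂ} (he : e ∈ atlas ℂ X) (he' : e' ∈ atlas ℂ X)
    {x : X} (hx : x ∈ e.source) (hx' : x ∈ e'.source) :
    P.volDensity e x = P.volDensity e' x * conformalFactor e e' (fun y => y) x := by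
  rw [volDensity, volDensity, Finset.sum_mul]
  refine Finset.sum_congr rfl fun i _ => ?_
  by_cases hxi : x ∈ (chartAt ℂ i).source
  · rw [conformalFactor_comp (f := fun y => y) (g := fun y => y) mdifferentiable_id
      mdifferentiable_id he he' (chart_mem_atlas ℂ i) hx hx' hxi]
    ring
  · simp [P.χ_eq_zero hxi]

theorem contMDiffAt_volDensity {e : OpenPartialHomeomorph X ℂ} (he : e ∈ atlas ℂ X)
    {x : X} (hx : x ∈ e.source) : ContMDiffAt 𝓘(ℝ, ℂ) 𝓘(ℝ, ℝ) ∞ (P.volDensity e) x := by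
  unfold volDensity
  refine contMDiffAt_finsetSum fun i _ => ?_
  by_cases h : x ∈ tsupport (P.χ i)
  · exact (P.isTestFunction i x).mul (contMDiffAt_conformalFactor mdifferentiable_id he
      (chart_mem_atlas ℂ i) hx (P.tsupport_subset i h))
  · refine (contMDiffAt_const (c := (0 : ℝ))).congr_of_eventuallyEq ?_
    filter_upwards [notMem_tsupport_iff_eventuallyEq.mp h] with y hy
    simp [hy]

theorem continuousOn_volDensity {e : OpenPartialHomeomorph X ℂ} (he : e ∈ atlas ℂ X) :
    ContinuousOn (P.volDensity e) e.source := fun _ hx =>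
  (P.contMDiffAt_volDensity he hx).continuousAt.continuousWithinAt

end Density

section Volume

variable {X : Type*} [TopologicalSpace X] [ChartedSpace ℂ X]
  [MeasurableSpace X] [BorelSpace X] (P : ChartPartition X)

/-- The reference measure of a partition of unity, `∑ χ_i · Lebesgue` in the charts. It has a smooth
positive density in every chart. -/
def vol : Measure X :=
  ∑ i ∈ P.index, (chartVolume (chartAt ℂ i)).withDensity fun x => ENNReal.ofReal (P.χ i x)

theorem measurable_χ (i : X) : Measurable (P.χ i) := (P.isTestFunction i).continuous.measurable

theorem setLIntegral_eq_inter {μ : Measure X} {B S : Set X} (hS : MeasurableSet S)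
    {g : X → ℝ≥0∞} (h : ∀ x, x ∉ S → g x = 0) :
    ∫⁻ x in B, g x ∂μ = ∫⁻ x in B ∩ S, g x ∂μ := by
  rw [← lintegral_inter_add_sdiff g B hS]
  have h0 : ∫⁻ x in B \ S, g x ∂μ ≤ ∫⁻ x in Sᶜ, g x ∂μ :=
    lintegral_mono_set fun x hx => hx.2
  have h1 : ∫⁻ x in Sᶜ, g x ∂μ = 0 := by
    rw [setLIntegral_congr_fun (g := fun _ => 0) hS.compl fun x hx => h x hx]
    simp
  rw [le_antisymm (h0.trans h1.le) zero_le, add_zero]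

theorem ofReal_χ_eq_zero {i x : X} (h : x ∉ (chartAt ℂ i).source) :
    ENNReal.ofReal (P.χ i x) = 0 := by rw [P.χ_eq_zero h, ENNReal.ofReal_zero]

variable [IsManifold 𝓘(ℂ) ω X]

theorem vol_apply {e : OpenPartialHomeomorph X ℂ} (he : e ∈ atlas ℂ X) {B : Set X}
    (hB : MeasurableSet B) (hBe : B ⊆ e.source) :
    P.vol B = ∫⁻ x in B, ENNReal.ofReal (P.volDensity e x) ∂chartVolume e := by
  have hS : ∀ i, MeasurableSet (chartAt ℂ i : OpenPartialHomeomorph X ℂ).source := fun i =>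
    (chartAt ℂ i).open_source.measurableSet
  rw [vol, Measure.finsetSum_apply]
  have h1 : ∀ i ∈ P.index, ((chartVolume (chartAt ℂ i)).withDensity
      fun x => ENNReal.ofReal (P.χ i x)) B =
      ∫⁻ x in B, ENNReal.ofReal (P.χ i x * conformalFactor e (chartAt ℂ i) (fun y => y) x)
        ∂chartVolume e := by
    intro i _
    rw [withDensity_apply _ hB, setLIntegral_eq_inter (hS i) (fun x => P.ofReal_χ_eq_zero),
      setLIntegral_eq_inter (B := B) (hS i) (g := fun x => ENNReal.ofReal (P.χ i x *
        conformalFactor e (chartAt ℂ i) (fun y => y) x)) (fun x hx => by simp [P.χ_eq_zero hx]),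
      setLIntegral_chartVolume_transition he (chart_mem_atlas ℂ i) (hB.inter (hS i))
        (Set.inter_subset_left.trans hBe) Set.inter_subset_right (P.measurable_χ i).ennreal_ofReal]
    congr 1; funext x
    rw [mul_comm, ENNReal.ofReal_mul (P.nonneg i x)]
  rw [Finset.sum_congr rfl h1]
  have h2 : ∀ x, ENNReal.ofReal (P.volDensity e x) = ∑ i ∈ P.index,
      ENNReal.ofReal (P.χ i x * conformalFactor e (chartAt ℂ i) (fun y => y) x) := fun x =>
    ENNReal.ofReal_sum_of_nonneg fun i _ =>
      mul_nonneg (P.nonneg i x) (conformalFactor_nonneg _ _ _ _)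
  simp only [h2]
  rw [lintegral_finsetSum']
  intro i _
  refine ENNReal.measurable_ofReal.comp_aemeasurable (aemeasurable_chartVolume e hB ?_)
  intro x hx
  have hxe := hBe hx
  refine ContMDiffAt.continuousAt (I := 𝓘(ℝ, ℂ)) (I' := 𝓘(ℝ, ℝ)) (n := ∞) ?_ |>.continuousWithinAt
  by_cases h : x ∈ tsupport (P.χ i)
  · exact (P.isTestFunction i x).mul (contMDiffAt_conformalFactor mdifferentiable_id he
      (chart_mem_atlas ℂ i) hxe (P.tsupport_subset i h))
  · refine (contMDiffAt_const (c := (0 : ℝ))).congr_of_eventuallyEq ?_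
    filter_upwards [notMem_tsupport_iff_eventuallyEq.mp h] with y hy
    simp [hy]

theorem restrict_vol {e : OpenPartialHomeomorph X ℂ} (he : e ∈ atlas ℂ X) {B : Set X}
    (hB : MeasurableSet B) (hBe : B ⊆ e.source) :
    P.vol.restrict B =
      ((chartVolume e).restrict B).withDensity fun x => ENNReal.ofReal (P.volDensity e x) := by
  ext A hA
  rw [Measure.restrict_apply hA, P.vol_apply he (hA.inter hB) (Set.inter_subset_right.trans hBe),
    withDensity_apply _ hA, Measure.restrict_restrict hA]

theorem aemeasurable_volDensity {e : OpenPartialHomeomorph X ℂ} (he : e ∈ atlas ℂ X) {B : Set X}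
    (hB : MeasurableSet B) (hBe : B ⊆ e.source) :
    AEMeasurable (P.volDensity e) ((chartVolume e).restrict B) :=
  aemeasurable_chartVolume e hB ((P.continuousOn_volDensity he).mono hBe)

theorem setLIntegral_vol {e : OpenPartialHomeomorph X ℂ} (he : e ∈ atlas ℂ X) {B : Set X}
    (hB : MeasurableSet B) (hBe : B ⊆ e.source) {g : X → ℝ≥0∞}
    (hg : AEMeasurable g ((chartVolume e).restrict B)) :
    ∫⁻ x in B, g x ∂P.vol =
      ∫⁻ x in B, ENNReal.ofReal (P.volDensity e x) * g x ∂chartVolume e := by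
  rw [P.restrict_vol he hB hBe, lintegral_withDensity_eq_lintegral_mul₀
    (P.aemeasurable_volDensity he hB hBe).ennreal_ofReal hg]
  rfl

theorem setIntegral_vol {e : OpenPartialHomeomorph X ℂ} (he : e ∈ atlas ℂ X)
    {g : X → ℝ} (hg : Measurable g) :
    ∫ x in e.source, g x ∂P.vol =
      ∫ z in e.target, P.volDensity e (e.symm z) * g (e.symm z) := by
  have hm := e.open_source.measurableSet
  have hT : e '' e.source = e.target := e.image_source_eq_target
  rw [P.restrict_vol he hm le_rfl, integral_withDensity_eq_integral_toReal_smul₀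
    (P.aemeasurable_volDensity he hm le_rfl).ennreal_ofReal
    (Eventually.of_forall fun x => ENNReal.ofReal_lt_top)]
  have hae : AEStronglyMeasurable (fun x => (ENNReal.ofReal (P.volDensity e x)).toReal • g x)
      ((chartVolume e).restrict e.source) :=
    ((P.aemeasurable_volDensity he hm le_rfl).ennreal_ofReal.ennreal_toReal.mul
      hg.aemeasurable).aestronglyMeasurable
  rw [restrict_chartVolume e hm le_rfl, hT] at hae ⊢
  rw [integral_map (aemeasurable_chart_symm e e.open_target.measurableSet le_rfl) hae]
  congr 1; funext z
  rw [ENNReal.toReal_ofReal (P.volDensity_nonneg e _), smul_eq_mul]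

instance isFiniteMeasure_vol [CompactSpace X] : IsFiniteMeasure P.vol := by
  constructor
  rw [vol, Measure.finsetSum_apply]
  refine ENNReal.sum_lt_top.mpr fun i _ => ?_
  set e : OpenPartialHomeomorph X ℂ := chartAt ℂ i
  have hm : MeasurableSet (tsupport (P.χ i)) := (isClosed_tsupport _).measurableSet
  rw [withDensity_apply _ MeasurableSet.univ, setLIntegral_eq_inter hm
    (fun x hx => by rw [image_eq_zero_of_notMem_tsupport hx, ENNReal.ofReal_zero]), Set.univ_inter]
  obtain ⟨C, hC⟩ := (isCompact_univ (X := X)).exists_bound_of_continuousOn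
    (P.isTestFunction i).continuous.continuousOn
  calc ∫⁻ x in tsupport (P.χ i), ENNReal.ofReal (P.χ i x) ∂chartVolume e
      ≤ ∫⁻ x in tsupport (P.χ i), ENNReal.ofReal C ∂chartVolume e :=
        lintegral_mono fun x => ENNReal.ofReal_le_ofReal
          ((le_abs_self _).trans (hC x (Set.mem_univ x)))
    _ = ENNReal.ofReal C * volume (e '' tsupport (P.χ i)) := by
        rw [setLIntegral_chartVolume e hm (P.tsupport_subset i) aemeasurable_const]
        simp
    _ < ⊤ := ENNReal.mul_lt_top ENNReal.ofReal_lt_top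
        (isCompact_image_tsupport (P.tsupport_subset i)).measure_lt_top

instance isOpenPosMeasure_vol : P.vol.IsOpenPosMeasure := by
  constructor
  rintro U hU ⟨x, hx⟩ h0
  set e : OpenPartialHomeomorph X ℂ := chartAt ℂ x
  have he : e ∈ atlas ℂ X := chart_mem_atlas ℂ x
  have hB : MeasurableSet (U ∩ e.source) := (hU.inter e.open_source).measurableSet
  have h1 := measure_mono_null (Set.inter_subset_left (t := e.source)) h0
  rw [P.vol_apply he hB Set.inter_subset_right, setLIntegral_eq_zero_iff' hB
    (P.aemeasurable_volDensity he hB Set.inter_subset_right).ennreal_ofReal] at h1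
  have himg : IsOpen (e '' (U ∩ e.source)) := by
    rw [e.image_eq_target_inter_inv_preimage Set.inter_subset_right]
    exact e.isOpen_inter_preimage_symm (hU.inter e.open_source)
  have hpos : 0 < volume (e '' (U ∩ e.source)) :=
    himg.measure_pos volume ⟨_, x, ⟨hx, mem_chart_source ℂ x⟩, rfl⟩
  have h2 : chartVolume e (U ∩ e.source) = 0 := by
    refine measure_mono_null (fun y hy => ?_) h1
    simpa using ⟨hy.1, hy.2, P.volDensity_pos he hy.2⟩
  have h3 := setLIntegral_chartVolume e hB Set.inter_subset_right
    (g := fun _ => 1) aemeasurable_const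
  simp only [lintegral_const, one_mul, Measure.restrict_apply MeasurableSet.univ,
    Set.univ_inter, h2] at h3
  exact hpos.ne h3

/-- A smooth probability measure has a smooth density with respect to the reference measure: the
local densities are glued by the partition of unity. -/
theorem exists_density {ω₀ : Measure X} (hω : IsSmoothProbability ω₀) :
    ∃ s : X → ℝ, IsTestFunction s ∧ (∀ x, 0 ≤ s x) ∧
      ω₀ = P.vol.withDensity fun x => ENNReal.ofReal (s x) := by
  choose ρ hρs hρ0 hρ using fun i : X => hω.smooth (chartAt ℂ i) (chart_mem_atlas ℂ i)
  -- the density relative to the reference measure, valid on the domain of the `i`-th chart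
  set t : X → X → ℝ := fun i x => ρ i (chartAt ℂ i x) / P.volDensity (chartAt ℂ i) x with ht
  have hS : ∀ i, MeasurableSet (chartAt ℂ i : OpenPartialHomeomorph X ℂ).source := fun i =>
    (chartAt ℂ i).open_source.measurableSet
  have ht0 : ∀ i, ∀ x ∈ (chartAt ℂ i).source, 0 ≤ t i x := fun i x hx =>
    div_nonneg (hρ0 i _ ((chartAt ℂ i).map_source hx)) (P.volDensity_nonneg _ _)
  have hts : ∀ i, ∀ x ∈ (chartAt ℂ i).source, ContMDiffAt 𝓘(ℝ, ℂ) 𝓘(ℝ, ℝ) ∞ (t i) x := by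
    intro i x hx
    have h1 : ContMDiffAt 𝓘(ℝ, ℂ) 𝓘(ℝ, ℝ) ∞ (fun x => ρ i (chartAt ℂ i x)) x := by
      have h2 := (hρs i).contDiffAt ((chartAt ℂ i).open_target.mem_nhds
        ((chartAt ℂ i).map_source hx))
      exact h2.contMDiffAt.comp x
        (contMDiffAt_of_mem_maximalAtlas (mem_maximalAtlas_real (chart_mem_atlas ℂ i)) hx)
    exact h1.div₀ (P.contMDiffAt_volDensity (chart_mem_atlas ℂ i) hx)
      (P.volDensity_pos (chart_mem_atlas ℂ i) hx).ne'
  have htc : ∀ i, ContinuousOn (t i) (chartAt ℂ i).source := fun i x hx =>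
    (hts i x hx).continuousAt.continuousWithinAt
  have hloc : ∀ i, ω₀.restrict (chartAt ℂ i).source =
      (P.vol.restrict (chartAt ℂ i).source).withDensity fun x => ENNReal.ofReal (t i x) := by
    intro i
    set e : OpenPartialHomeomorph X ℂ := chartAt ℂ i
    have he : e ∈ atlas ℂ X := chart_mem_atlas ℂ i
    ext A hA
    have hB : MeasurableSet (A ∩ e.source) := hA.inter (hS i)
    have hBe : A ∩ e.source ⊆ e.source := Set.inter_subset_right
    have hm := measurableSet_chart_image e hB hBe
    have hsub : e '' (A ∩ e.source) ⊆ e.target := by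
      rintro _ ⟨x, hx, rfl⟩; exact e.map_source hx.2
    have h1 := congrArg (fun μ => μ (e '' (A ∩ e.source))) (hρ i)
    rw [Measure.map_apply_of_aemeasurable (e.continuousOn.aemeasurable (hS i)) hm,
      withDensity_apply _ hm, Measure.restrict_restrict hm, Set.inter_eq_left.mpr hsub,
      Measure.restrict_apply' (hS i)] at h1
    have h2 : e ⁻¹' (e '' (A ∩ e.source)) ∩ e.source = A ∩ e.source := by
      ext x
      constructor
      · rintro ⟨⟨y, hy, hxy⟩, hx⟩
        rwa [← e.injOn hy.2 hx hxy]
      · exact fun hx => ⟨⟨x, hx, rfl⟩, hx.2⟩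
    rw [h2] at h1
    rw [Measure.restrict_apply hA, withDensity_apply _ hA, Measure.restrict_restrict hA,
      P.setLIntegral_vol he hB hBe
        (aemeasurable_chartVolume e hB ((htc i).mono hBe)).ennreal_ofReal, h1,
      setLIntegral_chartVolume e hB hBe
        (g := fun x => ENNReal.ofReal (P.volDensity e x) * ENNReal.ofReal (t i x))
        ((P.aemeasurable_volDensity he hB hBe).ennreal_ofReal.mul
        (aemeasurable_chartVolume e hB ((htc i).mono hBe)).ennreal_ofReal)]
    refine setLIntegral_congr_fun hm ?_
    rintro _ ⟨x, hx, rfl⟩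
    have hpos := P.volDensity_pos he hx.2
    simp only [e.left_inv hx.2]
    rw [← ENNReal.ofReal_mul hpos.le]
    congr 1
    exact (mul_div_cancel₀ _ hpos.ne').symm
  refine ⟨fun x => ∑ i ∈ P.index, P.χ i x * t i x, fun x => ?_, fun x => ?_, ?_⟩
  · refine contMDiffAt_finsetSum fun i _ => ?_
    by_cases h : x ∈ tsupport (P.χ i)
    · exact (P.isTestFunction i x).mul (hts i x (P.tsupport_subset i h))
    · refine (contMDiffAt_const (c := (0 : ℝ))).congr_of_eventuallyEq ?_
      filter_upwards [notMem_tsupport_iff_eventuallyEq.mp h] with y hy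
      simp [hy]
  · refine Finset.sum_nonneg fun i _ => ?_
    by_cases h : x ∈ (chartAt ℂ i).source
    · exact mul_nonneg (P.nonneg i x) (ht0 i x h)
    · simp [P.χ_eq_zero h]
  · ext A hA
    have h1 : ω₀ A = ∑ i ∈ P.index, ∫⁻ x in A, ENNReal.ofReal (P.χ i x) ∂ω₀ := by
      rw [← lintegral_finsetSum _ fun i _ => (P.measurable_χ i).ennreal_ofReal]
      simp_rw [← ENNReal.ofReal_sum_of_nonneg fun i (_ : i ∈ P.index) => P.nonneg i _,
        P.sum_eq_one]
      simp
    have h2 : ∀ i ∈ P.index, ∫⁻ x in A, ENNReal.ofReal (P.χ i x) ∂ω₀ =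
        ∫⁻ x in A, ENNReal.ofReal (P.χ i x * t i x) ∂P.vol := by
      intro i _
      have hz : ∀ x, x ∉ (chartAt ℂ i).source → ENNReal.ofReal (P.χ i x * t i x) = 0 := by
        intro x hx; simp [P.χ_eq_zero hx]
      rw [setLIntegral_eq_inter (hS i) (fun x => P.ofReal_χ_eq_zero),
        setLIntegral_eq_inter (B := A) (hS i) hz, ← Measure.restrict_restrict hA,
        ← Measure.restrict_restrict hA, hloc i, restrict_withDensity hA,
        lintegral_withDensity_eq_lintegral_mul₀ _ (P.measurable_χ i).ennreal_ofReal.aemeasurable,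
        Measure.restrict_restrict hA]
      · refine setLIntegral_congr_fun (hA.inter (hS i)) fun x hx => ?_
        simp only [Pi.mul_apply]
        rw [← ENNReal.ofReal_mul (ht0 i x hx.2), mul_comm]
      · rw [Measure.restrict_restrict hA]
        exact (((htc i).mono Set.inter_subset_right).aemeasurable (hA.inter (hS i))).ennreal_ofReal
    have h3 : ∀ x, ENNReal.ofReal (∑ i ∈ P.index, P.χ i x * t i x) =
        ∑ i ∈ P.index, ENNReal.ofReal (P.χ i x * t i x) := fun x =>
      ENNReal.ofReal_sum_of_nonneg fun i _ => by
        by_cases h : x ∈ (chartAt ℂ i).source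
        · exact mul_nonneg (P.nonneg i x) (ht0 i x h)
        · simp [P.χ_eq_zero h]
    rw [h1, Finset.sum_congr rfl h2, withDensity_apply _ hA]
    simp only [h3]
    rw [lintegral_finsetSum]
    intro i _
    have hc : Continuous fun x => P.χ i x * t i x := by
      rw [continuous_iff_continuousAt]
      intro x
      by_cases h : x ∈ tsupport (P.χ i)
      · exact (P.isTestFunction i).continuous.continuousAt.mul
          (hts i x (P.tsupport_subset i h)).continuousAt
      · refine (continuousAt_const (y := (0 : ℝ))).congr ?_
        filter_upwards [notMem_tsupport_iff_eventuallyEq.mp h] with y hy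
        simp [hy]
    exact hc.measurable.ennreal_ofReal

end Volume

end ChartPartition

/-! ### The Laplacian on the surface -/

theorem contDiffAt_laplacian {u : ℂ → ℝ} {z : ℂ} (hu : ContDiffAt ℝ ∞ u z) :
    ContDiffAt ℝ ∞ (Δ u) z := by
  have h1 : ∀ v w : ℂ, ContDiffAt ℝ ∞ (fun z => fderiv ℝ (fun w => fderiv ℝ u w v) z w) z := by
    intro v w
    have h2 : ContDiffAt ℝ ∞ (fun w => fderiv ℝ u w v) z :=
      (hu.fderiv_right (m := ∞) (by simp)).clm_apply contDiffAt_const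
    exact (h2.fderiv_right (m := ∞) (by simp)).clm_apply contDiffAt_const
  refine ((h1 1 1).add (h1 Complex.I Complex.I)).congr_of_eventuallyEq ?_
  have h2 : ContDiffAt ℝ 2 u z := hu.of_le (WithTop.coe_le_coe.2 le_top)
  filter_upwards [h2.eventually (by simp)] with w hw
  exact laplacian_eq_fderiv hw

/-- `Δ(u²) = 2 u Δu + 2 |∇u|²`. -/
theorem laplacian_mul_self {u : ℂ → ℝ} {z : ℂ} (hu : ContDiffAt ℝ 2 u z) :
    Δ (fun w => u w * u w) z = 2 * u z * Δ u z +
      2 * ((fderiv ℝ u z 1) ^ 2 + (fderiv ℝ u z Complex.I) ^ 2) := by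
  rw [laplacian_eq_fderiv (hu.mul hu), laplacian_eq_fderiv hu]
  have hd : ∀ᶠ w in 𝓝 z, DifferentiableAt ℝ u w :=
    (hu.eventually (by simp)).mono fun w hw => hw.differentiableAt (by norm_num)
  have hd1 := hu.differentiableAt (by norm_num)
  have h1 : ∀ v : ℂ, fderiv ℝ (fun w => fderiv ℝ (fun w => u w * u w) w v) z v =
      2 * u z * fderiv ℝ (fun w => fderiv ℝ u w v) z v + 2 * (fderiv ℝ u z v) ^ 2 := by
    intro v
    have h2 : (fun w => fderiv ℝ (fun w => u w * u w) w v) =ᶠ[𝓝 z]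
        fun w => 2 * (u w * fderiv ℝ u w v) := by
      filter_upwards [hd] with w hw
      rw [fderiv_fun_mul hw hw]
      simp; ring
    have h3 : DifferentiableAt ℝ (fun w => fderiv ℝ u w v) z :=
      ((hu.fderiv_right (m := 1) (by norm_num)).differentiableAt (by norm_num)).clm_apply
        (differentiableAt_const _)
    have h4 : HasFDerivAt (fun w => 2 * (u w * fderiv ℝ u w v)) _ z :=
      (hd1.hasFDerivAt.mul h3.hasFDerivAt).const_mul 2
    rw [h2.fderiv_eq, h4.fderiv]
    simp; ring
  rw [h1, h1]; ring

theorem fderiv_eq_zero_of_apply {u : ℂ → ℝ} {z : ℂ} (h1 : fderiv ℝ u z 1 = 0)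
    (h2 : fderiv ℝ u z Complex.I = 0) : fderiv ℝ u z = 0 := by
  ext v
  have : v = v.re • (1 : ℂ) + v.im • Complex.I := by apply Complex.ext <;> simp
  rw [this, map_add, map_smul, map_smul, h1, h2]
  simp

section Surface

variable {X : Type*} [TopologicalSpace X] [ChartedSpace ℂ X] [IsManifold 𝓘(ℂ) ω X]

theorem IsTestFunction.contDiffAt_two {u : X → ℝ} (hu : IsTestFunction u)
    {e : OpenPartialHomeomorph X ℂ} (he : e ∈ atlas ℂ X) {z : ℂ} (hz : z ∈ e.target) :
    ContDiffAt ℝ 2 (u ∘ e.symm) z :=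
  (hu.contDiffAt he hz).of_le (WithTop.coe_le_coe.2 le_top)

/-- Conformal covariance of the Laplacian read in charts. -/
theorem laplacian_chart_comp {u : X → ℝ} (hu : IsTestFunction u) {f : X → X}
    (hf : MDifferentiable 𝓘(ℂ) 𝓘(ℂ) f) {e e' : OpenPartialHomeomorph X ℂ} (he : e ∈ atlas ℂ X)
    (he' : e' ∈ atlas ℂ X) {x : X} (hx : x ∈ e.source) (hfx : f x ∈ e'.source) :
    Δ ((fun y => u (f y)) ∘ e.symm) (e x) =
      conformalFactor e e' f x * Δ (u ∘ e'.symm) (e' (f x)) := by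
  have ha := analyticAt_chart_comp hf he he' hx hfx
  have hval : (e' ∘ f ∘ e.symm) (e x) = e' (f x) := by simp [e.left_inv hx]
  have h3 : ((fun y => u (f y)) ∘ e.symm) =ᶠ[𝓝 (e x)]
      (u ∘ e'.symm) ∘ (e' ∘ f ∘ e.symm) := by
    have hcont : ContinuousAt (f ∘ e.symm) (e x) :=
      hf.continuous.continuousAt.comp (e.continuousAt_symm (e.map_source hx))
    have : ∀ᶠ z in 𝓝 (e x), (f ∘ e.symm) z ∈ e'.source :=
      hcont.eventually_mem (e'.open_source.mem_nhds (by simpa [e.left_inv hx] using hfx))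
    filter_upwards [this] with z hz
    simp only [Function.comp_apply] at hz ⊢
    rw [e'.left_inv hz]
  have hc : ContDiffAt ℝ 2 (u ∘ e'.symm) ((e' ∘ f ∘ e.symm) (e x)) := by
    rw [hval]; exact hu.contDiffAt_two he' (e'.map_source hfx)
  rw [(laplacian_congr_nhds h3).eq_of_nhds, laplacian_comp_holomorphic hc ha, hval]
  rfl

/-- A smooth Urysohn function, equal to `1` near the closed set. -/
theorem exists_cutoff [T2Space X] [CompactSpace X] {K U : Set X} (hK : IsClosed K) (hU : IsOpen U)
    (hKU : K ⊆ U) : ∃ θ : X → ℝ, IsTestFunction θ ∧ (∀ x, 0 ≤ θ x) ∧ (∀ x, θ x ≤ 1) ∧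
      (∀ x ∈ K, θ =ᶠ[𝓝 x] fun _ => 1) ∧ tsupport θ ⊆ U := by
  obtain ⟨θ, h0, h1, h01⟩ := exists_contMDiffMap_zero_one_nhds_of_isClosed (n := ⊤) 𝓘(ℝ, ℂ)
    hU.isClosed_compl hK (Set.disjoint_compl_left_iff_subset.mpr hKU)
  refine ⟨θ, θ.contMDiff, fun x => (h01 x).1, fun x => (h01 x).2, fun x hx => ?_, fun x hx => ?_⟩
  · exact (eventually_nhdsSet_iff_forall.mp h1) x hx
  · by_contra hxU
    exact (notMem_tsupport_iff_eventuallyEq.mpr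
      ((eventually_nhdsSet_iff_forall.mp h0) x hxU)) hx

namespace ChartPartition

variable (P : ChartPartition X)

/-- The Laplacian `(2π)⁻¹ (∂²/∂x² + ∂²/∂y²)` of a function, divided by the density of the reference
measure so as to be a function on the surface again. -/
def lap (u : X → ℝ) (x : X) : ℝ :=
  (2 * Real.pi)⁻¹ * Δ (u ∘ (chartAt ℂ x).symm) (chartAt ℂ x x) / P.volDensity (chartAt ℂ x) x

/-- The value of the Laplacian does not depend on the chart, because `Δ` and the density of the
reference measure are multiplied by the same conformal factor under a change of charts. -/
theorem lap_eq {u : X → ℝ} (hu : IsTestFunction u) {e : OpenPartialHomeomorph X ℂ}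
    (he : e ∈ atlas ℂ X) {x : X} (hx : x ∈ e.source) :
    P.lap u x = (2 * Real.pi)⁻¹ * Δ (u ∘ e.symm) (e x) / P.volDensity e x := by
  have h := laplacian_chart_comp hu (f := fun y => y) mdifferentiable_id
    (chart_mem_atlas ℂ x) he (mem_chart_source ℂ x) hx
  have hc := conformalFactor_id_pos (chart_mem_atlas ℂ x) he (mem_chart_source ℂ x) hx
  rw [lap, h, P.volDensity_eq (chart_mem_atlas ℂ x) he (mem_chart_source ℂ x) hx]
  have := P.volDensity_pos he hx
  field_simp

theorem lap_congr {u v : X → ℝ} {x : X} (h : u =ᶠ[𝓝 x] v) : P.lap u x = P.lap v x := by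
  have h1 : u ∘ (chartAt ℂ x).symm =ᶠ[𝓝 (chartAt ℂ x x)] v ∘ (chartAt ℂ x).symm := by
    have hc := (chartAt ℂ x).continuousAt_symm (mem_chart_target ℂ x)
    rw [ContinuousAt, (chartAt ℂ x).left_inv (mem_chart_source ℂ x)] at hc
    exact hc.eventually h
  rw [lap, lap, (laplacian_congr_nhds h1).eq_of_nhds]

theorem lap_eq_zero_of_notMem_tsupport {u : X → ℝ} {x : X} (h : x ∉ tsupport u) :
    P.lap u x = 0 := by
  rw [P.lap_congr (notMem_tsupport_iff_eventuallyEq.mp h)]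
  have : (0 : X → ℝ) ∘ (chartAt ℂ x).symm = fun _ => (0 : ℝ) := rfl
  rw [lap, this]
  simp

theorem isTestFunction_lap {u : X → ℝ} (hu : IsTestFunction u) : IsTestFunction (P.lap u) := by
  intro x
  set e : OpenPartialHomeomorph X ℂ := chartAt ℂ x
  have he : e ∈ atlas ℂ X := chart_mem_atlas ℂ x
  have hx : x ∈ e.source := mem_chart_source ℂ x
  rw [contMDiffAt_iff_chart he hx]
  have h1 := contDiffAt_laplacian (hu.contDiffAt he (e.map_source hx))
  have h2 := (contMDiffAt_iff_chart he hx).mp (P.contMDiffAt_volDensity he hx)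
  have h3 : (P.volDensity e ∘ e.symm) (e x) ≠ 0 := by
    simpa [e.left_inv hx] using (P.volDensity_pos he hx).ne'
  refine (((contDiffAt_const (c := (2 * Real.pi)⁻¹)).mul h1).div h2 h3).congr_of_eventuallyEq ?_
  filter_upwards [e.open_target.mem_nhds (e.map_source hx)] with z hz
  simp only [Function.comp_apply, P.lap_eq hu he (e.map_target hz), e.right_inv hz]
  rfl

theorem lap_const (c : ℝ) (x : X) : P.lap (fun _ => c) x = 0 := by
  have : (fun _ : X => c) ∘ (chartAt ℂ x).symm = fun _ => c := rfl
  rw [lap, this]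
  simp

theorem lap_add {u v : X → ℝ} (hu : IsTestFunction u) (hv : IsTestFunction v) (x : X) :
    P.lap (fun y => u y + v y) x = P.lap u x + P.lap v x := by
  have he := chart_mem_atlas ℂ x
  have h : Δ ((fun y => u y + v y) ∘ (chartAt ℂ x).symm) (chartAt ℂ x x) =
      Δ (u ∘ (chartAt ℂ x).symm) (chartAt ℂ x x) + Δ (v ∘ (chartAt ℂ x).symm) (chartAt ℂ x x) :=
    (hu.contDiffAt_two he (mem_chart_target ℂ x)).laplacian_add
      (hv.contDiffAt_two he (mem_chart_target ℂ x))
  rw [lap, lap, lap, h]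
  ring

theorem lap_const_mul {u : X → ℝ} (hu : IsTestFunction u) (c : ℝ) (x : X) :
    P.lap (fun y => c * u y) x = c * P.lap u x := by
  have he := chart_mem_atlas ℂ x
  have h : Δ ((fun y => c * u y) ∘ (chartAt ℂ x).symm) (chartAt ℂ x x) =
      c • Δ (u ∘ (chartAt ℂ x).symm) (chartAt ℂ x x) :=
    laplacian_smul c (hu.contDiffAt_two he (mem_chart_target ℂ x))
  rw [lap, lap, h, smul_eq_mul]
  ring

theorem lap_sub {u v : X → ℝ} (hu : IsTestFunction u) (hv : IsTestFunction v) (x : X) :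
    P.lap (fun y => u y - v y) x = P.lap u x - P.lap v x := by
  have := P.lap_add hu (hv.const_mul (-1)) x
  rw [P.lap_const_mul hv] at this
  simp only [neg_mul, one_mul, ← sub_eq_add_neg] at this
  exact this

theorem lap_sum {ι : Type*} (s : Finset ι) {u : ι → X → ℝ} (hu : ∀ i, IsTestFunction (u i))
    (x : X) : P.lap (fun y => ∑ i ∈ s, u i y) x = ∑ i ∈ s, P.lap (u i) x := by
  classical
  induction s using Finset.induction_on with
  | empty => simp [P.lap_const 0 x]
  | insert a s ha ih =>
    simp only [Finset.sum_insert ha]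
    rw [P.lap_add (hu a) (IsTestFunction.sum fun i _ => hu i), ih]

/-- The Jacobian of a holomorphic map with respect to the reference measure. -/
def jacobian (f : X → X) (x : X) : ℝ :=
  P.volDensity (chartAt ℂ (f x)) (f x) * conformalFactor (chartAt ℂ x) (chartAt ℂ (f x)) f x /
    P.volDensity (chartAt ℂ x) x

theorem jacobian_nonneg (f : X → X) (x : X) : 0 ≤ P.jacobian f x :=
  div_nonneg (mul_nonneg (P.volDensity_nonneg _ _) (conformalFactor_nonneg _ _ _ _))
    (P.volDensity_nonneg _ _)

/-- The Jacobian can be computed in any pair of charts. -/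
theorem jacobian_eq {f : X → X} (hf : MDifferentiable 𝓘(ℂ) 𝓘(ℂ) f)
    {e e' : OpenPartialHomeomorph X ℂ} (he : e ∈ atlas ℂ X) (he' : e' ∈ atlas ℂ X) {x : X}
    (hx : x ∈ e.source) (hfx : f x ∈ e'.source) :
    P.jacobian f x = P.volDensity e' (f x) * conformalFactor e e' f x / P.volDensity e x := by
  have hid : MDifferentiable 𝓘(ℂ) 𝓘(ℂ) (fun y : X => y) := mdifferentiable_id
  have hc := chart_mem_atlas ℂ x
  have hc' := chart_mem_atlas ℂ (f x)
  have hm := mem_chart_source ℂ x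
  have hm' := mem_chart_source ℂ (f x)
  have h1 := conformalFactor_comp hid hf hc he he' hm hx hfx
  have h2 := conformalFactor_comp hf hid hc hc' he' hm hm' hfx
  have h3 := conformalFactor_id_pos hc he hm hx
  have h4 := conformalFactor_id_pos hc' he' hm' hfx
  have h5 := P.volDensity_pos he hx
  have h6 := h1.symm.trans h2
  rw [jacobian, P.volDensity_eq hc he hm hx, P.volDensity_eq hc' he' hm' hfx]
  rw [div_eq_div_iff (by positivity) (by positivity)]
  linear_combination -(P.volDensity e' (f x) * P.volDensity e x) * h6

theorem isTestFunction_jacobian {f : X → X} (hf : MDifferentiable 𝓘(ℂ) 𝓘(ℂ) f) :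
    IsTestFunction (P.jacobian f) := by
  intro x
  have hc := chart_mem_atlas ℂ x
  have hc' := chart_mem_atlas ℂ (f x)
  have hm := mem_chart_source ℂ x
  have hm' := mem_chart_source ℂ (f x)
  have h1 : ContMDiffAt 𝓘(ℝ, ℂ) 𝓘(ℝ, ℝ) ∞ (fun y => P.volDensity (chartAt ℂ (f x)) (f y)) x := by
    have ha := analyticAt_chart_comp hf hc hc' hm hm'
    have h2 := (contMDiffAt_iff_chart hc' hm').mp (P.contMDiffAt_volDensity hc' hm')
    have hval : (chartAt ℂ (f x) ∘ f ∘ (chartAt ℂ x).symm) (chartAt ℂ x x) =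
      chartAt ℂ (f x) (f x) := by simp
    rw [← hval] at h2
    rw [contMDiffAt_iff_chart hc hm]
    refine (h2.comp _ (ha.contDiffAt.restrict_scalars ℝ)).congr_of_eventuallyEq ?_
    have hcont : ContinuousAt (f ∘ (chartAt ℂ x).symm) (chartAt ℂ x x) :=
      hf.continuous.continuousAt.comp ((chartAt ℂ x).continuousAt_symm (mem_chart_target ℂ x))
    have : ∀ᶠ z in 𝓝 (chartAt ℂ x x), (f ∘ (chartAt ℂ x).symm) z ∈ (chartAt ℂ (f x)).source :=
      hcont.eventually_mem ((chartAt ℂ (f x)).open_source.mem_nhds (by simp))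
    filter_upwards [this] with z hz
    simp only [Function.comp_apply] at hz ⊢
    rw [(chartAt ℂ (f x)).left_inv hz]
  refine ((h1.mul (contMDiffAt_conformalFactor hf hc hc' hm hm')).div₀
    (P.contMDiffAt_volDensity hc hm) (P.volDensity_pos hc hm).ne').congr_of_eventuallyEq ?_
  filter_upwards [(chartAt ℂ x).open_source.mem_nhds hm,
    hf.continuous.continuousAt.eventually_mem ((chartAt ℂ (f x)).open_source.mem_nhds hm')]
    with y hy hfy
  exact P.jacobian_eq hf hc hc' hy hfy

/-- Conformal covariance: `Δ(u ∘ f) = (Δu ∘ f) · Jac f`. -/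
theorem lap_comp {u : X → ℝ} (hu : IsTestFunction u) {f : X → X}
    (hf : MDifferentiable 𝓘(ℂ) 𝓘(ℂ) f) (x : X) :
    P.lap (fun y => u (f y)) x = P.jacobian f x * P.lap u (f x) := by
  have hc := chart_mem_atlas ℂ x
  have hc' := chart_mem_atlas ℂ (f x)
  have hm := mem_chart_source ℂ x
  have hm' := mem_chart_source ℂ (f x)
  rw [lap, laplacian_chart_comp hu hf hc hc' hm hm', jacobian, lap]
  have := P.volDensity_pos hc hm
  have := P.volDensity_pos hc' hm'
  field_simp

end ChartPartition

end Surface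

/-! ### Green's identity and distributional Laplacians -/

section Energy

variable {X : Type*} [TopologicalSpace X] [T2Space X] [CompactSpace X] [ChartedSpace ℂ X]
  [IsManifold 𝓘(ℂ) ω X] [MeasurableSpace X] [BorelSpace X]

theorem integrable_of_continuous {μ : Measure X} [IsFiniteMeasure μ] {u : X → ℝ}
    (hu : Continuous u) : Integrable u μ :=
  hu.integrable_of_hasCompactSupport (HasCompactSupport.of_compactSpace u)

theorem integrable_mul_of_continuous {μ : Measure X} [IsFiniteMeasure μ] {u v : X → ℝ}
    (hu : Continuous u) (hv : Continuous v) : Integrable (fun x => u x * v x) μ :=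
  integrable_of_continuous (hu.mul hv)

namespace ChartPartition

variable (P : ChartPartition X)

theorem sum_χ_mul (u : X → ℝ) (x : X) : ∑ i ∈ P.index, P.χ i x * u x = u x := by
  rw [← Finset.sum_mul, P.sum_eq_one, one_mul]

theorem tsupport_χ_mul_subset (i : X) (u : X → ℝ) :
    tsupport (fun x => P.χ i x * u x) ⊆ (chartAt ℂ i).source :=
  (tsupport_mul_subset_left (f := P.χ i) (g := u)).trans (P.tsupport_subset i)

theorem isTestFunction_χ_mul (i : X) {u : X → ℝ} (hu : IsTestFunction u) :
    IsTestFunction fun x => P.χ i x * u x := (P.isTestFunction i).mul hu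

theorem integral_mul_lap_of_tsupport {e : OpenPartialHomeomorph X ℂ} (he : e ∈ atlas ℂ X)
    {u g : X → ℝ} (hu : IsTestFunction u) (hs : tsupport u ⊆ e.source) (hg : Measurable g) :
    ∫ x, g x * P.lap u x ∂P.vol =
      (2 * Real.pi)⁻¹ * ∫ z in e.target, g (e.symm z) * Δ (chartPush e u) z := by
  rw [← setIntegral_eq_integral_of_forall_compl_eq_zero (s := e.source) fun x hx => by
    rw [P.lap_eq_zero_of_notMem_tsupport fun h => hx (hs h), mul_zero],
    P.setIntegral_vol he (g := fun x => g x * P.lap u x)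
      (hg.mul (P.isTestFunction_lap hu).continuous.measurable),
    ← integral_const_mul]
  refine setIntegral_congr_fun e.open_target.measurableSet fun z hz => ?_
  rw [P.lap_eq hu he (e.map_target hz), (laplacian_congr_nhds (chartPush_eventuallyEq u hz)).eq_of_nhds,
    e.right_inv hz]
  have := P.volDensity_pos he (e.map_target hz)
  field_simp

theorem integral_mul_lap_comm_of_tsupport {e : OpenPartialHomeomorph X ℂ} (he : e ∈ atlas ℂ X)
    {u v : X → ℝ} (hu : IsTestFunction u) (hv : IsTestFunction v) (hsu : tsupport u ⊆ e.source)
    (hsv : tsupport v ⊆ e.source) :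
    ∫ x, u x * P.lap v x ∂P.vol = ∫ x, v x * P.lap u x ∂P.vol := by
  rw [P.integral_mul_lap_of_tsupport he hv hsv hu.continuous.measurable,
    P.integral_mul_lap_of_tsupport he hu hsu hv.continuous.measurable]
  have h : ∀ {a b : X → ℝ}, tsupport b ⊆ e.source → ∫ z in e.target, a (e.symm z) * Δ (chartPush e b) z =
      ∫ z, chartPush e a z * Δ (chartPush e b) z := by
    intro a b hb
    rw [← setIntegral_eq_integral_of_forall_compl_eq_zero (s := e.target)
      (f := fun z => chartPush e a z * Δ (chartPush e b) z) fun z hz => by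
      rw [show chartPush e a z = 0 from Set.indicator_of_notMem hz _, zero_mul]]
    refine setIntegral_congr_fun e.open_target.measurableSet fun z hz => ?_
    simp only [chartPush_apply hz]
  rw [h hsv, h hsu, integral_mul_laplacian (contDiff_chartPush he hu hsu)
    (contDiff_chartPush he hv hsv) (hasCompactSupport_chartPush hsv)]
  congr 2; funext z; ring

/-- The Laplacian is symmetric. One factor is localised by the partition of unity and the other by a
cut-off equal to `1` near the support of the first, so that the planar identity applies. -/
theorem integral_mul_lap_comm {u v : X → ℝ} (hu : IsTestFunction u) (hv : IsTestFunction v) :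
    ∫ x, u x * P.lap v x ∂P.vol = ∫ x, v x * P.lap u x ∂P.vol := by
  have hi : ∀ {a b : X → ℝ}, IsTestFunction a → IsTestFunction b →
      Integrable (fun x => a x * b x) P.vol := fun ha hb =>
    integrable_mul_of_continuous ha.continuous hb.continuous
  have hloc : ∀ i ∈ P.index, ∫ x, P.χ i x * u x * P.lap v x ∂P.vol =
      ∫ x, v x * P.lap (fun y => P.χ i y * u y) x ∂P.vol := by
    intro i _
    set w : X → ℝ := fun y => P.χ i y * u y
    have hw : IsTestFunction w := P.isTestFunction_χ_mul i hu
    have hsw : tsupport w ⊆ (chartAt ℂ i).source := P.tsupport_χ_mul_subset i u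
    -- `v` may be replaced by `θ v`, as `θ = 1` near the support of `w`
    obtain ⟨θ, hθ, -, -, hθ1, hθs⟩ := exists_cutoff (isClosed_tsupport w)
      (chartAt ℂ i).open_source hsw
    have hθv := hθ.mul hv
    have hs : tsupport (fun x => θ x * v x) ⊆ (chartAt ℂ i).source :=
      (tsupport_mul_subset_left (f := θ) (g := v)).trans hθs
    have h := P.integral_mul_lap_comm_of_tsupport (chart_mem_atlas ℂ i) hw hθv hsw hs
    have h1 : ∫ x, w x * P.lap (fun x => θ x * v x) x ∂P.vol = ∫ x, w x * P.lap v x ∂P.vol := by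
      congr 1; funext x
      by_cases hx : x ∈ tsupport w
      · rw [P.lap_congr (v := v)]
        filter_upwards [hθ1 x hx] with y hy
        rw [hy, one_mul]
      · simp [image_eq_zero_of_notMem_tsupport hx]
    have h2 : ∫ x, θ x * v x * P.lap w x ∂P.vol = ∫ x, v x * P.lap w x ∂P.vol := by
      congr 1; funext x
      by_cases hx : x ∈ tsupport w
      · rw [(hθ1 x hx).eq_of_nhds, one_mul]
      · simp [P.lap_eq_zero_of_notMem_tsupport hx]
    rw [← h2, ← h, h1]
  have h1 : ∫ x, u x * P.lap v x ∂P.vol =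
      ∑ i ∈ P.index, ∫ x, P.χ i x * u x * P.lap v x ∂P.vol := by
    rw [← integral_finsetSum _ fun i _ => hi (P.isTestFunction_χ_mul i hu) (P.isTestFunction_lap hv)]
    congr 1; funext x
    rw [← Finset.sum_mul, P.sum_χ_mul]
  have h2 : ∫ x, v x * P.lap u x ∂P.vol =
      ∑ i ∈ P.index, ∫ x, v x * P.lap (fun y => P.χ i y * u y) x ∂P.vol := by
    rw [← integral_finsetSum _ fun i _ => hi hv
      (P.isTestFunction_lap (P.isTestFunction_χ_mul i hu))]
    congr 1; funext x
    rw [← Finset.mul_sum, ← P.lap_sum P.index fun i => P.isTestFunction_χ_mul i hu]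
    simp only [P.sum_χ_mul]
  rw [h1, h2, Finset.sum_congr rfl hloc]

theorem integral_lap {u : X → ℝ} (hu : IsTestFunction u) : ∫ x, P.lap u x ∂P.vol = 0 := by
  have := P.integral_mul_lap_comm (isTestFunction_const (X := X) 1) hu
  simpa [P.lap_const] using this

/-- Harmonic functions on a compact connected surface are constant, as their energy vanishes. -/
theorem exists_eq_const_of_lap_eq_zero [ConnectedSpace X] {u : X → ℝ} (hu : IsTestFunction u)
    (h : ∀ x, P.lap u x = 0) : ∃ c, ∀ x, u x = c := by
  have hu2 := hu.mul hu
  have hpi : (0 : ℝ) < (2 * Real.pi)⁻¹ := by positivity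
  -- `Δ(u²) = 2 u Δu + 2 |∇u|²`, so `∫ |∇u|² = 0`
  have hlap : ∀ e ∈ atlas ℂ X, ∀ x ∈ e.source, P.lap (fun y => u y * u y) x =
      (2 * Real.pi)⁻¹ * (2 * ((fderiv ℝ (u ∘ e.symm) (e x) 1) ^ 2 +
        (fderiv ℝ (u ∘ e.symm) (e x) Complex.I) ^ 2)) / P.volDensity e x := by
    intro e he x hx
    have h1 := laplacian_mul_self (hu.contDiffAt_two he (e.map_source hx))
    have h2 := h x
    rw [P.lap_eq hu he hx, div_eq_zero_iff, mul_eq_zero] at h2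
    rcases h2 with (h2 | h2) | h2
    · exact absurd h2 hpi.ne'
    · rw [P.lap_eq hu2 he hx,
        show (fun y => u y * u y) ∘ e.symm = fun w => (u ∘ e.symm) w * (u ∘ e.symm) w from rfl,
        h1, h2]
      ring
    · exact absurd h2 (P.volDensity_pos he hx).ne'
  have hnn : ∀ x, 0 ≤ P.lap (fun y => u y * u y) x := by
    intro x
    rw [hlap _ (chart_mem_atlas ℂ x) x (mem_chart_source ℂ x)]
    have := P.volDensity_pos (chart_mem_atlas ℂ x) (mem_chart_source ℂ x)
    positivity
  have hzero : ∀ x, P.lap (fun y => u y * u y) x = 0 := by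
    have hc := (P.isTestFunction_lap hu2).continuous
    have h0 := (integral_eq_zero_iff_of_nonneg hnn (integrable_of_continuous hc)).mp
      (P.integral_lap hu2)
    exact fun x => congrFun ((hc.ae_eq_iff_eq P.vol continuous_const).mp h0) x
  have hloc : IsLocallyConstant u := by
    rw [IsLocallyConstant.iff_eventually_eq]
    intro x
    set e : OpenPartialHomeomorph X ℂ := chartAt ℂ x
    have he : e ∈ atlas ℂ X := chart_mem_atlas ℂ x
    have hx : x ∈ e.source := mem_chart_source ℂ x
    obtain ⟨r, hr, hrt⟩ := Metric.isOpen_iff.mp e.open_target _ (e.map_source hx)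
    have hfd : ∀ z ∈ Metric.ball (e x) r, fderiv ℝ (u ∘ e.symm) z = 0 := by
      intro z hz
      have hzt := hrt hz
      have h1 := hzero (e.symm z)
      have hp := P.volDensity_pos he (e.map_target hzt)
      rw [hlap e he _ (e.map_target hzt), e.right_inv hzt] at h1
      have h2 : (fderiv ℝ (u ∘ e.symm) z 1) ^ 2 + (fderiv ℝ (u ∘ e.symm) z Complex.I) ^ 2 = 0 := by
        field_simp at h1
        simpa using h1
      apply fderiv_eq_zero_of_apply <;> nlinarith
    have hconst : ∀ z ∈ Metric.ball (e x) r, (u ∘ e.symm) z = (u ∘ e.symm) (e x) := by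
      intro z hz
      refine Metric.isOpen_ball.is_const_of_fderiv_eq_zero
        (convex_ball (e x) r).isPreconnected ?_ hfd hz (Metric.mem_ball_self hr)
      intro w hw
      exact ((hu.contDiffAt he (hrt hw)).differentiableAt (by simp)).differentiableWithinAt
    filter_upwards [e.open_source.mem_nhds hx,
      (e.continuousAt hx).eventually_mem (Metric.ball_mem_nhds _ hr)] with y hy hyr
    have := hconst _ hyr
    simpa [e.left_inv hy, e.left_inv hx] using this
  obtain ⟨x₀⟩ : Nonempty X := inferInstance
  exact ⟨u x₀, fun x => hloc.apply_eq_of_isPreconnected isPreconnected_univ trivial trivial⟩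

/-- Testing in charts is the same as testing globally. -/
theorem eqAddLaplacian_iff {μ ω₀ : Measure X} [IsFiniteMeasure μ] [IsFiniteMeasure ω₀]
    {g : X → ℝ} (hg : Continuous g) : EqAddLaplacian μ ω₀ g ↔
      ∀ ψ : X → ℝ, IsTestFunction ψ →
        ∫ x, ψ x ∂μ = ∫ x, ψ x ∂ω₀ + ∫ x, g x * P.lap ψ x ∂P.vol := by
  -- the correspondence between test functions in a chart and test functions supported there
  have key : ∀ e ∈ atlas ℂ X, ∀ u : X → ℝ, IsTestFunction u → tsupport u ⊆ e.source →
      ((∫ x in e.source, chartPush e u (e x) ∂μ = ∫ x in e.source, chartPush e u (e x) ∂ω₀ +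
        (2 * Real.pi)⁻¹ * ∫ z in e.target, g (e.symm z) * Δ (chartPush e u) z) ↔
      ∫ x, u x ∂μ = ∫ x, u x ∂ω₀ + ∫ x, g x * P.lap u x ∂P.vol) := by
    intro e he u hu hs
    have h : ∀ ν : Measure X, ∫ x in e.source, chartPush e u (e x) ∂ν = ∫ x, u x ∂ν := by
      intro ν
      rw [← setIntegral_eq_integral_of_forall_compl_eq_zero (s := e.source) fun x hx =>
        image_eq_zero_of_notMem_tsupport fun h => hx (hs h)]
      refine setIntegral_congr_fun e.open_source.measurableSet fun x hx => ?_
      simp only [chartPush_apply (e.map_source hx), e.left_inv hx]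
    rw [h, h, P.integral_mul_lap_of_tsupport he hu hs hg.measurable]
  constructor
  · intro h ψ hψ
    have hloc : ∀ i ∈ P.index, ∫ x, P.χ i x * ψ x ∂μ = ∫ x, P.χ i x * ψ x ∂ω₀ +
        ∫ x, g x * P.lap (fun y => P.χ i y * ψ y) x ∂P.vol := by
      intro i _
      have hu := P.isTestFunction_χ_mul i hψ
      have hs := P.tsupport_χ_mul_subset i ψ
      exact (key _ (chart_mem_atlas ℂ i) _ hu hs).mp (h _ (chart_mem_atlas ℂ i) _
        (contDiff_chartPush (chart_mem_atlas ℂ i) hu hs) (hasCompactSupport_chartPush hs)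
        (tsupport_chartPush_subset hs))
    have h1 : ∀ (ν : Measure X) [IsFiniteMeasure ν], ∫ x, ψ x ∂ν =
        ∑ i ∈ P.index, ∫ x, P.χ i x * ψ x ∂ν := by
      intro ν _
      rw [← integral_finsetSum _ fun i _ => integrable_of_continuous
        (P.isTestFunction_χ_mul i hψ).continuous]
      simp only [P.sum_χ_mul]
    have h2 : ∫ x, g x * P.lap ψ x ∂P.vol =
        ∑ i ∈ P.index, ∫ x, g x * P.lap (fun y => P.χ i y * ψ y) x ∂P.vol := by
      rw [← integral_finsetSum _ fun i _ => integrable_mul_of_continuous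
        hg (P.isTestFunction_lap (P.isTestFunction_χ_mul i hψ)).continuous]
      congr 1; funext x
      rw [← Finset.mul_sum, ← P.lap_sum P.index fun i => P.isTestFunction_χ_mul i hψ]
      simp only [P.sum_χ_mul]
    rw [h1 μ, h1 ω₀, h2, ← Finset.sum_add_distrib, Finset.sum_congr rfl hloc]
  · intro h e he φ hφ hc hs
    have hu := isTestFunction_chartPull he hφ hc hs
    have hsu := tsupport_chartPull_subset hc hs
    have hpp : chartPush e (chartPull e φ) = φ := by
      funext z
      by_cases hz : z ∈ e.target
      · rw [chartPush_apply hz, chartPull_apply (e.map_target hz), e.right_inv hz]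
      · rw [chartPush, Set.indicator_of_notMem hz]
        exact (image_eq_zero_of_notMem_tsupport fun h => hz (hs h)).symm
    have := (key e he _ hu hsu).mpr (h _ hu)
    rwa [hpp] at this

/-- The measure with a given density with respect to the reference measure. -/
def smoothMeasure (s : X → ℝ) : Measure X := P.vol.withDensity fun x => ENNReal.ofReal (s x)

theorem isFiniteMeasure_smoothMeasure {s : X → ℝ} (hs : Continuous s) :
    IsFiniteMeasure (P.smoothMeasure s) :=
  isFiniteMeasure_withDensity_ofReal (integrable_of_continuous hs).2

theorem integral_smoothMeasure {s : X → ℝ} (hs : Continuous s) (h0 : ∀ x, 0 ≤ s x) (u : X → ℝ) :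
    ∫ x, u x ∂P.smoothMeasure s = ∫ x, s x * u x ∂P.vol := by
  rw [smoothMeasure, integral_withDensity_eq_integral_toReal_smul₀
    hs.measurable.ennreal_ofReal.aemeasurable (Eventually.of_forall fun x => ENNReal.ofReal_lt_top)]
  congr 1; funext x
  rw [ENNReal.toReal_ofReal (h0 x), smul_eq_mul]

theorem eq_of_integral_mul_eq {a b : X → ℝ} (ha : IsTestFunction a) (hb : IsTestFunction b)
    (h : ∀ ψ : X → ℝ, IsTestFunction ψ → ∫ x, a x * ψ x ∂P.vol = ∫ x, b x * ψ x ∂P.vol) :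
    a = b := by
  have hab := ha.sub hb
  have hc := hab.continuous
  have h1 := h _ hab
  have h2 : ∫ x, (a x - b x) * (a x - b x) ∂P.vol = 0 := by
    simp only [sub_mul (a _) (b _)]
    rw [integral_sub (integrable_mul_of_continuous ha.continuous hc)
      (integrable_mul_of_continuous hb.continuous hc), h1, sub_self]
  have h3 := (integral_eq_zero_iff_of_nonneg (fun x => mul_self_nonneg _)
    (integrable_mul_of_continuous hc hc)).mp h2
  have h4 := ((hc.mul hc).ae_eq_iff_eq P.vol continuous_const).mp h3
  funext x
  have := congrFun h4 x
  exact sub_eq_zero.mp (mul_self_eq_zero.mp this)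

theorem eqAddLaplacian_smoothMeasure_iff {s t g : X → ℝ} (hs : IsTestFunction s)
    (hs0 : ∀ x, 0 ≤ s x) (ht : IsTestFunction t) (ht0 : ∀ x, 0 ≤ t x) (hg : IsTestFunction g) :
    EqAddLaplacian (P.smoothMeasure s) (P.smoothMeasure t) g ↔
      ∀ x, s x = t x + P.lap g x := by
  have := P.isFiniteMeasure_smoothMeasure hs.continuous
  have := P.isFiniteMeasure_smoothMeasure ht.continuous
  have hl := P.isTestFunction_lap hg
  have hsum : ∀ ψ : X → ℝ, IsTestFunction ψ → ∫ x, (t x + P.lap g x) * ψ x ∂P.vol =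
      ∫ x, t x * ψ x ∂P.vol + ∫ x, g x * P.lap ψ x ∂P.vol := by
    intro ψ hψ
    rw [P.integral_mul_lap_comm hg hψ]
    simp only [add_mul]
    rw [integral_add (integrable_mul_of_continuous ht.continuous hψ.continuous)
      (integrable_mul_of_continuous hl.continuous hψ.continuous)]
    simp only [mul_comm]
  rw [P.eqAddLaplacian_iff hg.continuous]
  simp only [P.integral_smoothMeasure hs.continuous hs0, P.integral_smoothMeasure ht.continuous ht0]
  constructor
  · intro h x
    refine congrFun (P.eq_of_integral_mul_eq hs (ht.add hl) fun ψ hψ => ?_) x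
    rw [h ψ hψ, hsum ψ hψ]
  · intro h ψ hψ
    rw [← hsum ψ hψ]
    simp only [h]

end ChartPartition

end Energy

/-! ### Integral operators with continuous kernels -/

section Kernel

variable {X : Type*} [TopologicalSpace X] [CompactSpace X] [T2Space X] [SecondCountableTopology X]
  [MeasurableSpace X] [BorelSpace X] (μ : Measure X) [IsFiniteMeasure μ]

theorem integrable_continuousMap {Y : Type*} [TopologicalSpace Y] [CompactSpace Y]
    [MeasurableSpace Y] [OpensMeasurableSpace Y] {ν : Measure Y} [IsFiniteMeasure ν]
    {u : Y → ℝ} (hu : Continuous u) : Integrable u ν :=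
  hu.integrable_of_hasCompactSupport (HasCompactSupport.of_compactSpace u)

theorem continuous_integral_kernel {k : X × X → ℝ} (hk : Continuous k) {u : X → ℝ}
    (hu : Continuous u) : Continuous fun x => ∫ y, k (x, y) * u y ∂μ := by
  have hc : Continuous (Function.uncurry fun x y => k (x, y) * u y) := by
    have : (Function.uncurry fun x y => k (x, y) * u y) = fun p : X × X => k p * u p.2 := by
      ext ⟨x, y⟩; rfl
    rw [this]
    exact hk.mul (hu.comp continuous_snd)
  have := continuous_parametric_integral_of_continuous (μ := μ) hc (isCompact_univ (X := X))
  simpa using this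

theorem abs_integral_kernel_le (k : C(X × X, ℝ)) (u : C(X, ℝ)) (x : X) :
    |∫ y, k (x, y) * u y ∂μ| ≤ ‖k‖ * μ.real Set.univ * ‖u‖ := by
  have h := norm_integral_le_of_norm_le_const (μ := μ) (f := fun y => k (x, y) * u y)
    (C := ‖k‖ * ‖u‖) (Eventually.of_forall fun y => by
      rw [norm_mul]
      exact mul_le_mul (k.norm_coe_le_norm _) (u.norm_coe_le_norm _) (norm_nonneg _)
        (norm_nonneg _))
  rw [Real.norm_eq_abs] at h
  linarith

/-- The integral operator with a continuous kernel, on the space of continuous functions. -/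
def kernelOp (k : C(X × X, ℝ)) : C(X, ℝ) →L[ℝ] C(X, ℝ) :=
  LinearMap.mkContinuous
    { toFun := fun u => ⟨fun x => ∫ y, k (x, y) * u y ∂μ,
        continuous_integral_kernel μ k.continuous u.continuous⟩
      map_add' := fun u v => by
        ext x
        simp only [ContinuousMap.coe_mk, ContinuousMap.add_apply, mul_add]
        have hk : Continuous fun y => k (x, y) := k.continuous.comp (by fun_prop)
        exact integral_add (integrable_continuousMap (hk.mul u.continuous))
          (integrable_continuousMap (hk.mul v.continuous))
      map_smul' := fun c u => by
        ext x
        simp only [ContinuousMap.coe_mk, ContinuousMap.smul_apply, smul_eq_mul, RingHom.id_apply]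
        rw [← integral_const_mul]
        congr 1; funext y; ring }
    (‖k‖ * μ.real Set.univ) fun u => by
      rw [ContinuousMap.norm_le _ (by positivity)]
      intro x
      exact abs_integral_kernel_le μ k u x

theorem kernelOp_apply (k : C(X × X, ℝ)) (u : C(X, ℝ)) (x : X) :
    kernelOp μ k u x = ∫ y, k (x, y) * u y ∂μ := rfl

theorem norm_kernelOp_le (k : C(X × X, ℝ)) : ‖kernelOp μ k‖ ≤ ‖k‖ * μ.real Set.univ :=
  LinearMap.mkContinuous_norm_le _ (by positivity) _

/-- The transposed kernel. -/
def swapKernel (k : C(X × X, ℝ)) : C(X × X, ℝ) := k.comp ⟨Prod.swap, continuous_swap⟩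

theorem norm_swapKernel_le (k : C(X × X, ℝ)) : ‖swapKernel k‖ ≤ ‖k‖ := by
  rw [ContinuousMap.norm_le _ (norm_nonneg _)]
  exact fun p => k.norm_coe_le_norm _

theorem integral_mul_kernelOp (k : C(X × X, ℝ)) (u v : C(X, ℝ)) :
    ∫ x, u x * kernelOp μ k v x ∂μ = ∫ y, kernelOp μ (swapKernel k) u y * v y ∂μ := by
  have hc : Continuous (Function.uncurry fun x y => u x * (k (x, y) * v y)) := by
    have : (Function.uncurry fun x y => u x * (k (x, y) * v y)) =
        fun p : X × X => u p.1 * (k p * v p.2) := by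
      ext ⟨x, y⟩; rfl
    rw [this]
    fun_prop
  have h := integral_integral_swap (μ := μ) (ν := μ) (integrable_continuousMap hc)
  simp only [kernelOp_apply]
  rw [show ∫ x, u x * ∫ y, k (x, y) * v y ∂μ ∂μ = ∫ x, ∫ y, u x * (k (x, y) * v y) ∂μ ∂μ by
    congr 1; funext x; rw [integral_const_mul], h]
  congr 1; funext y
  rw [← integral_mul_const]
  congr 1; funext x
  simp [swapKernel]; ring

/-- If the kernel `k` is small then `1 + K` has a right inverse `T` (a Neumann series), and `T` has
a transpose `T'` for the pairing given by the integral. -/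
theorem exists_inverse_one_add_kernelOp (k : C(X × X, ℝ)) (hk : ‖k‖ * μ.real Set.univ < 1) :
    ∃ T T' : C(X, ℝ) →L[ℝ] C(X, ℝ), (∀ u, T u + kernelOp μ k (T u) = u) ∧
      ∀ u v, ∫ x, u x * T v x ∂μ = ∫ x, T' u x * v x ∂μ := by
  have h1 : ‖-kernelOp μ k‖ < 1 :=
    (ContinuousLinearMap.opNorm_neg _).trans_lt ((norm_kernelOp_le μ k).trans_lt hk)
  have h2 : ‖-kernelOp μ (swapKernel k)‖ < 1 := by
    refine (ContinuousLinearMap.opNorm_neg _).trans_lt ((norm_kernelOp_le μ _).trans_lt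
      (lt_of_le_of_lt ?_ hk))
    exact mul_le_mul_of_nonneg_right (norm_swapKernel_le k) (by positivity)
  set U := Units.oneSub (-kernelOp μ k) h1 with hU
  set V := Units.oneSub (-kernelOp μ (swapKernel k)) h2 with hV
  have hUT : ∀ u, (↑U⁻¹ : C(X, ℝ) →L[ℝ] C(X, ℝ)) u +
      kernelOp μ k ((↑U⁻¹ : C(X, ℝ) →L[ℝ] C(X, ℝ)) u) = u := by
    intro u
    have := congrArg (fun S : C(X, ℝ) →L[ℝ] C(X, ℝ) => S u) U.mul_inv
    simpa [hU, Units.val_oneSub] using this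
  have hVT : ∀ u, (↑V⁻¹ : C(X, ℝ) →L[ℝ] C(X, ℝ)) u +
      kernelOp μ (swapKernel k) ((↑V⁻¹ : C(X, ℝ) →L[ℝ] C(X, ℝ)) u) = u := by
    intro u
    have := congrArg (fun S : C(X, ℝ) →L[ℝ] C(X, ℝ) => S u) V.mul_inv
    simpa [hV, Units.val_oneSub] using this
  refine ⟨↑U⁻¹, ↑V⁻¹, hUT, fun u v => ?_⟩
  set Tv := (↑U⁻¹ : C(X, ℝ) →L[ℝ] C(X, ℝ)) v
  set Tu := (↑V⁻¹ : C(X, ℝ) →L[ℝ] C(X, ℝ)) u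
  have i : ∀ a b : C(X, ℝ), Integrable (fun x => a x * b x) μ := fun a b =>
    integrable_continuousMap (a.continuous.mul b.continuous)
  calc ∫ x, u x * Tv x ∂μ = ∫ x, (Tu x + kernelOp μ (swapKernel k) Tu x) * Tv x ∂μ := by
        congr 1; funext x
        rw [← ContinuousMap.add_apply, hVT]
    _ = ∫ x, Tu x * Tv x ∂μ + ∫ x, kernelOp μ (swapKernel k) Tu x * Tv x ∂μ := by
        simp only [add_mul]; exact integral_add (i _ _) (i _ _)
    _ = ∫ x, Tu x * Tv x ∂μ + ∫ x, Tu x * kernelOp μ k Tv x ∂μ := by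
        rw [integral_mul_kernelOp μ k Tu Tv]
    _ = ∫ x, Tu x * (Tv x + kernelOp μ k Tv x) ∂μ := by
        simp only [mul_add]; exact (integral_add (i _ _) (i _ _)).symm
    _ = ∫ x, Tu x * v x ∂μ := by
        congr 1; funext x
        rw [← ContinuousMap.add_apply, hUT]

end Kernel

section StoneWeierstrass

variable {X : Type*} [TopologicalSpace X] [T2Space X] [CompactSpace X] [ChartedSpace ℂ X]
  [IsManifold 𝓘(ℂ) ω X]

/-- Kernels of the form `∑ b_j(x) a_j(y)` with smooth `a_j`, `b_j`. -/
def IsSmoothFiniteRank (k : C(X × X, ℝ)) : Prop :=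
  ∃ (ι : Type) (_ : Fintype ι) (b a : ι → X → ℝ), (∀ j, IsTestFunction (b j)) ∧
    (∀ j, IsTestFunction (a j)) ∧ ∀ x y, k (x, y) = ∑ j, b j x * a j y

/-- The algebra of smooth kernels of finite rank. -/
def smoothFiniteRank (X : Type*) [TopologicalSpace X] [CompactSpace X] [ChartedSpace ℂ X] :
    Subalgebra ℝ C(X × X, ℝ) where
  carrier := {k | IsSmoothFiniteRank k}
  mul_mem' := by
    rintro k k' ⟨ι, _, b, a, hb, ha, h⟩ ⟨ι', _, b', a', hb', ha', h'⟩
    refine ⟨ι × ι', inferInstance, fun j x => b j.1 x * b' j.2 x, fun j x => a j.1 x * a' j.2 x,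
      fun j => (hb _).mul (hb' _), fun j => (ha _).mul (ha' _), fun x y => ?_⟩
    rw [ContinuousMap.mul_apply, h, h', Finset.sum_mul_sum, Fintype.sum_prod_type]
    refine Finset.sum_congr rfl fun i _ => Finset.sum_congr rfl fun j _ => ?_
    ring
  add_mem' := by
    rintro k k' ⟨ι, _, b, a, hb, ha, h⟩ ⟨ι', _, b', a', hb', ha', h'⟩
    refine ⟨ι ⊕ ι', inferInstance, Sum.elim b b', Sum.elim a a', ?_, ?_, fun x y => ?_⟩
    · rintro (j | j); exacts [hb j, hb' j]
    · rintro (j | j); exacts [ha j, ha' j]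
    · rw [ContinuousMap.add_apply, h, h', Fintype.sum_sum_type]
      simp
  algebraMap_mem' c := ⟨Unit, inferInstance, fun _ _ => c, fun _ _ => 1,
    fun _ => isTestFunction_const c, fun _ => isTestFunction_const 1, fun x y => by simp⟩

/-- By the Stone–Weierstrass theorem, continuous kernels are uniform limits of smooth kernels of
finite rank. -/
theorem exists_smoothFiniteRank_near (k : C(X × X, ℝ)) {δ : ℝ} (hδ : 0 < δ) :
    ∃ k' : C(X × X, ℝ), IsSmoothFiniteRank k' ∧ ‖k - k'‖ < δ := by
  have hsep : (smoothFiniteRank X).SeparatesPoints := by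
    have hpt : ∀ x x' : X, x ≠ x' → ∃ θ : X → ℝ, IsTestFunction θ ∧ θ x ≠ θ x' := by
      intro x x' hne
      obtain ⟨θ, hθ, -, -, h1, h0⟩ := exists_cutoff (K := {x}) (U := {x'}ᶜ) isClosed_singleton
        isClosed_singleton.isOpen_compl (by simpa [eq_comm] using hne)
      refine ⟨θ, hθ, ?_⟩
      rw [(h1 x rfl).eq_of_nhds, image_eq_zero_of_notMem_tsupport fun h => h0 h rfl]
      exact one_ne_zero
    rintro ⟨x, y⟩ ⟨x', y'⟩ hne
    by_cases hx : x = x'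
    · have hy : y ≠ y' := fun h => hne (by rw [hx, h])
      obtain ⟨θ, hθ, hne⟩ := hpt y y' hy
      refine ⟨_, ⟨⟨fun p => θ p.2, hθ.continuous.comp continuous_snd⟩, ⟨Unit, inferInstance,
        fun _ _ => 1, fun _ => θ, fun _ => isTestFunction_const 1, fun _ => hθ,
        fun x y => by simp⟩, rfl⟩, hne⟩
    · obtain ⟨θ, hθ, hne⟩ := hpt x x' hx
      refine ⟨_, ⟨⟨fun p => θ p.1, hθ.continuous.comp continuous_fst⟩, ⟨Unit, inferInstance,
        fun _ => θ, fun _ _ => 1, fun _ => hθ, fun _ => isTestFunction_const 1,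
        fun x y => by simp⟩, rfl⟩, hne⟩
  obtain ⟨⟨k', hk'⟩, h⟩ := ContinuousMap.exists_mem_subalgebra_near_continuousMap_of_separatesPoints
    (smoothFiniteRank X) hsep k δ hδ
  exact ⟨k', hk', by rw [norm_sub_rev]; exact h⟩

end StoneWeierstrass

/-! ### The parametrix on the surface -/

section Parametrix

variable {X : Type*} [TopologicalSpace X] [T2Space X] [CompactSpace X] [ChartedSpace ℂ X]
  [IsManifold 𝓘(ℂ) ω X] [MeasurableSpace X] [BorelSpace X]

theorem exists_abs_le_of_continuous {u : X → ℝ} (hu : Continuous u) :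
    ∃ M : ℝ, 0 ≤ M ∧ ∀ x, |u x| ≤ M := by
  obtain ⟨M, hM⟩ := (isCompact_univ (X := X)).exists_bound_of_continuousOn hu.continuousOn
  exact ⟨max M 0, le_max_right _ _, fun x => (hM x trivial).trans (le_max_left _ _)⟩

namespace ChartPartition

variable (P : ChartPartition X)

/-- A local parametrix for the Laplacian at a cut-off `χ`: an operator `op` on test functions with
`2π Δ (op σ) = χ σ + K σ`, where `K` is the integral operator with the continuous kernel `ker`. -/
structure LocalParametrix (χ : X → ℝ) where
  /-- the operator -/
  op : (X → ℝ) → X → ℝ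
  /-- the kernel of the error -/
  ker : C(X × X, ℝ)
  /-- a bound for the operator in the uniform and in the `L¹` norm -/
  const : ℝ
  const_nonneg : 0 ≤ const
  isTestFunction_op : ∀ σ, IsTestFunction σ → IsTestFunction (op σ)
  two_pi_mul_lap : ∀ σ, IsTestFunction σ → ∀ x,
    2 * Real.pi * P.lap (op σ) x = χ x * σ x + ∫ y, ker (x, y) * σ y ∂P.vol
  isTestFunction_ker : ∀ σ : X → ℝ, Continuous σ →
    IsTestFunction fun x => ∫ y, ker (x, y) * σ y ∂P.vol
  abs_op_le : ∀ (σ : X → ℝ) (A : ℝ), (∀ x, |σ x| ≤ A) → ∀ x, |op σ x| ≤ const * A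
  op_nonpos : ∀ σ : X → ℝ, (∀ x, 0 ≤ σ x) → ∀ x, op σ x ≤ 0
  neg_integral_op_le : ∀ σ, IsTestFunction σ → (∀ x, 0 ≤ σ x) →
    -∫ x, op σ x ∂P.vol ≤ const * ∫ x, σ x ∂P.vol

theorem two_pi_mul_lap_chartPull {e : OpenPartialHomeomorph X ℂ} (he : e ∈ atlas ℂ X)
    {w : ℂ → ℝ} (hw : ContDiff ℝ ∞ w) (hc : HasCompactSupport w) (hs : tsupport w ⊆ e.target)
    {x : X} (hx : x ∈ e.source) :
    2 * Real.pi * P.lap (chartPull e w) x = Δ w (e x) / P.volDensity e x := by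
  rw [P.lap_eq (isTestFunction_chartPull he hw hc hs) he hx]
  have h : chartPull e w ∘ e.symm =ᶠ[𝓝 (e x)] w := by
    filter_upwards [e.open_target.mem_nhds (e.map_source hx)] with z hz
    rw [Function.comp_apply, chartPull_apply (e.map_target hz), e.right_inv hz]
  rw [(laplacian_congr_nhds h).eq_of_nhds, ← mul_div_assoc, ← mul_assoc,
    mul_inv_cancel₀ (by positivity), one_mul]

theorem contMDiffAt_div_volDensity {e : OpenPartialHomeomorph X ℂ} (he : e ∈ atlas ℂ X)
    {u : X → ℝ} {x : X} (hu : ContMDiffAt 𝓘(ℝ, ℂ) 𝓘(ℝ, ℝ) ∞ u x) (hx : x ∈ e.source) :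
    ContMDiffAt 𝓘(ℝ, ℂ) 𝓘(ℝ, ℝ) ∞ (fun x => u x / P.volDensity e x) x :=
  hu.div₀ (P.contMDiffAt_volDensity he hx) (P.volDensity_pos he hx).ne'

theorem isTestFunction_div_volDensity {e : OpenPartialHomeomorph X ℂ} (he : e ∈ atlas ℂ X)
    {u : X → ℝ} (hu : IsTestFunction u) (hs : tsupport u ⊆ e.source) :
    IsTestFunction fun x => u x / P.volDensity e x := by
  refine contMDiff_of_tsupport fun x hx => P.contMDiffAt_div_volDensity he (hu x) (hs ?_)
  refine closure_mono (fun y hy => ?_) hx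
  rw [Function.mem_support] at hy ⊢
  exact fun h => hy (by rw [h, zero_div])

theorem isTestFunction_mul_volDensity {e : OpenPartialHomeomorph X ℂ} (he : e ∈ atlas ℂ X)
    {u : X → ℝ} (hu : IsTestFunction u) (hs : tsupport u ⊆ e.source) :
    IsTestFunction fun x => u x * P.volDensity e x :=
  contMDiff_of_tsupport fun x hx =>
    (hu x).mul (P.contMDiffAt_volDensity he (hs (tsupport_mul_subset_left hx)))

/-- The error kernel of the parametrix in a chart. -/
theorem continuous_chartKernel {e : OpenPartialHomeomorph X ℂ} {r : ℂ → ℝ}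
    (hr : Continuous r) {θ χ : X → ℝ} (hθ : Continuous θ) (hχ : Continuous χ)
    (hθs : tsupport θ ⊆ e.source) (hχs : tsupport χ ⊆ e.source) :
    Continuous fun p : X × X => θ p.1 * (r (e p.1 - e p.2) * χ p.2) := by
  refine continuous_of_tsupport fun p hp => ?_
  have h1 : tsupport (fun p : X × X => θ p.1 * (r (e p.1 - e p.2) * χ p.2)) ⊆
      tsupport θ ×ˢ tsupport χ := by
    refine closure_minimal (fun q hq => ?_) ((isClosed_tsupport θ).prod (isClosed_tsupport χ))
    rw [Function.mem_support] at hq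
    exact ⟨subset_tsupport _ fun h => hq (by simp [h]), subset_tsupport _ fun h => hq (by simp [h])⟩
  have h2 := h1 hp
  have c1 : ContinuousAt (fun p : X × X => e p.1) p :=
    ContinuousAt.comp (f := Prod.fst) (e.continuousAt (hθs h2.1)) continuousAt_fst
  have c2 : ContinuousAt (fun p : X × X => e p.2) p :=
    ContinuousAt.comp (f := Prod.snd) (e.continuousAt (hχs h2.2)) continuousAt_snd
  exact (hθ.comp continuous_fst).continuousAt.mul
    ((hr.continuousAt.comp (c1.sub c2)).mul (hχ.comp continuous_snd).continuousAt)

/-- The integral of a function which vanishes outside the domain of a chart, computed in this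
chart. -/
theorem integral_eq_chart {e : OpenPartialHomeomorph X ℂ} (he : e ∈ atlas ℂ X)
    {g : X → ℝ} (hg : Continuous g) (hs : ∀ x, x ∉ e.source → g x = 0) :
    ∫ x, g x ∂P.vol = ∫ z in e.target, P.volDensity e (e.symm z) * g (e.symm z) := by
  rw [← P.setIntegral_vol he hg.measurable]
  exact (setIntegral_eq_integral_of_forall_compl_eq_zero hs).symm

/-- In a chart the parametrix is the convolution of the density of `χ σ` with a truncated
logarithm, at a scale so small that the result is still supported in the domain of the chart. -/
theorem exists_localParametrix {e : OpenPartialHomeomorph X ℂ} (he : e ∈ atlas ℂ X)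
    {χ : X → ℝ} (hχ : IsTestFunction χ) (hχ0 : ∀ x, 0 ≤ χ x) (hχ1 : ∀ x, χ x ≤ 1)
    (hs : tsupport χ ⊆ e.source) : Nonempty (P.LocalParametrix χ) := by
  obtain ⟨δ, hδ, hδt⟩ := (isCompact_image_tsupport hs).exists_cthickening_subset_open
    e.open_target (image_tsupport_subset hs)
  set ε := min δ 1 with hε
  obtain ⟨Q⟩ := exists_parametrix (ε := ε) (lt_min hδ one_pos) (min_le_right _ _)
  -- all potentials are supported in `K`
  set K := Metric.cthickening ε (e '' tsupport χ) with hK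
  have hKt : K ⊆ e.target := (Metric.cthickening_mono (min_le_left _ _) _).trans hδt
  have hKc : IsCompact K := (isCompact_image_tsupport hs).cthickening
  have hsK : e.symm '' K ⊆ e.source := by
    rintro _ ⟨z, hz, rfl⟩; exact e.map_target (hKt hz)
  have hsKc : IsCompact (e.symm '' K) := hKc.image_of_continuousOn (e.continuousOn_symm.mono hKt)
  -- the cut-off `θ` extends the error kernel by zero outside the chart in its first variable
  obtain ⟨θ, hθ, hθ0, hθ1, hθK, hθs⟩ := exists_cutoff hsKc.isClosed e.open_source hsK
  -- the density of `χ σ` in the chart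
  set loc : (X → ℝ) → X → ℝ := fun σ x => χ x * P.volDensity e x * σ x with hloc
  have hD : IsTestFunction fun x => χ x * P.volDensity e x :=
    P.isTestFunction_mul_volDensity he hχ hs
  have hloct : ∀ σ, IsTestFunction σ → IsTestFunction (loc σ) := fun σ hσ => hD.mul hσ
  have hlocc : ∀ σ : X → ℝ, Continuous σ → Continuous (loc σ) :=
    fun σ hσ => hD.continuous.mul hσ
  have hlocs' : ∀ σ, tsupport (loc σ) ⊆ tsupport χ := fun σ =>
    tsupport_mul_subset_left.trans tsupport_mul_subset_left
  have hlocs : ∀ σ, tsupport (loc σ) ⊆ e.source := fun σ => (hlocs' σ).trans hs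
  have hzero : ∀ σ z, z ∉ K → ∀ w ∈ Metric.ball z ε, chartPush e (loc σ) w = 0 := by
    intro σ z hz w hw
    refine chartPush_eq_zero fun hw' => hz ?_
    exact Metric.mem_cthickening_of_dist_le z w ε _ (Set.image_mono (hlocs' σ) hw')
      (by rw [dist_comm]; exact (Metric.mem_ball.1 hw).le)
  have hsupp : ∀ {v : ℂ → ℝ}, (∀ z, z ∉ K → v z = 0) →
      HasCompactSupport v ∧ tsupport v ⊆ e.target := by
    intro v hv
    refine ⟨HasCompactSupport.intro hKc hv, (closure_minimal (fun z hz => ?_) hKc.isClosed).trans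
      hKt⟩
    by_contra h
    exact hz (hv z h)
  have hpot : ∀ σ z, z ∉ K → Q.potential (chartPush e (loc σ)) z = 0 := fun σ z hz =>
    Q.potential_eq_zero (hzero σ z hz)
  have herr : ∀ σ z, z ∉ K → Q.error (chartPush e (loc σ)) z = 0 := fun σ z hz =>
    Q.error_eq_zero (hzero σ z hz)
  have hpush : ∀ σ, IsTestFunction σ → ContDiff ℝ ∞ (chartPush e (loc σ)) := fun σ hσ =>
    contDiff_chartPush he (hloct σ hσ) (hlocs σ)
  have hpushc : ∀ σ, HasCompactSupport (chartPush e (loc σ)) := fun σ =>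
    hasCompactSupport_chartPush (hlocs σ)
  have hpotC : ∀ σ, IsTestFunction σ → ContDiff ℝ ∞ (Q.potential (chartPush e (loc σ))) :=
    fun σ hσ => Q.contDiff_potential (hpush σ hσ) (hpushc σ)
  have herrC : ∀ σ : X → ℝ, Continuous σ → ContDiff ℝ ∞ (Q.error (chartPush e (loc σ))) :=
    fun σ hσ => Q.contDiff_error (continuous_chartPush (hlocc σ hσ) (hlocs σ)).locallyIntegrable
  have hop : ∀ σ, IsTestFunction σ → IsTestFunction
      (chartPull e (Q.potential (chartPush e (loc σ)))) := fun σ hσ =>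
    isTestFunction_chartPull he (hpotC σ hσ) (hsupp (hpot σ)).1 (hsupp (hpot σ)).2
  set k : C(X × X, ℝ) := ⟨fun p => θ p.1 / P.volDensity e p.1 * (Q.r (e p.1 - e p.2) * χ p.2),
    continuous_chartKernel Q.contDiff.continuous
      (P.isTestFunction_div_volDensity he hθ hθs).continuous hχ.continuous
      ((closure_mono (Function.support_subset_iff'.2 fun x hx => by
      rw [Function.notMem_support.1 hx, zero_div])).trans hθs) hs⟩ with hk
  have hχsrc : ∀ x, x ∉ e.source → χ x = 0 := fun x hx =>
    image_eq_zero_of_notMem_tsupport fun h => hx (hs h)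
  -- the kernel `k` represents the smoothing error of the planar parametrix
  have hkerr : ∀ σ : X → ℝ, Continuous σ → ∀ x, ∫ y, k (x, y) * σ y ∂P.vol =
      chartPull e (Q.error (chartPush e (loc σ))) x / P.volDensity e x := by
    intro σ hσ x
    by_cases hx : x ∈ e.source
    swap
    · have hθx : θ x = 0 := image_eq_zero_of_notMem_tsupport fun h => hx (hθs h)
      rw [chartPull, Set.indicator_of_notMem hx, zero_div]
      simp [hk, hθx]
    have h1 : ∫ y, Q.r (e x - e y) * χ y * σ y ∂P.vol = Q.error (chartPush e (loc σ)) (e x) := by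
      have hc : Continuous fun y => Q.r (e x - e y) * χ y * σ y := by
        refine Continuous.mul (continuous_of_tsupport fun y hy => ?_) hσ
        have hy' : y ∈ e.source := hs (tsupport_mul_subset_right hy)
        exact (Q.contDiff.continuous.continuousAt.comp
          (continuousAt_const.sub (e.continuousAt hy'))).mul hχ.continuous.continuousAt
      rw [P.integral_eq_chart he hc fun y hy => by rw [hχsrc y hy, mul_zero, zero_mul], Q.error_eq]
      refine Eq.trans ?_ (setIntegral_eq_integral_of_forall_compl_eq_zero (s := e.target)
        fun w hw => by rw [chartPush, Set.indicator_of_notMem hw, mul_zero])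
      refine setIntegral_congr_fun e.open_target.measurableSet fun z hz => ?_
      simp only [chartPush_apply hz, e.right_inv hz, hloc]
      ring
    rw [chartPull_apply hx]
    by_cases hxK : e x ∈ K
    · have hθx : θ x = 1 := (hθK x ⟨e x, hxK, e.left_inv hx⟩).eq_of_nhds
      simp only [hk, ContinuousMap.coe_mk, hθx, mul_assoc]
      rw [integral_const_mul]
      simp only [← mul_assoc]
      rw [h1]; ring
    · simp only [hk, ContinuousMap.coe_mk, mul_assoc]
      rw [integral_const_mul]
      simp only [← mul_assoc]
      rw [h1, herr σ _ hxK]; ring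
  obtain ⟨M, hM0, hM⟩ := exists_abs_le_of_continuous hD.continuous
  obtain ⟨M', hM'⟩ := hKc.exists_bound_of_continuousOn
    ((P.continuousOn_volDensity he).comp (e.continuousOn_symm.mono hKt) fun z hz =>
      e.map_target (hKt hz))
  set L := ∫ w, |Q.ℓ w| with hL
  have hL0 : 0 ≤ L := integral_nonneg fun _ => abs_nonneg _
  have hsb : ∀ (σ : X → ℝ) (A : ℝ), (∀ x, |σ x| ≤ A) → 0 ≤ A →
      ∀ z, |chartPush e (loc σ) z| ≤ M * A := by
    intro σ A hσ hA z
    by_cases hz : z ∈ e.target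
    · rw [chartPush_apply hz, hloc, abs_mul]
      exact mul_le_mul (hM _) (hσ _) (abs_nonneg _) hM0
    · rw [chartPush, Set.indicator_of_notMem hz, abs_zero]; positivity
  refine ⟨⟨fun σ => chartPull e (Q.potential (chartPush e (loc σ))), k, max (L * M) (max M' 0 * L),
    by positivity, hop, fun σ hσ x => ?_, fun σ hσ => ?_, fun σ A hA x => ?_, fun σ h0 x => ?_,
    fun σ hσ h0 => ?_⟩⟩
  · rw [hkerr σ hσ.continuous]
    by_cases hx : x ∈ e.source
    · rw [P.two_pi_mul_lap_chartPull he (hpotC σ hσ) (hsupp (hpot σ)).1 (hsupp (hpot σ)).2 hx,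
        Q.laplacian_potential (hpush σ hσ) (hpushc σ), chartPull_apply hx,
        chartPush_apply (e.map_source hx), e.left_inv hx, add_div, hloc]
      have := (P.volDensity_pos he hx).ne'
      field_simp
    · rw [P.lap_eq_zero_of_notMem_tsupport fun h => hx (tsupport_chartPull_subset
        (hsupp (hpot σ)).1 (hsupp (hpot σ)).2 h), hχsrc x hx, chartPull,
        Set.indicator_of_notMem hx]
      simp
  · rw [show (fun x => ∫ y, k (x, y) * σ y ∂P.vol) = fun x =>
      chartPull e (Q.error (chartPush e (loc σ))) x / P.volDensity e x from
        funext (hkerr σ hσ)]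
    exact P.isTestFunction_div_volDensity he
      (isTestFunction_chartPull he (herrC σ hσ) (hsupp (herr σ)).1 (hsupp (herr σ)).2)
      (tsupport_chartPull_subset (hsupp (herr σ)).1 (hsupp (herr σ)).2)
  · have hA0 : 0 ≤ A := (abs_nonneg _).trans (hA x)
    refine le_trans ?_ (mul_le_mul_of_nonneg_right (le_max_left _ _) hA0)
    by_cases hx : x ∈ e.source
    · rw [chartPull_apply hx, Parametrix.potential]
      calc ‖∫ w, Q.ℓ w * chartPush e (loc σ) (e x - w)‖
          ≤ ∫ w, |Q.ℓ w| * (M * A) := by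
            refine norm_integral_le_of_norm_le (Q.integrable_ℓ.abs.mul_const _)
              (Eventually.of_forall fun w => ?_)
            rw [norm_mul]
            exact mul_le_mul_of_nonneg_left (hsb σ A hA hA0 _) (norm_nonneg _)
        _ = L * M * A := by rw [integral_mul_const]; ring
    · rw [chartPull, Set.indicator_of_notMem hx, abs_zero]; positivity
  · by_cases hx : x ∈ e.source
    · rw [chartPull_apply hx, Parametrix.potential]
      refine integral_nonpos fun w => mul_nonpos_of_nonpos_of_nonneg (Q.nonpos w) ?_
      refine Set.indicator_nonneg (fun z _ => ?_) _
      exact mul_nonneg (mul_nonneg (hχ0 _) (P.volDensity_nonneg e _)) (h0 _)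
    · rw [chartPull, Set.indicator_of_notMem hx]
  · set w := Q.potential (chartPush e (loc σ)) with hw
    have hw0 : ∀ z, w z ≤ 0 := by
      intro z
      refine integral_nonpos fun w => mul_nonpos_of_nonpos_of_nonneg (Q.nonpos w) ?_
      refine Set.indicator_nonneg (fun z _ => ?_) _
      exact mul_nonneg (mul_nonneg (hχ0 _) (P.volDensity_nonneg e _)) (h0 _)
    have hwi : Integrable w := (hpotC σ hσ).continuous.integrable_of_hasCompactSupport
      (hsupp (hpot σ)).1
    have hints : ∫ z, chartPush e (loc σ) z = ∫ x, χ x * σ x ∂P.vol := by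
      rw [P.integral_eq_chart he (hχ.mul hσ).continuous fun y hy => by rw [hχsrc y hy, zero_mul],
        ← setIntegral_eq_integral_of_forall_compl_eq_zero (s := e.target) fun w hw => by
          rw [chartPush, Set.indicator_of_notMem hw]]
      refine setIntegral_congr_fun e.open_target.measurableSet fun z hz => ?_
      simp only [chartPush_apply hz, hloc]
      ring
    have hintw : ∫ z, w z = (∫ z, Q.ℓ z) * ∫ z, chartPush e (loc σ) z :=
      integral_convolution (ContinuousLinearMap.mul ℝ ℝ) Q.integrable_ℓ
        ((hpush σ hσ).continuous.integrable_of_hasCompactSupport (hpushc σ))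
    have hLneg : ∫ z, Q.ℓ z = -L := by
      rw [hL, ← integral_neg]
      congr 1; funext z; rw [abs_of_nonpos (Q.nonpos z), neg_neg]
    have hσint : ∫ x, χ x * σ x ∂P.vol ≤ ∫ x, σ x ∂P.vol :=
      integral_mono (integrable_mul_of_continuous hχ.continuous hσ.continuous)
        (integrable_of_continuous hσ.continuous)
        fun x => mul_le_of_le_one_left (h0 x) (hχ1 x)
    have hσ0 : 0 ≤ ∫ x, σ x ∂P.vol := integral_nonneg h0
    calc -∫ x, chartPull e w x ∂P.vol
        = ∫ z in e.target, P.volDensity e (e.symm z) * -w z := by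
          rw [P.integral_eq_chart he (hop σ hσ).continuous fun y hy => by
            rw [chartPull, Set.indicator_of_notMem hy], ← integral_neg]
          refine setIntegral_congr_fun e.open_target.measurableSet fun z hz => ?_
          simp only [chartPull_apply (e.map_target hz), e.right_inv hz]
          ring
      _ ≤ ∫ z in e.target, max M' 0 * -w z := by
          refine integral_mono_of_nonneg (Eventually.of_forall fun z =>
            mul_nonneg (P.volDensity_nonneg e _) (neg_nonneg.2 (hw0 z)))
            (hwi.neg.const_mul _).integrableOn (Eventually.of_forall fun z => ?_)
          by_cases hz : z ∈ K
          · exact mul_le_mul_of_nonneg_right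
              (((le_abs_self _).trans (hM' z hz)).trans (le_max_left _ _)) (neg_nonneg.2 (hw0 z))
          · simp [hw, hpot σ z hz]
      _ = max M' 0 * L * ∫ x, χ x * σ x ∂P.vol := by
          rw [integral_const_mul, integral_neg,
            setIntegral_eq_integral_of_forall_compl_eq_zero (s := e.target) fun z hz =>
              hpot σ z fun h => hz (hKt h), hintw, hLneg, hints]
          ring
      _ ≤ max M' 0 * L * ∫ x, σ x ∂P.vol := mul_le_mul_of_nonneg_left hσint (by positivity)
      _ ≤ _ := mul_le_mul_of_nonneg_right (le_max_right _ _) hσ0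

/-- Local parametrices add up to a parametrix for the sum of the cut-offs. -/
def LocalParametrix.add {χ χ' : X → ℝ} (G : P.LocalParametrix χ) (G' : P.LocalParametrix χ') :
    P.LocalParametrix fun x => χ x + χ' x where
  op σ x := G.op σ x + G'.op σ x
  ker := G.ker + G'.ker
  const := G.const + G'.const
  const_nonneg := add_nonneg G.const_nonneg G'.const_nonneg
  isTestFunction_op σ hσ := (G.isTestFunction_op σ hσ).add (G'.isTestFunction_op σ hσ)
  two_pi_mul_lap σ hσ x := by
    have h : ∀ k : C(X × X, ℝ), Integrable (fun y => k (x, y) * σ y) P.vol := fun k =>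
      integrable_mul_of_continuous (k.continuous.comp (by fun_prop)) hσ.continuous
    simp only [ContinuousMap.add_apply, add_mul]
    rw [P.lap_add (G.isTestFunction_op σ hσ) (G'.isTestFunction_op σ hσ), mul_add,
      G.two_pi_mul_lap σ hσ, G'.two_pi_mul_lap σ hσ, integral_add (h _) (h _)]
    ring
  isTestFunction_ker σ hσ := by
    have h : ∀ (k : C(X × X, ℝ)) x, Integrable (fun y => k (x, y) * σ y) P.vol := fun k x =>
      integrable_mul_of_continuous (k.continuous.comp (by fun_prop)) hσ
    simp only [ContinuousMap.add_apply, add_mul]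
    simp_rw [integral_add (h G.ker _) (h G'.ker _)]
    exact (G.isTestFunction_ker σ hσ).add (G'.isTestFunction_ker σ hσ)
  abs_op_le σ A hA x := by
    rw [add_mul]
    exact (abs_add_le _ _).trans (add_le_add (G.abs_op_le σ A hA x) (G'.abs_op_le σ A hA x))
  op_nonpos σ h0 x := add_nonpos (G.op_nonpos σ h0 x) (G'.op_nonpos σ h0 x)
  neg_integral_op_le σ hσ h0 := by
    rw [integral_add (integrable_of_continuous (G.isTestFunction_op σ hσ).continuous)
      (integrable_of_continuous (G'.isTestFunction_op σ hσ).continuous), add_mul, neg_add]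
    exact add_le_add (G.neg_integral_op_le σ hσ h0) (G'.neg_integral_op_le σ hσ h0)

theorem χ_le_one {i : X} (hi : i ∈ P.index) (x : X) : P.χ i x ≤ 1 := by
  rw [← P.sum_eq_one x]
  exact Finset.single_le_sum (f := fun j => P.χ j x) (fun j _ => P.nonneg j x) hi

theorem exists_globalParametrix : Nonempty (P.LocalParametrix fun _ => 1) := by
  have h : ∀ s ⊆ P.index, Nonempty (P.LocalParametrix fun x => ∑ i ∈ s, P.χ i x) := by
    classical
    intro s
    induction s using Finset.induction_on with
    | empty =>
      intro _
      exact ⟨{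
        op := fun _ _ => 0
        ker := 0
        const := 0
        const_nonneg := le_rfl
        isTestFunction_op := fun _ _ => isTestFunction_const 0
        two_pi_mul_lap := fun σ _ x => by simp [P.lap_const]
        isTestFunction_ker := fun σ _ => by simpa using isTestFunction_const 0
        abs_op_le := by simp
        op_nonpos := by simp
        neg_integral_op_le := by simp }⟩
    | insert i s his ih =>
      intro hs
      obtain ⟨G⟩ := ih ((Finset.subset_insert i s).trans hs)
      obtain ⟨G'⟩ := P.exists_localParametrix (chart_mem_atlas ℂ i) (P.isTestFunction i)
        (P.nonneg i) (P.χ_le_one (hs (Finset.mem_insert_self i s))) (P.tsupport_subset i)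
      simp_rw [Finset.sum_insert his]
      exact ⟨LocalParametrix.add P G' G⟩
  simpa only [P.sum_eq_one] using h P.index subset_rfl

end ChartPartition

end Parametrix

/-! ### Poisson's equation -/

section Poisson

variable {X : Type*} [TopologicalSpace X] [T2Space X] [CompactSpace X] [ChartedSpace ℂ X]
  [IsManifold 𝓘(ℂ) ω X] [MeasurableSpace X] [BorelSpace X]

namespace ChartPartition

variable (P : ChartPartition X)

/-- Weyl's lemma on the surface. -/
theorem isTestFunction_of_weakly_harmonic {h : X → ℝ} (hh : Continuous h)
    (hw : ∀ φ : X → ℝ, IsTestFunction φ → ∫ x, h x * P.lap φ x ∂P.vol = 0) :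
    IsTestFunction h := by
  refine isTestFunction_of_chart fun x => ?_
  set e := chartAt ℂ x
  have he : e ∈ atlas ℂ X := chart_mem_atlas ℂ x
  refine (contDiffOn_of_weakly_harmonic e.open_target
    (hh.comp_continuousOn e.continuousOn_symm) fun φ hφ hc hs => ?_).contDiffAt
    (e.open_target.mem_nhds (mem_chart_target ℂ x))
  have hpp : chartPush e (chartPull e φ) = φ := by
    funext z
    by_cases hz : z ∈ e.target
    · rw [chartPush_apply hz, chartPull_apply (e.map_target hz), e.right_inv hz]
    · rw [chartPush, Set.indicator_of_notMem hz,
        image_eq_zero_of_notMem_tsupport fun h => hz (hs h)]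
  have h := hw _ (isTestFunction_chartPull he hφ hc hs)
  rw [P.integral_mul_lap_of_tsupport he (isTestFunction_chartPull he hφ hc hs)
    (tsupport_chartPull_subset hc hs) hh.measurable, hpp,
    setIntegral_eq_integral_of_forall_compl_eq_zero fun z hz => by
      rw [image_eq_zero_of_notMem_tsupport fun h => hz (hs (tsupport_laplacian_subset φ h)),
        mul_zero]] at h
  exact (mul_eq_zero.1 h).resolve_left (by positivity)

/-- Up to an operator of finite rank, the Laplacian has a right inverse which is bounded for the
uniform norm: if `G` is the parametrix, with error `K = K₁ + K₂` where `K₁` has finite rank and `K₂`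
is small, it is `G (1 + K₂)⁻¹`. -/
theorem exists_rightInverse_modulo_finiteRank :
    ∃ (ι : Type) (_ : Fintype ι) (b a : ι → X → ℝ) (C : ℝ), 0 ≤ C ∧
      (∀ j, IsTestFunction (b j)) ∧ (∀ j, Continuous (a j)) ∧
      ∀ σ, IsTestFunction σ → ∃ u, IsTestFunction u ∧
        (∀ x, P.lap u x = σ x + ∑ j, (∫ y, a j y * σ y ∂P.vol) * b j x) ∧
        ∀ A : ℝ, (∀ x, |σ x| ≤ A) → ∀ x, |u x| ≤ C * A := by
  have : SecondCountableTopology X := ChartedSpace.secondCountable_of_sigmaCompact ℂ X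
  obtain ⟨G⟩ := P.exists_globalParametrix
  have hδ : 0 < (P.vol.real Set.univ + 1)⁻¹ := by positivity
  obtain ⟨k₁, ⟨ι, hι, b, a, hb, ha, hk₁⟩, hk₂⟩ := exists_smoothFiniteRank_near G.ker hδ
  have hsmall : ‖G.ker - k₁‖ * P.vol.real Set.univ < 1 := by
    have h0 : 0 ≤ P.vol.real Set.univ := measureReal_nonneg
    calc ‖G.ker - k₁‖ * P.vol.real Set.univ
        ≤ (P.vol.real Set.univ + 1)⁻¹ * P.vol.real Set.univ :=
          mul_le_mul_of_nonneg_right hk₂.le h0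
      _ < 1 := by rw [inv_mul_lt_one₀ (by positivity)]; linarith
  obtain ⟨T, T', hT, hTT'⟩ := exists_inverse_one_add_kernelOp P.vol (G.ker - k₁) hsmall
  -- `T σ + K₂ (T σ) = σ`, with `K₂ = K - K₁` and `K₁` of finite rank
  have hsplit : ∀ (τ : C(X, ℝ)) x, kernelOp P.vol (G.ker - k₁) τ x =
      ∫ y, G.ker (x, y) * τ y ∂P.vol - ∑ j, (∫ y, a j y * τ y ∂P.vol) * b j x := by
    intro τ x
    have i1 : Integrable (fun y => G.ker (x, y) * τ y) P.vol :=
      integrable_mul_of_continuous (G.ker.continuous.comp (by fun_prop)) τ.continuous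
    have i2 : ∀ j, Integrable (fun y => b j x * (a j y * τ y)) P.vol := fun j =>
      (integrable_mul_of_continuous (ha j).continuous τ.continuous).const_mul _
    rw [kernelOp_apply]
    simp only [ContinuousMap.sub_apply, hk₁, sub_mul, Finset.sum_mul, mul_assoc]
    rw [integral_sub i1 (integrable_finsetSum _ fun j _ => i2 j), integral_finsetSum _ fun j _ =>
      i2 j]
    congr 1
    refine Finset.sum_congr rfl fun j _ => ?_
    rw [integral_const_mul, mul_comm]
  have hfr : ∀ τ : C(X, ℝ), IsTestFunction fun x => ∑ j, (∫ y, a j y * τ y ∂P.vol) * b j x :=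
    fun τ => IsTestFunction.sum fun j _ => (hb j).const_mul _
  have hTtest : ∀ σ : C(X, ℝ), IsTestFunction σ → IsTestFunction (T σ) := by
    intro σ hσ
    have h : (T σ : X → ℝ) = fun x => σ x - (∫ y, G.ker (x, y) * T σ y ∂P.vol -
        ∑ j, (∫ y, a j y * T σ y ∂P.vol) * b j x) := by
      funext x
      rw [← hsplit, eq_sub_iff_add_eq, ← ContinuousMap.add_apply, hT]
    rw [h]
    exact hσ.sub ((G.isTestFunction_ker _ (T σ).continuous).sub (hfr _))
  set Ta : ι → C(X, ℝ) := fun j => T' ⟨a j, (ha j).continuous⟩ with hTa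
  have haT : ∀ j (σ : C(X, ℝ)), ∫ y, a j y * T σ y ∂P.vol = ∫ y, Ta j y * σ y ∂P.vol :=
    fun j σ => hTT' ⟨a j, (ha j).continuous⟩ σ
  refine ⟨ι, hι, b, fun j => Ta j, 2 * Real.pi * (G.const * ‖T‖), mul_nonneg (by positivity)
      (mul_nonneg G.const_nonneg T.opNorm_nonneg), hb, fun j => (Ta j).continuous,
    fun σ hσ => ?_⟩
  set σ' : C(X, ℝ) := ⟨σ, hσ.continuous⟩ with hσ'
  have hG := G.isTestFunction_op _ (hTtest σ' hσ)
  refine ⟨_, hG.const_mul (2 * Real.pi), fun x => ?_, fun A hA x => ?_⟩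
  · rw [P.lap_const_mul hG, G.two_pi_mul_lap _ (hTtest σ' hσ)]
    have h1 := hsplit (T σ') x
    have h2 : T σ' x + kernelOp P.vol (G.ker - k₁) (T σ') x = σ x := by
      rw [← ContinuousMap.add_apply, hT]; rfl
    have h3 : ∀ j, ∫ y, Ta j y * σ y ∂P.vol = ∫ y, a j y * T σ' y ∂P.vol := fun j =>
      (haT j σ').symm
    simp only [h3]
    linarith
  · have hA0 : 0 ≤ A := (abs_nonneg _).trans (hA x)
    have hTn : ∀ y, |T σ' y| ≤ ‖T‖ * A := fun y =>
      ((T σ').norm_coe_le_norm y).trans ((T.le_opNorm σ').trans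
        (mul_le_mul_of_nonneg_left ((ContinuousMap.norm_le _ hA0).2 hA) T.opNorm_nonneg))
    have h := G.abs_op_le (T σ') _ hTn x
    rw [abs_mul, abs_of_pos (by positivity : (0 : ℝ) < 2 * Real.pi)]
    calc 2 * Real.pi * |G.op (T σ') x| ≤ 2 * Real.pi * (G.const * (‖T‖ * A)) :=
          mul_le_mul_of_nonneg_left h (by positivity)
      _ = _ := by ring

/-- The equation `Δ γ = σ` is solvable if `σ` has mean zero: a linear functional which vanishes on
the range of the Laplacian is the integration against a weakly harmonic function, hence a multiple
of the mean. -/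
theorem exists_lap_eq [ConnectedSpace X] {σ : X → ℝ} (hσ : IsTestFunction σ)
    (h0 : ∫ x, σ x ∂P.vol = 0) : ∃ γ, IsTestFunction γ ∧ ∀ x, P.lap γ x = σ x := by
  obtain ⟨ι, _, b, a, C, -, hb, ha, hS⟩ := P.exists_rightInverse_modulo_finiteRank
  let R : Submodule ℝ (X → ℝ) :=
    { carrier := {u | ∃ γ, IsTestFunction γ ∧ ∀ x, P.lap γ x = u x}
      add_mem' := by
        rintro u v ⟨γ, hγ, h⟩ ⟨γ', hγ', h'⟩
        exact ⟨_, hγ.add hγ', fun x => by rw [P.lap_add hγ hγ', h, h']; rfl⟩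
      zero_mem' := ⟨fun _ => 0, isTestFunction_const 0, fun x => P.lap_const 0 x⟩
      smul_mem' := by
        rintro c u ⟨γ, hγ, h⟩
        exact ⟨_, hγ.const_mul c, fun x => by rw [P.lap_const_mul hγ, h]; rfl⟩ }
  by_contra hcon
  obtain ⟨ν, hν, hR⟩ := Submodule.exists_le_ker_of_notMem (p := R) (v := σ) hcon
  have hνlap : ∀ γ, IsTestFunction γ → ν (P.lap γ) = 0 := fun γ hγ =>
    LinearMap.mem_ker.1 (hR ⟨γ, hγ, fun _ => rfl⟩)
  -- `ν` applied to the equation solved modulo finite rank expresses `ν` through finitely many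
  -- integrals
  set h : X → ℝ := fun x => -∑ j, ν (b j) * a j x with hh
  have hhc : Continuous h := (continuous_finsetSum _ fun j _ => (ha j).const_mul _).neg
  have hrep : ∀ τ, IsTestFunction τ → ν τ = ∫ x, h x * τ x ∂P.vol := by
    intro τ hτ
    obtain ⟨S, hSt, hlap, -⟩ := hS τ hτ
    have h1 : P.lap S = τ + ∑ j, (∫ y, a j y * τ y ∂P.vol) • b j := by
      funext x; rw [hlap]; simp
    have h2 := hνlap _ hSt
    rw [h1, map_add, map_sum] at h2
    simp only [map_smul, smul_eq_mul] at h2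
    rw [eq_neg_of_add_eq_zero_left h2]
    simp only [hh, neg_mul, Finset.sum_mul, mul_assoc]
    rw [integral_neg, integral_finsetSum _ fun j _ =>
      (integrable_mul_of_continuous (ha j) hτ.continuous).const_mul _]
    congr 1
    exact Finset.sum_congr rfl fun j _ => by rw [integral_const_mul, mul_comm]
  have hht : IsTestFunction h := P.isTestFunction_of_weakly_harmonic hhc fun φ hφ => by
    rw [← hrep _ (P.isTestFunction_lap hφ), hνlap φ hφ]
  have hharm : P.lap h = fun _ => 0 := by
    refine P.eq_of_integral_mul_eq (P.isTestFunction_lap hht) (isTestFunction_const 0)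
      fun ψ hψ => ?_
    simp only [zero_mul, integral_zero]
    rw [← hνlap ψ hψ, hrep _ (P.isTestFunction_lap hψ), P.integral_mul_lap_comm hht hψ]
    congr 1; funext x; ring
  obtain ⟨c, hc⟩ := P.exists_eq_const_of_lap_eq_zero hht fun x => congrFun hharm x
  refine hν ?_
  rw [hrep σ hσ]
  simp only [hc]
  rw [integral_const_mul, h0, mul_zero]

theorem abs_integral_mul_le {u v : X → ℝ} {A : ℝ} (hu : Continuous u)
    (hA : ∀ x, |v x| ≤ A) : |∫ x, u x * v x ∂P.vol| ≤ (∫ x, |u x| ∂P.vol) * A := by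
  rw [← integral_mul_const, ← Real.norm_eq_abs]
  refine norm_integral_le_of_norm_le ((integrable_of_continuous hu.abs).mul_const A)
    (Eventually.of_forall fun x => ?_)
  rw [norm_mul]
  exact mul_le_mul_of_nonneg_left (hA x) (norm_nonneg _)

theorem vol_real_pos [Nonempty X] : 0 < P.vol.real Set.univ :=
  ENNReal.toReal_pos (isOpen_univ.measure_pos P.vol Set.univ_nonempty).ne' (measure_ne_top _ _)

/-- Solutions of `Δ γ = σ` can be chosen with a uniform bound: the solution modulo finite rank is
bounded, and it is corrected by the solutions `β_j` of finitely many fixed equations. -/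
theorem exists_lap_eq_abs_le [ConnectedSpace X] : ∃ C : ℝ, 0 ≤ C ∧
    ∀ (σ : X → ℝ) (A : ℝ), IsTestFunction σ → ∫ x, σ x ∂P.vol = 0 → (∀ x, |σ x| ≤ A) →
      ∃ γ, IsTestFunction γ ∧ (∀ x, P.lap γ x = σ x) ∧ ∀ x, |γ x| ≤ C * A := by
  obtain ⟨ι, _, b, a, C, hC0, hb, ha, hS⟩ := P.exists_rightInverse_modulo_finiteRank
  set V := P.vol.real Set.univ with hV
  have hV0 : 0 < V := P.vol_real_pos
  have hβ : ∀ j, ∃ β, IsTestFunction β ∧ ∀ x, P.lap β x = b j x - V⁻¹ * ∫ y, b j y ∂P.vol := by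
    intro j
    refine P.exists_lap_eq ((hb j).sub (isTestFunction_const _)) ?_
    rw [integral_sub (integrable_of_continuous (hb j).continuous) (integrable_const _),
      integral_const, smul_eq_mul, ← hV]
    field_simp
    ring
  choose β hβt hβ using hβ
  choose M hM0 hM using fun j => exists_abs_le_of_continuous (hβt j).continuous
  set N : ι → ℝ := fun j => ∫ x, |a j x| ∂P.vol with hN
  have hN0 : ∀ j, 0 ≤ N j := fun j => integral_nonneg fun _ => abs_nonneg _
  refine ⟨C + ∑ j, N j * M j, add_nonneg hC0 (Finset.sum_nonneg fun j _ =>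
    mul_nonneg (hN0 j) (hM0 j)), fun σ A hσ h0 hA => ?_⟩
  obtain ⟨S, hSt, hlap, hSb⟩ := hS σ hσ
  set c : ι → ℝ := fun j => ∫ y, a j y * σ y ∂P.vol with hc
  have hbeta : IsTestFunction fun x => ∑ j, c j * β j x :=
    IsTestFunction.sum fun j _ => (hβt j).const_mul _
  -- the finite rank error has mean zero
  have hmean : ∑ j, c j * ∫ y, b j y ∂P.vol = 0 := by
    have h := P.integral_lap hSt
    simp only [hlap] at h
    rw [integral_add (integrable_of_continuous hσ.continuous)
      (integrable_finsetSum _ fun j _ =>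
        (integrable_of_continuous (hb j).continuous).const_mul _), h0, zero_add,
      integral_finsetSum _ fun j _ =>
        (integrable_of_continuous (hb j).continuous).const_mul _] at h
    simpa only [integral_const_mul] using h
  refine ⟨_, hSt.sub hbeta, fun x => ?_, fun x => ?_⟩
  · rw [P.lap_sub hSt hbeta, hlap, P.lap_sum _ fun j => (hβt j).const_mul _]
    have : ∑ j, P.lap (fun y => c j * β j y) x = ∑ j, c j * b j x := by
      calc ∑ j, P.lap (fun y => c j * β j y) x
          = ∑ j, (c j * b j x - V⁻¹ * (c j * ∫ y, b j y ∂P.vol)) :=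
            Finset.sum_congr rfl fun j _ => by rw [P.lap_const_mul (hβt j), hβ]; ring
        _ = ∑ j, c j * b j x := by
            rw [Finset.sum_sub_distrib, ← Finset.mul_sum, hmean, mul_zero, sub_zero]
    rw [this]; ring
  · have h1 : |∑ j, c j * β j x| ≤ (∑ j, N j * M j) * A := by
      rw [Finset.sum_mul]
      refine (Finset.abs_sum_le_sum_abs _ _).trans (Finset.sum_le_sum fun j _ => ?_)
      rw [abs_mul, mul_right_comm]
      exact mul_le_mul (P.abs_integral_mul_le (ha j) hA) (hM j x) (abs_nonneg _)
        (mul_nonneg (hN0 j) ((abs_nonneg _).trans (hA x)))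
    rw [add_mul]
    exact (abs_sub _ _).trans (add_le_add (hSb A hA x) h1)

/-- A continuous function is nonnegative if all its integrals against nonnegative test functions
are. -/
theorem nonneg_of_integral_mul_nonneg {w : X → ℝ} (hw : Continuous w)
    (h : ∀ σ, IsTestFunction σ → (∀ x, 0 ≤ σ x) → 0 ≤ ∫ x, w x * σ x ∂P.vol) (x : X) :
    0 ≤ w x := by
  by_contra! hx
  obtain ⟨θ, hθ, hθ0, -, hθ1, hθs⟩ := exists_cutoff (K := {x}) (U := {y | w y < 0})
    isClosed_singleton (isOpen_lt hw continuous_const) (by simpa using hx)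
  have hc : Continuous fun y => -(w y * θ y) := (hw.mul hθ.continuous).neg
  have hpos : 0 < ∫ y, -(w y * θ y) ∂P.vol := by
    refine hc.integral_pos_of_hasCompactSupport_nonneg_nonzero
      (HasCompactSupport.of_compactSpace _) (fun y => ?_) (x := x) ?_
    · by_cases hy : y ∈ tsupport θ
      · exact neg_nonneg.2 (mul_nonpos_of_nonpos_of_nonneg (hθs hy).le (hθ0 y))
      · simp [image_eq_zero_of_notMem_tsupport hy]
    · rw [(hθ1 x rfl).eq_of_nhds]
      simpa using hx.ne
  rw [integral_neg] at hpos
  linarith [h θ hθ hθ0]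

/-- One-sided bound: a function of mean zero whose Laplacian is bounded below by `-A` is bounded
above by a multiple of `A`. The main term has a sign, because the parametrix is nonpositive; the
error term is controlled by duality, with `exists_lap_eq_abs_le`. -/
theorem exists_le_of_lap_ge [ConnectedSpace X] : ∃ C : ℝ, 0 ≤ C ∧
    ∀ (h : X → ℝ) (A : ℝ), IsTestFunction h → ∫ x, h x ∂P.vol = 0 → 0 ≤ A →
      (∀ x, -A ≤ P.lap h x) → ∀ x, h x ≤ C * A := by
  obtain ⟨G⟩ := P.exists_globalParametrix
  obtain ⟨C, hC0, hC⟩ := P.exists_lap_eq_abs_le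
  set V := P.vol.real Set.univ with hV
  have hV0 : 0 < V := P.vol_real_pos
  -- `∫ h ξ = ∫ Δh γ` if `Δγ` is `ξ` minus its mean `m`, and the `L¹` norm of `Δh` is at most
  -- `2 A V` because `Δh ≥ -A` has mean zero
  have hdual : ∀ (h ξ : X → ℝ) (A B : ℝ), IsTestFunction h → IsTestFunction ξ →
      ∫ x, h x ∂P.vol = 0 → 0 ≤ A → (∀ x, -A ≤ P.lap h x) → (∀ x, |ξ x| ≤ B) →
      |∫ x, h x * ξ x ∂P.vol| ≤ 4 * C * V * A * B := by
    intro h ξ A B hh hξ h0 hA hlap hB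
    set m := V⁻¹ * ∫ x, ξ x ∂P.vol with hm
    have hB0 : 0 ≤ B := (abs_nonneg _).trans (hB (Classical.arbitrary X))
    have hmB : |m| ≤ B := by
      have h1 : |∫ x, ξ x ∂P.vol| ≤ B * V :=
        norm_integral_le_of_norm_le_const (f := ξ) (Eventually.of_forall hB)
      rw [hm, abs_mul, abs_of_pos (inv_pos.2 hV0), inv_mul_le_iff₀ hV0]
      linarith
    obtain ⟨γ, hγ, hγlap, hγb⟩ := hC (fun x => ξ x - m) (2 * B)
      (hξ.sub (isTestFunction_const m))
      (by
        rw [integral_sub (integrable_of_continuous hξ.continuous) (integrable_const _),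
          integral_const, smul_eq_mul, ← hV, hm]
        field_simp
        ring)
      (fun x => (abs_sub _ _).trans (by linarith [hB x]))
    have e1 : ∫ x, h x * ξ x ∂P.vol = ∫ x, P.lap h x * γ x ∂P.vol := by
      have h1 : ∫ x, h x * P.lap γ x ∂P.vol = ∫ x, h x * ξ x ∂P.vol := by
        simp only [hγlap, mul_sub]
        rw [integral_sub (integrable_mul_of_continuous hh.continuous hξ.continuous)
          ((integrable_of_continuous hh.continuous).mul_const m), integral_mul_const, h0,
          zero_mul, sub_zero]
      rw [← h1, P.integral_mul_lap_comm hh hγ]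
      congr 1; funext x; ring
    have hlc := (P.isTestFunction_lap hh).continuous
    have e2 : ∫ x, |P.lap h x| ∂P.vol ≤ 2 * A * V := by
      calc ∫ x, |P.lap h x| ∂P.vol ≤ ∫ x, (P.lap h x + 2 * A) ∂P.vol := by
            refine integral_mono (integrable_of_continuous hlc.abs)
              ((integrable_of_continuous hlc).add (integrable_const _)) fun x => ?_
            rcases abs_cases (P.lap h x) with ⟨h1, h2⟩ | ⟨h1, h2⟩ <;> simp only [h1] <;>
              linarith [hlap x]
        _ = 2 * A * V := by
            rw [integral_add (integrable_of_continuous hlc) (integrable_const _),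
              P.integral_lap hh, integral_const, smul_eq_mul, ← hV]
            ring
    rw [e1]
    calc |∫ x, P.lap h x * γ x ∂P.vol| ≤ (∫ x, |P.lap h x| ∂P.vol) * (C * (2 * B)) :=
          P.abs_integral_mul_le hlc hγb
      _ ≤ 2 * A * V * (C * (2 * B)) := mul_le_mul_of_nonneg_right e2 (by positivity)
      _ = _ := by ring
  refine ⟨2 * Real.pi * G.const + 4 * C * V * ‖G.ker‖, by
    have := G.const_nonneg; positivity, fun h A hh h0 hA hlap => ?_⟩
  set D := 2 * Real.pi * G.const + 4 * C * V * ‖G.ker‖ with hD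
  suffices hw : ∀ x, 0 ≤ D * A - h x from fun x => by linarith [hw x]
  refine P.nonneg_of_integral_mul_nonneg (continuous_const.sub hh.continuous) fun σ hσ hσ0 => ?_
  have hGt := G.isTestFunction_op σ hσ
  have hI0 : 0 ≤ ∫ x, σ x ∂P.vol := integral_nonneg hσ0
  have hKt := G.isTestFunction_ker σ hσ.continuous
  have hK : ∀ x, |∫ y, G.ker (x, y) * σ y ∂P.vol| ≤ ‖G.ker‖ * ∫ y, σ y ∂P.vol := by
    intro x
    rw [← integral_const_mul, ← Real.norm_eq_abs]
    refine norm_integral_le_of_norm_le ((integrable_of_continuous hσ.continuous).const_mul _)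
      (Eventually.of_forall fun y => ?_)
    rw [norm_mul, Real.norm_of_nonneg (hσ0 y)]
    exact mul_le_mul_of_nonneg_right (G.ker.norm_coe_le_norm _) (hσ0 y)
  -- Green's identity with the parametrix in place of a Green function
  have h1 : 2 * Real.pi * ∫ x, G.op σ x * P.lap h x ∂P.vol =
      ∫ x, h x * σ x ∂P.vol + ∫ x, h x * ∫ y, G.ker (x, y) * σ y ∂P.vol ∂P.vol := by
    rw [P.integral_mul_lap_comm hGt hh, ← integral_const_mul,
      ← integral_add (integrable_mul_of_continuous hh.continuous hσ.continuous)
        (integrable_mul_of_continuous hh.continuous hKt.continuous)]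
    congr 1; funext x
    have := G.two_pi_mul_lap σ hσ x
    rw [one_mul] at this
    rw [← mul_add, ← this]; ring
  have h2 : ∫ x, G.op σ x * P.lap h x ∂P.vol ≤ A * (G.const * ∫ x, σ x ∂P.vol) := by
    calc ∫ x, G.op σ x * P.lap h x ∂P.vol ≤ ∫ x, -A * G.op σ x ∂P.vol := by
          refine integral_mono (integrable_mul_of_continuous hGt.continuous
            (P.isTestFunction_lap hh).continuous)
            ((integrable_of_continuous hGt.continuous).const_mul _) fun x => ?_
          show _ ≤ _
          nlinarith [G.op_nonpos σ hσ0 x, hlap x]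
      _ = A * -∫ x, G.op σ x ∂P.vol := by rw [integral_const_mul]; ring
      _ ≤ _ := mul_le_mul_of_nonneg_left (G.neg_integral_op_le σ hσ hσ0) hA
  have h3 := (abs_le.1 (hdual h _ A _ hh hKt h0 hA hlap hK)).1
  have h4 : ∫ x, h x * σ x ∂P.vol ≤ D * A * ∫ x, σ x ∂P.vol := by
    have := mul_le_mul_of_nonneg_left h2 (by positivity : (0 : ℝ) ≤ 2 * Real.pi)
    rw [hD]
    nlinarith
  have h5 : ∫ x, (D * A - h x) * σ x ∂P.vol =
      D * A * ∫ x, σ x ∂P.vol - ∫ x, h x * σ x ∂P.vol := by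
    simp only [sub_mul]
    rw [integral_sub ((integrable_of_continuous hσ.continuous).const_mul _)
      (integrable_mul_of_continuous hh.continuous hσ.continuous), integral_const_mul]
  rw [h5]
  linarith

end ChartPartition

end Poisson

/-! ### Pull-back of smooth measures -/

section Fibers

theorem summable_enat {ι : Type*} (a : ι → ℕ∞) : Summable a :=
  ⟨_, hasSum_of_isLUB _ isLUB_iSup⟩

theorem toENNReal_tsum {ι : Type*} (a : ι → ℕ∞) :
    ((∑' i, a i : ℕ∞) : ℝ≥0∞) = ∑' i, (a i : ℝ≥0∞) :=
  (summable_enat a).map_tsum ENat.toENNRealRingHom ENat.continuous_toENNReal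

/-- A map of finite degree is nowhere locally constant. -/
theorem HasDegree.localDegree_ne_top {X : Type*} [TopologicalSpace X] [ChartedSpace ℂ X]
    {f : X → X} {d : ℕ} (hdeg : HasDegree f d) (x : X) : localDegree f x ≠ ⊤ := by
  have h : localDegree f x ≤ (d : ℕ∞) := by
    rw [← hdeg (f x)]
    exact (summable_enat fun x' : f ⁻¹' {f x} => localDegree f x').le_tsum' ⟨x, rfl⟩
  exact ne_top_of_le_ne_top (ENat.natCast_ne_top d) h

variable {X : Type*} [TopologicalSpace X] [T2Space X] [CompactSpace X] [ChartedSpace ℂ X]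
  [IsManifold 𝓘(ℂ) ω X] [MeasurableSpace X] [BorelSpace X]

theorem localDegree_eq (f : X → X) (x : X) : localDegree f x =
    analyticOrderAt (fun z => (chartAt ℂ (f x) ∘ f ∘ (chartAt ℂ x).symm) z -
      (chartAt ℂ (f x) ∘ f ∘ (chartAt ℂ x).symm) (chartAt ℂ x x)) (chartAt ℂ x x) := by
  simp [localDegree, writtenInExtChartAt, Function.comp_def]

/-- A piece on which `f` is injective, of constant local degree, and which is either contained in
a chart and free of critical points, or reduced to a point. -/
def IsBranch (f : X → X) (B : Set X) : Prop :=
  Set.InjOn f B ∧ ((∃ e ∈ atlas ℂ X, ∃ e' ∈ atlas ℂ X, B ⊆ e.source ∧ B ⊆ f ⁻¹' e'.source ∧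
    ∀ x ∈ B, localDegree f x = 1) ∨ B.Subsingleton)

theorem IsBranch.mono {f : X → X} {B B' : Set X} (h : IsBranch f B) (hB : B' ⊆ B) :
    IsBranch f B' := by
  refine ⟨h.1.mono hB, ?_⟩
  rcases h.2 with ⟨e, he, e', he', h1, h2, h3⟩ | h
  · exact Or.inl ⟨e, he, e', he', hB.trans h1, hB.trans h2, fun x hx => h3 x (hB hx)⟩
  · exact Or.inr (h.anti hB)

theorem isBranch_singleton (f : X → X) (x : X) : IsBranch f {x} :=
  ⟨Set.injOn_singleton f x, Or.inr Set.subsingleton_singleton⟩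

theorem IsBranch.exists_localDegree {f : X → X} {B : Set X} (h : IsBranch f B) :
    ∃ m : ℕ∞, ∀ x ∈ B, localDegree f x = m := by
  rcases h.2 with ⟨e, he, e', he', h1, h2, h3⟩ | h
  · exact ⟨1, h3⟩
  · rcases B.eq_empty_or_nonempty with rfl | ⟨x, hx⟩
    · exact ⟨1, by simp⟩
    · exact ⟨localDegree f x, fun y hy => by rw [h hx hy]⟩

namespace ChartPartition

variable (P : ChartPartition X)

theorem jacobian_ne_zero_iff {f : X → X} (hf : MDifferentiable 𝓘(ℂ) 𝓘(ℂ) f)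
    {e e' : OpenPartialHomeomorph X ℂ} (he : e ∈ atlas ℂ X) (he' : e' ∈ atlas ℂ X) {x : X}
    (hx : x ∈ e.source) (hfx : f x ∈ e'.source) :
    P.jacobian f x ≠ 0 ↔ deriv (e' ∘ f ∘ e.symm) (e x) ≠ 0 := by
  rw [P.jacobian_eq hf he he' hx hfx, conformalFactor]
  have h1 := (P.volDensity_pos he hx).ne'
  have h2 := (P.volDensity_pos he' hfx).ne'
  simp [h1, h2]

theorem localDegree_eq_one {f : X → X} (hf : MDifferentiable 𝓘(ℂ) 𝓘(ℂ) f) {x : X}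
    (hx : P.jacobian f x ≠ 0) : localDegree f x = 1 := by
  have hx' := (P.jacobian_ne_zero_iff hf (chart_mem_atlas ℂ x) (chart_mem_atlas ℂ (f x))
    (mem_chart_source ℂ x) (mem_chart_source ℂ (f x))).1 hx
  rw [localDegree_eq]
  exact (analyticAt_chart_comp hf (chart_mem_atlas ℂ x) (chart_mem_atlas ℂ (f x))
    (mem_chart_source ℂ x) (mem_chart_source ℂ (f x))).analyticOrderAt_sub_eq_one_of_deriv_ne_zero
    hx'

/-- Inverse function theorem: near a noncritical point `f` is injective and has local degree one.
-/
theorem exists_isBranch_nhds {f : X → X} (hf : MDifferentiable 𝓘(ℂ) 𝓘(ℂ) f) {x : X}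
    (hx : P.jacobian f x ≠ 0) : ∃ U ∈ 𝓝 x, IsBranch f U := by
  set e := chartAt ℂ x
  set e' := chartAt ℂ (f x)
  have he : e ∈ atlas ℂ X := chart_mem_atlas ℂ x
  have he' : e' ∈ atlas ℂ X := chart_mem_atlas ℂ (f x)
  have hxe : x ∈ e.source := mem_chart_source ℂ x
  have hfx : f x ∈ e'.source := mem_chart_source ℂ (f x)
  have hd := (P.jacobian_ne_zero_iff hf he he' hxe hfx).1 hx
  have hs := (analyticAt_chart_comp hf he he' hxe hfx).hasStrictDerivAt.hasStrictFDerivAt_equiv hd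
  have hinv := (e.continuousAt hxe).eventually hs.eventually_left_inverse
  have hJ : ∀ᶠ y in 𝓝 x, P.jacobian f y ≠ 0 :=
    (P.isTestFunction_jacobian hf).continuous.continuousAt.eventually_ne hx
  refine ⟨_, inter_mem (inter_mem (e.open_source.mem_nhds hxe)
    (hf.continuous.continuousAt (e'.open_source.mem_nhds hfx))) (inter_mem hinv hJ), ?_, Or.inl
    ⟨e, he, e', he', fun y hy => hy.1.1, fun y hy => hy.1.2, fun y hy =>
      P.localDegree_eq_one hf hy.2.2⟩⟩
  rintro y ⟨⟨hy, -⟩, hy', -⟩ z ⟨⟨hz, -⟩, hz', -⟩ hyz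
  refine e.injOn hy hz ?_
  rw [Set.mem_ofPred_eq] at hy' hz'
  rw [← hy', ← hz']
  simp only [Function.comp_apply, e.left_inv hy, e.left_inv hz, hyz]

/-- Critical points are isolated where the local degree is finite, as the zeros of the derivative
in charts. -/
theorem countable_setOf_jacobian_eq_zero {f : X → X} (hf : MDifferentiable 𝓘(ℂ) 𝓘(ℂ) f)
    (hdeg : ∀ x, localDegree f x ≠ ⊤) : {x | P.jacobian f x = 0}.Countable := by
  have : SecondCountableTopology X := ChartedSpace.secondCountable_of_sigmaCompact ℂ X
  have h : ∀ x, ∃ U ∈ 𝓝 x, ∀ y ∈ U, y ≠ x → P.jacobian f y ≠ 0 := by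
    intro x
    set e := chartAt ℂ x with he_def
    set e' := chartAt ℂ (f x) with he'_def
    have he : e ∈ atlas ℂ X := chart_mem_atlas ℂ x
    have he' : e' ∈ atlas ℂ X := chart_mem_atlas ℂ (f x)
    have hxe : x ∈ e.source := mem_chart_source ℂ x
    have hfx : f x ∈ e'.source := mem_chart_source ℂ (f x)
    have hF := analyticAt_chart_comp hf he he' hxe hfx
    rcases hF.deriv.eventually_eq_zero_or_eventually_ne_zero with h0 | h0
    · refine absurd ?_ (hdeg x)
      rw [localDegree_eq, ← hF.analyticOrderAt_deriv_add_one, analyticOrderAt_eq_top.2 h0, top_add]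
    · rw [eventually_nhdsWithin_iff] at h0
      refine ⟨_, inter_mem (inter_mem (e.open_source.mem_nhds hxe)
        (hf.continuous.continuousAt (e'.open_source.mem_nhds hfx)))
        ((e.continuousAt hxe).eventually h0), ?_⟩
      rintro y ⟨⟨hy, hy'⟩, h0⟩ hyx
      exact (P.jacobian_ne_zero_iff hf he he' hy hy').2 (h0 fun h => hyx (e.injOn hy hxe h))
  choose U hU hU' using h
  obtain ⟨t, ht, htU⟩ := TopologicalSpace.countable_cover_nhds hU
  refine ht.mono fun x hx => ?_
  obtain ⟨c, hc, hxc⟩ := Set.mem_iUnion₂.1 (htU ▸ Set.mem_univ x)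
  by_cases h : x = c
  · rwa [h]
  · exact absurd hx (hU' c x hxc h)

/-- The surface is a countable disjoint union of Borel sets on which `f` is injective with constant
local degree; each of them is free of critical points or has at most one
point. -/
theorem exists_branchPartition {f : X → X} (hf : MDifferentiable 𝓘(ℂ) 𝓘(ℂ) f)
    (hdeg : ∀ x, localDegree f x ≠ ⊤) [Nonempty X] : ∃ B : ℕ → Set X, (∀ n, MeasurableSet (B n)) ∧
      Pairwise (Function.onFun Disjoint B) ∧ ⋃ n, B n = Set.univ ∧ ∀ n, IsBranch f (B n) := by
  obtain ⟨P⟩ := exists_chartPartition X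
  have : SecondCountableTopology X := ChartedSpace.secondCountable_of_sigmaCompact ℂ X
  choose! U hU hUb using fun x => P.exists_isBranch_nhds hf (x := x)
  obtain ⟨t, htR, htc, htU⟩ := TopologicalSpace.countable_cover_nhdsWithin
    (s := {x | P.jacobian f x ≠ 0}) (f := fun x => interior (U x))
    fun x hx => mem_nhdsWithin_of_mem_nhds (interior_mem_nhds.2 (hU x hx))
  set 𝒮 : Set (Set X) := (fun x => interior (U x)) '' t ∪
    (fun x => {x}) '' {x | P.jacobian f x = 0} with h𝒮
  have h𝒮c : 𝒮.Countable := (htc.image _).union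
    ((P.countable_setOf_jacobian_eq_zero hf hdeg).image _)
  have hcov : ⋃₀ 𝒮 = Set.univ := by
    refine Set.eq_univ_of_forall fun x => ?_
    by_cases hx : P.jacobian f x = 0
    · exact ⟨{x}, Or.inr ⟨x, hx, rfl⟩, rfl⟩
    · obtain ⟨c, hc, hxc⟩ := Set.mem_iUnion₂.1 (htU hx)
      exact ⟨_, Or.inl ⟨c, hc, rfl⟩, hxc⟩
  have hne : 𝒮.Nonempty := by
    obtain ⟨S, hS, -⟩ := Set.mem_sUnion.1 (hcov ▸ Set.mem_univ (Classical.arbitrary X))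
    exact ⟨S, hS⟩
  obtain ⟨A, hA⟩ := h𝒮c.exists_eq_range hne
  have hgood : ∀ S ∈ 𝒮, MeasurableSet S ∧ IsBranch f S := by
    rintro _ (⟨x, hx, rfl⟩ | ⟨x, hx, rfl⟩)
    · exact ⟨isOpen_interior.measurableSet, (hUb x (htR hx)).mono interior_subset⟩
    · exact ⟨measurableSet_singleton x, isBranch_singleton f x⟩
  have hAg : ∀ n, MeasurableSet (A n) ∧ IsBranch f (A n) := fun n =>
    hgood _ (hA ▸ Set.mem_range_self n)
  refine ⟨disjointed A, MeasurableSet.disjointed fun n => (hAg n).1, disjoint_disjointed A, ?_,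
    fun n => (hAg n).2.mono (disjointed_le A n)⟩
  rw [iUnion_disjointed, ← hcov, hA, Set.sUnion_range]

theorem vol_singleton (x : X) : P.vol {x} = 0 := by
  have he := chart_mem_atlas ℂ x
  have hx : {x} ⊆ (chartAt ℂ x).source := Set.singleton_subset_iff.2 (mem_chart_source ℂ x)
  rw [P.vol_apply he (measurableSet_singleton x) hx,
    setLIntegral_chartVolume _ (measurableSet_singleton x) hx
      (P.aemeasurable_volDensity he (measurableSet_singleton x) hx).ennreal_ofReal]
  exact setLIntegral_measure_zero _ _ (by simp)

theorem smoothMeasure_apply (s : X → ℝ) {A : Set X} (hA : MeasurableSet A) :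
    P.smoothMeasure s A = ∫⁻ x in A, ENNReal.ofReal (s x) ∂P.vol := withDensity_apply _ hA

/-- Change of variables on a piece free of critical points. -/
theorem smoothMeasure_image {f : X → X} (hf : MDifferentiable 𝓘(ℂ) 𝓘(ℂ) f) {s : X → ℝ}
    (hs : Continuous s) {e e' : OpenPartialHomeomorph X ℂ}
    (he : e ∈ atlas ℂ X) (he' : e' ∈ atlas ℂ X) {B : Set X}
    (hB : MeasurableSet B) (hBe : B ⊆ e.source) (hBe' : B ⊆ f ⁻¹' e'.source)
    (hinj : Set.InjOn f B) (hfB : MeasurableSet (f '' B)) :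
    P.smoothMeasure s (f '' B) = P.smoothMeasure (fun x => s (f x) * P.jacobian f x) B := by
  classical
  have hfBe : f '' B ⊆ e'.source := Set.image_subset_iff.2 hBe'
  set D := e'.source.indicator (P.volDensity e') with hD
  have hDm : Measurable D := by
    rw [hD, ← Set.piecewise_eq_indicator]
    exact (P.continuousOn_volDensity he').measurable_piecewise continuousOn_const
      e'.open_source.measurableSet
  have hsJ : Continuous fun x => s (f x) * P.jacobian f x :=
    (hs.comp hf.continuous).mul (P.isTestFunction_jacobian hf).continuous
  rw [P.smoothMeasure_apply _ hfB, P.smoothMeasure_apply _ hB,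
    P.setLIntegral_vol he' hfB hfBe hs.measurable.ennreal_ofReal.aemeasurable,
    P.setLIntegral_vol he hB hBe
      hsJ.measurable.ennreal_ofReal.aemeasurable]
  rw [setLIntegral_congr_fun (g := fun y => ENNReal.ofReal (D y) * ENNReal.ofReal (s y)) hfB
    fun y hy => by simp only [hD, Set.indicator_of_mem (hfBe hy)],
    setLIntegral_chartVolume_image hf he he' hB hBe hBe' hinj hfB
      (g := fun y => ENNReal.ofReal (D y) * ENNReal.ofReal (s y)) (hDm.ennreal_ofReal.mul hs.measurable.ennreal_ofReal)]
  refine setLIntegral_congr_fun hB fun x hx => ?_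
  have h1 := P.volDensity_pos he (hBe hx)
  simp only [hD, Set.indicator_of_mem (show f x ∈ e'.source from hBe' hx)]
  rw [← ENNReal.ofReal_mul (P.volDensity_nonneg _ _), ← ENNReal.ofReal_mul
    (conformalFactor_nonneg _ _ _ _), ← ENNReal.ofReal_mul (P.volDensity_nonneg _ _),
    P.jacobian_eq hf he he' (hBe hx) (hBe' hx)]
  congr 1
  field_simp

end ChartPartition

theorem fiberMeasure_apply (f : X → X) (y : X) {A : Set X} (hA : MeasurableSet A) :
    fiberMeasure f y A = ∑' x : f ⁻¹' {y}, (localDegree f x : ℝ≥0∞) * A.indicator 1 (x : X) := by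
  rw [fiberMeasure, Measure.sum_apply _ hA]
  simp [Measure.dirac_apply' _ hA]

/-- Over a partition into pieces on which `f` is injective of local degree `m n`, the sum over a
fibre becomes a sum over the pieces, whose terms are measurable functions of the base point. -/
theorem fiberMeasure_apply_eq_tsum {f : X → X} {B : ℕ → Set X} {m : ℕ → ℕ∞}
    (hdisj : Pairwise (Function.onFun Disjoint B)) (hcov : ⋃ n, B n = Set.univ)
    (hinj : ∀ n, Set.InjOn f (B n)) (hm : ∀ n, ∀ x ∈ B n, localDegree f x = m n) (y : X) {A : Set X}
    (hA : MeasurableSet A) : fiberMeasure f y A =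
      ∑' n, (m n : ℝ≥0∞) * (f '' (B n ∩ A)).indicator 1 y := by
  have h1 : ∀ x, (localDegree f x : ℝ≥0∞) * A.indicator 1 x =
      ∑' n, (m n : ℝ≥0∞) * (B n ∩ A).indicator 1 x := by
    intro x
    obtain ⟨n, hn⟩ := Set.mem_iUnion.1 (hcov ▸ Set.mem_univ x)
    rw [tsum_eq_single n, hm n x hn]
    · congr 1
      by_cases hx : x ∈ A <;> simp [hx, hn]
    · intro k hk
      have : x ∉ B k := fun h => Set.disjoint_left.1 (hdisj hk) h hn
      simp [this]
  rw [fiberMeasure_apply f y hA, tsum_congr fun x : f ⁻¹' {y} => h1 x, ENNReal.tsum_comm]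
  refine tsum_congr fun n => ?_
  rw [ENNReal.tsum_mul_left]
  congr 1
  by_cases hy : y ∈ f '' (B n ∩ A)
  · obtain ⟨x, hx, rfl⟩ := hy
    rw [tsum_eq_single (⟨x, rfl⟩ : f ⁻¹' {f x}), Set.indicator_of_mem hx,
      Set.indicator_of_mem (Set.mem_image_of_mem f hx)]
    · rfl
    · rintro ⟨z, hz⟩ hzx
      refine Set.indicator_of_notMem (fun h => hzx ?_) _
      exact Subtype.ext (hinj n h.1 hx.1 hz)
  · rw [Set.indicator_of_notMem hy, ENNReal.tsum_eq_zero]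
    rintro ⟨z, rfl⟩
    exact Set.indicator_of_notMem (fun h => hy ⟨z, h, rfl⟩) _

/-- Injective continuous images of Borel sets are Borel (Lusin–Souslin). -/
theorem measurableSet_image_of_injOn {f : X → X} (hf : Continuous f) {B : Set X}
    (hB : MeasurableSet B) (hinj : Set.InjOn f B) : MeasurableSet (f '' B) := by
  have := polishSpace_of_surface X
  exact hB.image_of_continuousOn_injOn hf.continuousOn hinj

theorem measurable_fiberMeasure {f : X → X} (hf : MDifferentiable 𝓘(ℂ) 𝓘(ℂ) f)
    (hdeg : ∀ x, localDegree f x ≠ ⊤) [Nonempty X] : Measurable (fiberMeasure f) := by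
  obtain ⟨P⟩ := exists_chartPartition X
  obtain ⟨B, hB, hdisj, hcov, hbr⟩ := ChartPartition.exists_branchPartition hf hdeg
  choose m hm using fun n => (hbr n).exists_localDegree
  refine Measure.measurable_of_measurable_coe _ fun A hA => ?_
  simp_rw [fiberMeasure_apply_eq_tsum hdisj hcov (fun n => (hbr n).1) hm _ hA]
  refine Measurable.tsum fun n => (measurable_one.indicator ?_).const_mul _
  exact measurableSet_image_of_injOn hf.continuous ((hB n).inter hA)
    ((hbr n).1.mono Set.inter_subset_left)

/-- The pull-back of a smooth measure is smooth, with density `(s ∘ f) · Jac f`. -/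
theorem ChartPartition.pullback_smoothMeasure (P : ChartPartition X) [Nonempty X] {f : X → X}
    (hf : MDifferentiable 𝓘(ℂ) 𝓘(ℂ) f) (hdeg : ∀ x, localDegree f x ≠ ⊤) {s : X → ℝ}
    (hs : Continuous s) :
    pullback f (P.smoothMeasure s) = P.smoothMeasure fun x => s (f x) * P.jacobian f x := by
  obtain ⟨B, hB, hdisj, hcov, hbr⟩ := ChartPartition.exists_branchPartition hf hdeg
  choose m hm using fun n => (hbr n).exists_localDegree
  have hnull : ∀ (t : X → ℝ) x, P.smoothMeasure t {x} = 0 := fun t x => by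
    rw [P.smoothMeasure_apply t (measurableSet_singleton x)]
    exact setLIntegral_measure_zero _ _ (P.vol_singleton x)
  ext A hA
  have him : ∀ n, MeasurableSet (f '' (B n ∩ A)) := fun n =>
    measurableSet_image_of_injOn hf.continuous ((hB n).inter hA)
      ((hbr n).1.mono Set.inter_subset_left)
  rw [pullback, Measure.bind_apply hA (measurable_fiberMeasure hf hdeg).aemeasurable]
  simp_rw [fiberMeasure_apply_eq_tsum hdisj hcov (fun n => (hbr n).1) hm _ hA]
  rw [lintegral_tsum fun n => ((measurable_one.indicator (him n)).const_mul _).aemeasurable]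
  have hA' : A = ⋃ n, B n ∩ A := by rw [← Set.iUnion_inter, hcov, Set.univ_inter]
  conv_rhs => rw [hA', measure_iUnion (fun i j hij => (hdisj hij).mono Set.inter_subset_left
    Set.inter_subset_left) fun n => (hB n).inter hA]
  refine tsum_congr fun n => ?_
  rw [lintegral_const_mul _ (measurable_one.indicator (him n)), lintegral_indicator_one (him n)]
  have hBA := (hbr n).mono (B' := B n ∩ A) Set.inter_subset_left
  rcases hBA.2 with ⟨e, he, e', he', h1, h2, h3⟩ | h
  · rw [P.smoothMeasure_image hf hs he he' ((hB n).inter hA) h1 h2 hBA.1 (him n)]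
    rcases (B n ∩ A).eq_empty_or_nonempty with h0 | ⟨x, hx⟩
    · simp [h0]
    · rw [← hm n x hx.1, h3 x hx]; simp
  · rcases h.eq_empty_or_singleton with h0 | ⟨x, hx⟩
    · simp [h0]
    · rw [hx, Set.image_singleton, hnull, hnull, mul_zero]

/-- `f_* f^* ν = d ν`. -/
theorem pullback_preimage [Nonempty X] {f : X → X} (hf : MDifferentiable 𝓘(ℂ) 𝓘(ℂ) f) {d : ℕ}
    (hdeg : HasDegree f d) (ν : Measure X) {A : Set X} (hA : MeasurableSet A) :
    pullback f ν (f ⁻¹' A) = d * ν A := by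
  have hfA := hf.continuous.measurable hA
  rw [pullback, Measure.bind_apply hfA
    (measurable_fiberMeasure hf hdeg.localDegree_ne_top).aemeasurable]
  have h : ∀ y, fiberMeasure f y (f ⁻¹' A) = A.indicator (fun _ => (d : ℝ≥0∞)) y := by
    intro y
    have hd : ∑' x : f ⁻¹' {y}, (localDegree f x : ℝ≥0∞) = d := by
      rw [← toENNReal_tsum, hdeg y]; simp
    rw [fiberMeasure_apply f y hfA]
    by_cases hy : y ∈ A
    · rw [Set.indicator_of_mem hy, ← hd]
      refine tsum_congr ?_
      rintro ⟨x, rfl⟩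
      rw [Set.indicator_of_mem (show x ∈ f ⁻¹' A from hy), Pi.one_apply, mul_one]
    · rw [Set.indicator_of_notMem hy, ENNReal.tsum_eq_zero]
      rintro ⟨x, rfl⟩
      rw [Set.indicator_of_notMem (show x ∉ f ⁻¹' A from hy), mul_zero]
  simp_rw [h]
  rw [lintegral_indicator_const hA]

/-- The identity `f_* f^* ν = d ν` for a smooth measure `ν`, in terms of its density. -/
theorem ChartPartition.integral_comp_mul_jacobian (P : ChartPartition X) [Nonempty X] {f : X → X}
    (hf : MDifferentiable 𝓘(ℂ) 𝓘(ℂ) f) {d : ℕ} (hdeg : HasDegree f d) {s ψ : X → ℝ}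
    (hs : Continuous s) (hs0 : ∀ x, 0 ≤ s x) (hψ : Continuous ψ) :
    ∫ x, s (f x) * P.jacobian f x * ψ (f x) ∂P.vol = d * ∫ x, s x * ψ x ∂P.vol := by
  have hsJ : Continuous fun x => s (f x) * P.jacobian f x :=
    (hs.comp hf.continuous).mul (P.isTestFunction_jacobian hf).continuous
  have hmap : (pullback f (P.smoothMeasure s)).map f = (d : ℝ≥0∞) • P.smoothMeasure s := by
    ext A hA
    rw [Measure.map_apply hf.continuous.measurable hA, pullback_preimage hf hdeg _ hA]
    rfl
  rw [P.pullback_smoothMeasure hf hdeg.localDegree_ne_top hs] at hmap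
  have h := congrArg (fun ν => ∫ x, ψ x ∂ν) hmap
  simp only [integral_smul_measure] at h
  rw [integral_map hf.continuous.aemeasurable hψ.aestronglyMeasurable,
    P.integral_smoothMeasure hsJ
      (fun x => mul_nonneg (hs0 _) (P.jacobian_nonneg f x)), P.integral_smoothMeasure hs hs0] at h
  simpa using h

end Fibers

/-! ### The transfer operator -/

section Transfer

variable {X : Type*} [TopologicalSpace X] [T2Space X] [CompactSpace X] [ChartedSpace ℂ X]
  [IsManifold 𝓘(ℂ) ω X] [MeasurableSpace X] [BorelSpace X]

theorem IsTestFunction.comp_iterate {u : X → ℝ} (hu : IsTestFunction u) {f : X → X}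
    (hf : MDifferentiable 𝓘(ℂ) 𝓘(ℂ) f) (n : ℕ) : IsTestFunction fun x => u (f^[n] x) := by
  induction n with
  | zero => exact hu
  | succ n ih => exact ih.comp_holomorphic hf

/-- Test functions are dense in the continuous functions. A function on `X` is regarded as a kernel
which does not depend on the second variable; restricting an approximating smooth kernel of finite
rank to a fixed second variable gives a test function. -/
theorem exists_isTestFunction_near {u : X → ℝ} (hu : Continuous u) {δ : ℝ} (hδ : 0 < δ) :
    ∃ θ, IsTestFunction θ ∧ ∀ x, |u x - θ x| ≤ δ := by
  rcases isEmpty_or_nonempty X with hX | ⟨⟨y⟩⟩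
  · exact ⟨fun _ => 0, isTestFunction_const 0, fun x => (hX.false x).elim⟩
  obtain ⟨k, ⟨ι, _, b, a, hb, -, hk⟩, hlt⟩ :=
    exists_smoothFiniteRank_near ⟨fun p : X × X => u p.1, hu.comp continuous_fst⟩ hδ
  refine ⟨fun x => k (x, y), ?_, fun x =>
    (ContinuousMap.norm_coe_le_norm (_ - k) (x, y)).trans hlt.le⟩
  simp only [hk, mul_comm (b _ _)]
  exact IsTestFunction.sum fun j _ => (hb j).const_mul _

theorem measure_eq_of_integral_testFunction_eq {μ ν : Measure X} [IsFiniteMeasure μ]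
    [IsFiniteMeasure ν]
    (h : ∀ ψ : X → ℝ, IsTestFunction ψ → ∫ x, ψ x ∂μ = ∫ x, ψ x ∂ν) : μ = ν := by
  have := polishSpace_of_surface X
  refine ext_of_forall_integral_eq_of_IsFiniteMeasure fun u => ?_
  refine eq_of_forall_dist_le fun ε hε => ?_
  set V := μ.real Set.univ + ν.real Set.univ with hV
  have hV0 : 0 ≤ V := add_nonneg measureReal_nonneg measureReal_nonneg
  obtain ⟨θ, hθ, hnear⟩ := exists_isTestFunction_near u.continuous
    (δ := ε / (V + 1)) (by positivity)
  have key : ∀ (ρ : Measure X) [IsFiniteMeasure ρ],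
      |∫ x, u x ∂ρ - ∫ x, θ x ∂ρ| ≤ ε / (V + 1) * ρ.real Set.univ := by
    intro ρ _
    rw [← integral_sub (integrable_of_continuous u.continuous)
      (integrable_of_continuous hθ.continuous)]
    exact norm_integral_le_of_norm_le_const (f := fun x => u x - θ x) (Eventually.of_forall hnear)
  have h1 := abs_le.1 (key μ)
  have h2 := abs_le.1 (key ν)
  have h3 : ε / (V + 1) * V ≤ ε := by
    rw [div_mul_eq_mul_div, div_le_iff₀ (by positivity)]
    nlinarith
  have h4 : ε / (V + 1) * V = ε / (V + 1) * μ.real Set.univ + ε / (V + 1) * ν.real Set.univ := by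
    rw [hV]; ring
  rw [Real.dist_eq, abs_le]
  have h5 := h θ hθ
  constructor <;> linarith

namespace ChartPartition

variable (P : ChartPartition X)

/-- The operator `s ↦ d⁻¹ (s ∘ f) Jac f`, which maps the density of `ν` to that of `d⁻¹ f^* ν`. -/
def transfer (f : X → X) (d : ℕ) : Module.End ℝ (X → ℝ) where
  toFun s x := (d : ℝ)⁻¹ * (s (f x) * P.jacobian f x)
  map_add' s t := by ext x; simp only [Pi.add_apply]; ring
  map_smul' c s := by ext x; simp only [Pi.smul_apply, smul_eq_mul, RingHom.id_apply]; ring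

theorem transfer_apply (f : X → X) (d : ℕ) (s : X → ℝ) (x : X) :
    P.transfer f d s x = (d : ℝ)⁻¹ * (s (f x) * P.jacobian f x) := rfl

theorem transfer_pow_succ (f : X → X) (d : ℕ) (s : X → ℝ) (n : ℕ) (x : X) :
    (P.transfer f d ^ (n + 1)) s x =
      (d : ℝ)⁻¹ * ((P.transfer f d ^ n) s (f x) * P.jacobian f x) := by
  rw [pow_succ', Module.End.mul_apply, transfer_apply]

/-- The `n`-th iterate of the transfer operator is linear over multiplication by `a ∘ f^n`. -/
theorem transfer_pow_mul (f : X → X) (d : ℕ) (a s : X → ℝ) (n : ℕ) (x : X) :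
    (P.transfer f d ^ n) (fun y => a y * s y) x = a (f^[n] x) * (P.transfer f d ^ n) s x := by
  induction n generalizing x with
  | zero => simp
  | succ n ih => rw [transfer_pow_succ, transfer_pow_succ, ih, Function.iterate_succ_apply]; ring

variable {f : X → X} (hf : MDifferentiable 𝓘(ℂ) 𝓘(ℂ) f) {d : ℕ}

include hf in
/-- The transfer operator contracts potentials: `transfer^n (Δu) = Δ(d^{-n} u ∘ f^n)`. -/
theorem transfer_pow_lap {u : X → ℝ} (hu : IsTestFunction u) (n : ℕ) (x : X) :
    (P.transfer f d ^ n) (P.lap u) x = P.lap (fun y => ((d : ℝ) ^ n)⁻¹ * u (f^[n] y)) x := by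
  induction n generalizing x with
  | zero => simp
  | succ n ih =>
    rw [transfer_pow_succ, ih, P.lap_const_mul (hu.comp_iterate hf n),
      P.lap_const_mul (hu.comp_iterate hf (n + 1))]
    have := P.lap_comp (hu.comp_iterate hf n) hf x
    simp only [Function.iterate_succ_apply]
    rw [this, pow_succ, mul_inv]
    ring

end ChartPartition

end Transfer

/-! ### The canonical measure -/

section Canonical

theorem summable_inv_pow_mul {d : ℕ} (hd : 2 ≤ d) (M : ℝ) :
    Summable fun j : ℕ => ((d : ℝ) ^ j)⁻¹ * M := by
  have hd' : (2 : ℝ) ≤ d := by exact_mod_cast hd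
  simp_rw [← inv_pow]
  exact (summable_geometric_of_lt_one (by positivity)
    (inv_lt_one_of_one_lt₀ (by linarith))).mul_right M

variable {X : Type*} [TopologicalSpace X] [T2Space X] [CompactSpace X] [ChartedSpace ℂ X]
  [IsManifold 𝓘(ℂ) ω X] [MeasurableSpace X] [BorelSpace X]

/-- The partial sums of the potential. -/
def partialPotential (f : X → X) (d : ℕ) (γ : X → ℝ) (n : ℕ) (x : X) : ℝ :=
  ∑ j ∈ Finset.range n, ((d : ℝ) ^ j)⁻¹ * γ (f^[j] x)

theorem abs_potential_term_le {γ : X → ℝ} {M : ℝ} (hM : ∀ x, |γ x| ≤ M) (f : X → X) (d j : ℕ)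
    (x : X) : |((d : ℝ) ^ j)⁻¹ * γ (f^[j] x)| ≤ ((d : ℝ) ^ j)⁻¹ * M := by
  rw [abs_mul, abs_of_nonneg (by positivity : (0 : ℝ) ≤ ((d : ℝ) ^ j)⁻¹)]
  exact mul_le_mul_of_nonneg_left (hM _) (by positivity)

theorem exists_abs_partialPotential_le {γ : X → ℝ} (hγ : Continuous γ) {d : ℕ} (hd : 2 ≤ d)
    (f : X → X) : ∃ M : ℝ, 0 ≤ M ∧ ∀ n x, |partialPotential f d γ n x| ≤ M := by
  obtain ⟨M, hM0, hM⟩ := exists_abs_le_of_continuous hγ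
  refine ⟨∑' j : ℕ, ((d : ℝ) ^ j)⁻¹ * M, tsum_nonneg fun j => by positivity, fun n x => ?_⟩
  exact (Finset.abs_sum_le_sum_abs _ _).trans
    ((Finset.sum_le_sum fun j _ => abs_potential_term_le hM f d j x).trans
      ((summable_inv_pow_mul hd M).sum_le_tsum _ fun j _ => by positivity))

theorem continuous_greenPotential {γ : X → ℝ} (hγ : Continuous γ) {d : ℕ} (hd : 2 ≤ d)
    {f : X → X} (hf : Continuous f) : Continuous (greenPotential f d γ) := by
  obtain ⟨M, hM0, hM⟩ := exists_abs_le_of_continuous hγ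
  exact continuous_tsum (fun j => (hγ.comp (hf.iterate j)).const_mul _)
    (summable_inv_pow_mul hd M) fun j x => abs_potential_term_le hM f d j x

theorem tendsto_partialPotential {γ : X → ℝ} (hγ : Continuous γ) {d : ℕ} (hd : 2 ≤ d)
    (f : X → X) (x : X) : Tendsto (fun n => partialPotential f d γ n x) atTop
      (𝓝 (greenPotential f d γ x)) := by
  obtain ⟨M, hM0, hM⟩ := exists_abs_le_of_continuous hγ
  exact (Summable.of_norm_bounded (summable_inv_pow_mul hd M)
    fun j => abs_potential_term_le hM f d j x).hasSum.tendsto_sum_nat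

theorem isTestFunction_partialPotential {γ : X → ℝ} (hγ : IsTestFunction γ) {f : X → X}
    (hf : MDifferentiable 𝓘(ℂ) 𝓘(ℂ) f) (d n : ℕ) : IsTestFunction (partialPotential f d γ n) :=
  IsTestFunction.sum fun j _ => (hγ.comp_iterate hf j).const_mul _

namespace ChartPartition

variable (P : ChartPartition X)

theorem isTestFunction_transfer_pow {f : X → X} (hf : MDifferentiable 𝓘(ℂ) 𝓘(ℂ) f) (d : ℕ)
    {s : X → ℝ} (hs : IsTestFunction s) (n : ℕ) : IsTestFunction ((P.transfer f d ^ n) s) := by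
  induction n with
  | zero => exact hs
  | succ n ih =>
    rw [funext (P.transfer_pow_succ f d s n)]
    exact ((ih.comp_holomorphic hf).mul (P.isTestFunction_jacobian hf)).const_mul _

theorem transfer_pow_nonneg (f : X → X) (d : ℕ) {s : X → ℝ} (hs : ∀ x, 0 ≤ s x) (n : ℕ) (x : X) :
    0 ≤ (P.transfer f d ^ n) s x := by
  induction n generalizing x with
  | zero => exact hs x
  | succ n ih =>
    rw [transfer_pow_succ]
    exact mul_nonneg (by positivity) (mul_nonneg (ih _) (P.jacobian_nonneg f x))

section Dynamics

variable {f : X → X} (hf : MDifferentiable 𝓘(ℂ) 𝓘(ℂ) f) {d : ℕ} (hd : 2 ≤ d)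
  (hdeg : HasDegree f d) [Nonempty X]

include hf hd hdeg

/-- Duality between the transfer operator and composition with `f`, from `f_* f^* = d`. -/
theorem integral_transfer_pow_succ_mul {s ψ : X → ℝ} (hs : IsTestFunction s) (hs0 : ∀ x, 0 ≤ s x)
    (hψ : Continuous ψ) (n : ℕ) :
    ∫ x, (P.transfer f d ^ (n + 1)) s x * ψ (f x) ∂P.vol =
      ∫ x, (P.transfer f d ^ n) s x * ψ x ∂P.vol := by
  have hd0 : (d : ℝ) ≠ 0 := by positivity
  have h := P.integral_comp_mul_jacobian hf hdeg
    (P.isTestFunction_transfer_pow hf d hs n).continuous (P.transfer_pow_nonneg f d hs0 n) hψ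
  simp only [transfer_pow_succ, mul_assoc] at h ⊢
  rw [integral_const_mul, h, inv_mul_cancel_left₀ hd0]

theorem integral_transfer_pow {s : X → ℝ} (hs : IsTestFunction s) (hs0 : ∀ x, 0 ≤ s x) (n : ℕ) :
    ∫ x, (P.transfer f d ^ n) s x ∂P.vol = ∫ x, s x ∂P.vol := by
  induction n with
  | zero => simp
  | succ n ih =>
    rw [← ih]
    simpa using P.integral_transfer_pow_succ_mul hf hd hdeg hs hs0 (ψ := fun _ => 1)
      continuous_const n

end Dynamics

/-- A smooth probability density `s`, with a potential `γ` of `d⁻¹ f^*(s vol) - s vol`. -/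
structure IsSeed (f : X → X) (d : ℕ) (s γ : X → ℝ) : Prop where
  isTestFunction_density : IsTestFunction s
  nonneg : ∀ x, 0 ≤ s x
  integral_eq_one : ∫ x, s x ∂P.vol = 1
  isTestFunction_potential : IsTestFunction γ
  transfer_eq : ∀ x, P.transfer f d s x = s x + P.lap γ x

variable {P}

/-- The iterates of the transfer operator change a seed by the Laplacian of a partial sum of the
potential. -/
theorem IsSeed.transfer_pow_eq {f : X → X} {d : ℕ} {s γ : X → ℝ} (h : P.IsSeed f d s γ)
    (hf : MDifferentiable 𝓘(ℂ) 𝓘(ℂ) f) (n : ℕ) (x : X) :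
    (P.transfer f d ^ n) s x = s x + P.lap (partialPotential f d γ n) x := by
  induction n generalizing x with
  | zero =>
    have : partialPotential f d γ 0 = fun _ => 0 := by funext x; simp [partialPotential]
    simp [this, P.lap_const]
  | succ n ih =>
    have h1 : P.transfer f d s = s + P.lap γ := funext h.transfer_eq
    have h2 : partialPotential f d γ (n + 1) = fun y => partialPotential f d γ n y +
        ((d : ℝ) ^ n)⁻¹ * γ (f^[n] y) := by
      funext y; simp only [partialPotential, Finset.sum_range_succ]
    rw [pow_succ, Module.End.mul_apply, h1, map_add, Pi.add_apply, ih,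
      P.transfer_pow_lap hf h.isTestFunction_potential, h2,
      P.lap_add (isTestFunction_partialPotential h.isTestFunction_potential hf d n)
        ((h.isTestFunction_potential.comp_iterate hf n).const_mul _)]
    ring

/-- The iterated pull-backs converge, as distributions, to `s + Δ g` with `g` the full potential.
-/
theorem IsSeed.tendsto_integral {f : X → X} {d : ℕ} {s γ : X → ℝ} (h : P.IsSeed f d s γ)
    (hf : MDifferentiable 𝓘(ℂ) 𝓘(ℂ) f) (hd : 2 ≤ d) {ψ : X → ℝ} (hψ : IsTestFunction ψ) :
    Tendsto (fun n => ∫ x, (P.transfer f d ^ n) s x * ψ x ∂P.vol) atTop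
      (𝓝 (∫ x, s x * ψ x ∂P.vol + ∫ x, greenPotential f d γ x * P.lap ψ x ∂P.vol)) := by
  have hγ := h.isTestFunction_potential
  have hlap := (P.isTestFunction_lap hψ).continuous
  have hG := fun n => isTestFunction_partialPotential hγ hf d n
  have h1 : ∀ n, ∫ x, (P.transfer f d ^ n) s x * ψ x ∂P.vol = ∫ x, s x * ψ x ∂P.vol +
      ∫ x, partialPotential f d γ n x * P.lap ψ x ∂P.vol := by
    intro n
    rw [P.integral_mul_lap_comm (hG n) hψ, ← integral_add
      (integrable_mul_of_continuous h.isTestFunction_density.continuous hψ.continuous)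
      (integrable_mul_of_continuous hψ.continuous (P.isTestFunction_lap (hG n)).continuous)]
    congr 1; funext x
    rw [h.transfer_pow_eq hf]; ring
  simp_rw [h1]
  refine tendsto_const_nhds.add ?_
  obtain ⟨M, hM0, hM⟩ := exists_abs_partialPotential_le hγ.continuous hd f
  refine tendsto_integral_of_dominated_convergence (fun x => M * |P.lap ψ x|)
    (fun n => (integrable_mul_of_continuous (hG n).continuous hlap).aestronglyMeasurable)
    ((integrable_of_continuous hlap.abs).const_mul M)
    (fun n => Eventually.of_forall fun x => ?_) (Eventually.of_forall fun x => ?_)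
  · rw [norm_mul]
    exact mul_le_mul_of_nonneg_right (hM n x) (norm_nonneg _)
  · exact (tendsto_partialPotential hγ.continuous hd f x).mul_const _

/-- Passing to the limit along the preimages of two smooth densities gives the same measure:
their difference is a Laplacian, which is contracted by the factor `d⁻¹`. -/
theorem tendsto_integral_transfer_pow_sub [ConnectedSpace X] {f : X → X}
    (hf : MDifferentiable 𝓘(ℂ) 𝓘(ℂ) f) {d : ℕ} (hd : 2 ≤ d) {s t : X → ℝ}
    (hs : IsTestFunction s) (ht : IsTestFunction t)
    (hst : ∫ x, s x ∂P.vol = ∫ x, t x ∂P.vol) {ψ : X → ℝ} (hψ : IsTestFunction ψ) :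
    Tendsto (fun n => ∫ x, (P.transfer f d ^ n) s x * ψ x ∂P.vol -
      ∫ x, (P.transfer f d ^ n) t x * ψ x ∂P.vol) atTop (𝓝 0) := by
  obtain ⟨u, hu, hlap⟩ := P.exists_lap_eq (hs.sub ht) (by
    rw [integral_sub (integrable_of_continuous hs.continuous)
      (integrable_of_continuous ht.continuous), hst, sub_self])
  obtain ⟨M, hM0, hM⟩ := exists_abs_le_of_continuous hu.continuous
  set L := ∫ x, |P.lap ψ x| ∂P.vol with hL
  have hψl := (P.isTestFunction_lap hψ).continuous
  have hst' : s - t = P.lap u := (funext hlap).symm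
  have hi : ∀ {w : X → ℝ} n, IsTestFunction w →
      Integrable (fun x => (P.transfer f d ^ n) w x * ψ x) P.vol := fun n hw =>
    integrable_mul_of_continuous (P.isTestFunction_transfer_pow hf d hw n).continuous hψ.continuous
  have h1 : ∀ n, ∫ x, (P.transfer f d ^ n) s x * ψ x ∂P.vol -
      ∫ x, (P.transfer f d ^ n) t x * ψ x ∂P.vol =
      ((d : ℝ) ^ n)⁻¹ * ∫ x, P.lap ψ x * u (f^[n] x) ∂P.vol := by
    intro n
    have hun := (hu.comp_iterate hf n).const_mul ((d : ℝ) ^ n)⁻¹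
    rw [← integral_sub (hi n hs) (hi n ht)]
    calc ∫ x, ((P.transfer f d ^ n) s x * ψ x - (P.transfer f d ^ n) t x * ψ x) ∂P.vol
        = ∫ x, ψ x * P.lap (fun y => ((d : ℝ) ^ n)⁻¹ * u (f^[n] y)) x ∂P.vol := by
          congr 1; funext x
          rw [← P.transfer_pow_lap hf hu, ← hst', map_sub, Pi.sub_apply]; ring
      _ = _ := by
          rw [P.integral_mul_lap_comm hψ hun, ← integral_const_mul]
          congr 1; funext x; ring
  simp_rw [h1]
  refine squeeze_zero_norm (a := fun n => ((d : ℝ) ^ n)⁻¹ * (L * M)) (fun n => ?_)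
    (summable_inv_pow_mul hd (L * M)).tendsto_atTop_zero
  rw [norm_mul, Real.norm_of_nonneg (by positivity : (0 : ℝ) ≤ ((d : ℝ) ^ n)⁻¹)]
  exact mul_le_mul_of_nonneg_left (P.abs_integral_mul_le hψl fun x => hM _) (by positivity)

theorem exists_isSeed [ConnectedSpace X] {f : X → X}
    (hf : MDifferentiable 𝓘(ℂ) 𝓘(ℂ) f) {d : ℕ} (hd : 2 ≤ d) (hdeg : HasDegree f d) {s : X → ℝ}
    (hs : IsTestFunction s) (hs0 : ∀ x, 0 ≤ s x) (hs1 : ∫ x, s x ∂P.vol = 1) :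
    ∃ γ, P.IsSeed f d s γ := by
  have hT := P.isTestFunction_transfer_pow hf d hs 1
  obtain ⟨γ, hγ, hlap⟩ := P.exists_lap_eq (hT.sub hs) (by
    rw [integral_sub (integrable_of_continuous hT.continuous)
      (integrable_of_continuous hs.continuous), P.integral_transfer_pow hf hd hdeg hs hs0, sub_self])
  refine ⟨γ, hs, hs0, hs1, hγ, fun x => ?_⟩
  rw [hlap, pow_one]; ring

theorem isProbabilityMeasure_smoothMeasure {s : X → ℝ} (hs : Continuous s) (hs0 : ∀ x, 0 ≤ s x)
    (hs1 : ∫ x, s x ∂P.vol = 1) : IsProbabilityMeasure (P.smoothMeasure s) := by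
  have := P.isFiniteMeasure_smoothMeasure hs
  have h := P.integral_smoothMeasure hs hs0 fun _ => 1
  simp only [mul_one, hs1, integral_const, smul_eq_mul] at h
  exact ⟨by rw [← ENNReal.toReal_eq_one_iff]; exact h⟩

/-- `d⁻¹ f^*(s vol) = s vol + Δ γ` in the sense of distributions means that `γ` is a potential. -/
theorem isSeed_iff {f : X → X} (hf : MDifferentiable 𝓘(ℂ) 𝓘(ℂ) f) {d : ℕ} (hd : 2 ≤ d)
    (hdeg : HasDegree f d) [Nonempty X] {s γ : X → ℝ} (hs : IsTestFunction s) (hs0 : ∀ x, 0 ≤ s x)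
    (hs1 : ∫ x, s x ∂P.vol = 1) (hγ : IsTestFunction γ) :
    P.IsSeed f d s γ ↔
      EqAddLaplacian ((d : ℝ≥0∞)⁻¹ • pullback f (P.smoothMeasure s)) (P.smoothMeasure s) γ := by
  have hT := P.isTestFunction_transfer_pow hf d hs 1
  have hT0 := P.transfer_pow_nonneg f d hs0 1
  rw [pow_one] at hT hT0
  have hd0 : (0 : ℝ) < d := by positivity
  have h1 : (d : ℝ≥0∞)⁻¹ • pullback f (P.smoothMeasure s) =
      P.smoothMeasure (P.transfer f d s) := by
    have hm : Measurable fun x => ENNReal.ofReal (s (f x) * P.jacobian f x) :=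
      ((hs.comp_holomorphic hf).mul (P.isTestFunction_jacobian hf)).continuous.measurable.ennreal_ofReal
    rw [P.pullback_smoothMeasure hf hdeg.localDegree_ne_top hs.continuous, smoothMeasure,
      smoothMeasure, ← withDensity_smul _ hm]
    congr 1; funext x
    rw [transfer_apply, ENNReal.ofReal_mul (by positivity), ENNReal.ofReal_inv_of_pos hd0,
      ENNReal.ofReal_natCast]
    rfl
  rw [h1, P.eqAddLaplacian_smoothMeasure_iff hT hT0 hs hs0 hγ]
  exact ⟨fun h => h.transfer_eq, fun h => ⟨hs, hs0, hs1, hγ, h⟩⟩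

/-- A measure is canonical for a seed exactly when it is the limit of the iterated pull-backs. -/
theorem IsSeed.eqAddLaplacian_greenPotential_iff {f : X → X} {d : ℕ} {s γ : X → ℝ}
    (h : P.IsSeed f d s γ) (hf : MDifferentiable 𝓘(ℂ) 𝓘(ℂ) f) (hd : 2 ≤ d) {μ : Measure X}
    [IsFiniteMeasure μ] : EqAddLaplacian μ (P.smoothMeasure s) (greenPotential f d γ) ↔
      ∀ ψ : X → ℝ, IsTestFunction ψ → Tendsto
        (fun n => ∫ x, (P.transfer f d ^ n) s x * ψ x ∂P.vol) atTop (𝓝 (∫ x, ψ x ∂μ)) := by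
  have hsc := h.isTestFunction_density.continuous
  have := P.isFiniteMeasure_smoothMeasure hsc
  rw [P.eqAddLaplacian_iff
    (continuous_greenPotential h.isTestFunction_potential.continuous hd hf.continuous)]
  refine forall₂_congr fun ψ hψ => ?_
  rw [P.integral_smoothMeasure hsc h.nonneg]
  have hlim := h.tendsto_integral hf hd hψ
  exact ⟨fun h' => h' ▸ hlim, fun h' => tendsto_nhds_unique h' hlim⟩

/-- The measures with densities `(P.transfer f d ^ n) s` converge: a limit point exists by
compactness, and all of them have the same integrals of test functions. -/
theorem IsSeed.exists_limit {f : X → X} {d : ℕ} {s γ : X → ℝ} (h : P.IsSeed f d s γ)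
    (hf : MDifferentiable 𝓘(ℂ) 𝓘(ℂ) f) (hd : 2 ≤ d) (hdeg : HasDegree f d) [Nonempty X] :
    ∃ μ : Measure X, IsProbabilityMeasure μ ∧ ∀ ψ : X → ℝ, IsTestFunction ψ → Tendsto
      (fun n => ∫ x, (P.transfer f d ^ n) s x * ψ x ∂P.vol) atTop (𝓝 (∫ x, ψ x ∂μ)) := by
  have := polishSpace_of_surface X
  have hs := h.isTestFunction_density
  have hS := fun n => (P.isTestFunction_transfer_pow hf d hs n).continuous
  have hS0 := P.transfer_pow_nonneg f d h.nonneg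
  let m : ℕ → ProbabilityMeasure X := fun n => ⟨P.smoothMeasure ((P.transfer f d ^ n) s),
    isProbabilityMeasure_smoothMeasure (hS n) (hS0 n)
      (by rw [P.integral_transfer_pow hf hd hdeg hs h.nonneg, h.integral_eq_one])⟩
  obtain ⟨μ, hμ⟩ := exists_clusterPt_of_compactSpace (map m atTop)
  refine ⟨μ, inferInstance, fun ψ hψ => ?_⟩
  have hlim := h.tendsto_integral hf hd hψ
  set c := ∫ x, s x * ψ x ∂P.vol + ∫ x, greenPotential f d γ x * P.lap ψ x ∂P.vol
  let Ψ : BoundedContinuousFunction X ℝ := BoundedContinuousFunction.mkOfCompact ⟨ψ, hψ.continuous⟩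
  have hcont : Continuous fun ν : ProbabilityMeasure X => ∫ x, ψ x ∂(ν : Measure X) :=
    continuous_iff_continuousAt.2 fun ν =>
      (ProbabilityMeasure.tendsto_iff_forall_integral_tendsto.1 tendsto_id) Ψ
  have hcl : MapClusterPt (∫ x, ψ x ∂(μ : Measure X)) atTop
      fun n => ∫ x, ψ x ∂(m n : Measure X) :=
    MapClusterPt.continuousAt_comp (u := m) hcont.continuousAt hμ
  have hm : (fun n => ∫ x, ψ x ∂(m n : Measure X)) =
      fun n => ∫ x, (P.transfer f d ^ n) s x * ψ x ∂P.vol :=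
    funext fun n => P.integral_smoothMeasure (hS n) (hS0 n) ψ
  rw [hm] at hcl
  have : ∫ x, ψ x ∂(μ : Measure X) = c := by
    by_contra hne
    have := hcl.clusterPt.mono (show map _ atTop ≤ 𝓝 c from hlim)
    exact hne (t2_iff_nhds.1 inferInstance this.neBot)
  rwa [this]

end ChartPartition

end Canonical

/-! ### Decay of correlations and mixing -/

section Correlations

variable {X : Type*} [TopologicalSpace X] [T2Space X] [CompactSpace X] [ChartedSpace ℂ X]
  [IsManifold 𝓘(ℂ) ω X] [MeasurableSpace X] [BorelSpace X]

namespace ChartPartition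

variable {P : ChartPartition X}

theorem exists_lap_eq_integral_eq_zero [ConnectedSpace X] {σ : X → ℝ} (hσ : IsTestFunction σ)
    (h0 : ∫ x, σ x ∂P.vol = 0) :
    ∃ γ, IsTestFunction γ ∧ (∀ x, P.lap γ x = σ x) ∧ ∫ x, γ x ∂P.vol = 0 := by
  obtain ⟨γ, hγ, hlap⟩ := P.exists_lap_eq hσ h0
  have hV := P.vol_real_pos
  refine ⟨_, hγ.sub (isTestFunction_const ((P.vol.real Set.univ)⁻¹ * ∫ x, γ x ∂P.vol)),
    fun x => by rw [P.lap_sub hγ (isTestFunction_const _), P.lap_const, sub_zero, hlap], ?_⟩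
  rw [integral_sub (integrable_of_continuous hγ.continuous) (integrable_const _),
    integral_const, smul_eq_mul]
  field_simp
  ring

theorem eq_of_lap_eq [ConnectedSpace X] {u v : X → ℝ} (hu : IsTestFunction u)
    (hv : IsTestFunction v) (hlap : ∀ x, P.lap u x = P.lap v x)
    (hint : ∫ x, u x ∂P.vol = ∫ x, v x ∂P.vol) (x : X) : u x = v x := by
  obtain ⟨c, hc⟩ := P.exists_eq_const_of_lap_eq_zero (hu.sub hv) fun x => by
    rw [P.lap_sub hu hv, hlap, sub_self]
  have h : ∫ x, (u x - v x) ∂P.vol = 0 := by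
    rw [integral_sub (integrable_of_continuous hu.continuous)
      (integrable_of_continuous hv.continuous), hint, sub_self]
  simp only [hc, integral_const, smul_eq_mul] at h
  have := hc x
  rw [(mul_eq_zero.1 h).resolve_left P.vol_real_pos.ne'] at this
  linarith

/-- The equations `Δ h = (φ - c) S_m`, where `S_m` is the density of `d^{-m} (f^m)^* (s vol)` and
`c` is the mean of `φ`, have solutions bounded uniformly in `m` by the uniform norm of `φ`. This
holds although the `S_m` are not bounded: `(φ ± A) S_m` has a sign, which gives one-sided bounds,
and the sum of the two solutions is a multiple of the potential of `S_m`. -/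
theorem IsSeed.exists_lap_eq_sub_mul [ConnectedSpace X] {f : X → X} {d : ℕ} {s γ : X → ℝ}
    (h : P.IsSeed f d s γ) (hf : MDifferentiable 𝓘(ℂ) 𝓘(ℂ) f) (hd : 2 ≤ d)
    (hdeg : HasDegree f d) : ∃ C : ℝ, 0 ≤ C ∧ ∀ (m : ℕ) (φ : X → ℝ) (A : ℝ), IsTestFunction φ →
      (∀ x, |φ x| ≤ A) → ∃ u, IsTestFunction u ∧ (∀ x, P.lap u x =
        (φ x - ∫ y, (P.transfer f d ^ m) s y * φ y ∂P.vol) * (P.transfer f d ^ m) s x) ∧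
        ∀ x, |u x| ≤ C * A := by
  obtain ⟨B, hB0, hB⟩ := exists_abs_partialPotential_le h.isTestFunction_potential.continuous hd f
  obtain ⟨C, hC0, hC⟩ := P.exists_le_of_lap_ge
  have hs := h.isTestFunction_density
  obtain ⟨M, hM0, hM⟩ := exists_abs_le_of_continuous hs.continuous
  have hV := P.vol_real_pos
  refine ⟨2 * C * M + 6 * B, by positivity, fun m φ A hφ hA => ?_⟩
  have hA0 : 0 ≤ A := (abs_nonneg _).trans (hA (Classical.arbitrary X))
  set S := (P.transfer f d ^ m) s with hS
  have hSt : IsTestFunction S := P.isTestFunction_transfer_pow hf d hs m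
  have hS0 : ∀ x, 0 ≤ S x := P.transfer_pow_nonneg f d h.nonneg m
  have hS1 : ∫ x, S x ∂P.vol = 1 := by
    rw [P.integral_transfer_pow hf hd hdeg hs h.nonneg, h.integral_eq_one]
  set G := partialPotential f d γ m with hG
  have hGt : IsTestFunction G := isTestFunction_partialPotential h.isTestFunction_potential hf d m
  have hSG : ∀ x, S x = s x + P.lap G x := h.transfer_pow_eq hf m
  set c := ∫ y, S y * φ y ∂P.vol with hc
  have hcA : |c| ≤ A := by
    have := P.abs_integral_mul_le hSt.continuous hA
    simp only [abs_of_nonneg (hS0 _), hS1, one_mul] at this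
    exact this
  -- a solution bounded above, for each sign of `φ`
  have solve : ∀ φ' : X → ℝ, IsTestFunction φ' → (∀ x, |φ' x| ≤ A) →
      |∫ y, S y * φ' y ∂P.vol| ≤ A → ∃ u, IsTestFunction u ∧
        (∀ x, P.lap u x = (φ' x + A) * S x - (∫ y, S y * φ' y ∂P.vol + A) * s x) ∧
        ∫ x, u x ∂P.vol = 0 ∧ ∀ x, u x ≤ C * (2 * A * M) := by
    intro φ' hφ' hA' hc'
    set c' := ∫ y, S y * φ' y ∂P.vol with hcd
    have ht1 : IsTestFunction fun x => (φ' x + A) * S x := (hφ'.add (isTestFunction_const A)).mul hSt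
    have ht2 : IsTestFunction fun x => (c' + A) * s x := hs.const_mul _
    obtain ⟨u, hu, hlap, hu0⟩ := exists_lap_eq_integral_eq_zero (P := P) (ht1.sub ht2) (by
      rw [integral_sub (integrable_of_continuous ht1.continuous)
        (integrable_of_continuous ht2.continuous), integral_const_mul, h.integral_eq_one]
      have : ∫ x, (φ' x + A) * S x ∂P.vol = c' + A := by
        calc ∫ x, (φ' x + A) * S x ∂P.vol = ∫ x, (S x * φ' x + A * S x) ∂P.vol := by
              congr 1; funext x; ring
          _ = c' + A := by
              rw [integral_add (integrable_mul_of_continuous hSt.continuous hφ'.continuous)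
                ((integrable_of_continuous hSt.continuous).const_mul A), integral_const_mul, hS1,
                mul_one]
      rw [this]; ring)
    refine ⟨u, hu, hlap, hu0, hC u _ hu hu0 (by positivity) fun x => ?_⟩
    rw [hlap]
    have h1 : 0 ≤ (φ' x + A) * S x := mul_nonneg (by linarith [(abs_le.1 (hA' x)).1]) (hS0 x)
    have h2 : (c' + A) * s x ≤ 2 * A * M :=
      mul_le_mul (by linarith [(abs_le.1 hc').2]) ((le_abs_self _).trans (hM x)) (h.nonneg x)
        (by positivity)
    linarith
  have hneg : ∫ y, S y * -φ y ∂P.vol = -c := by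
    rw [hc, ← integral_neg]; congr 1; funext y; ring
  obtain ⟨u, hu, hulap, hu0, hub⟩ := solve φ hφ hA hcA
  obtain ⟨v, hv, hvlap, hv0, hvb⟩ := solve (fun x => -φ x)
    (by simpa using hφ.const_mul (-1)) (by simpa using hA) (by rw [hneg, abs_neg]; exact hcA)
  rw [hneg] at hvlap
  -- the normalised potential
  set b := (P.vol.real Set.univ)⁻¹ * ∫ x, G x ∂P.vol with hb
  have hbB : |b| ≤ B := by
    have h1 : |∫ x, G x ∂P.vol| ≤ B * P.vol.real Set.univ :=
      norm_integral_le_of_norm_le_const (f := G) (Eventually.of_forall (hB m))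
    rw [hb, abs_mul, abs_of_pos (inv_pos.2 hV), inv_mul_le_iff₀ hV]
    linarith
  have hgt : IsTestFunction fun x => 2 * A * (G x - b) :=
    (hGt.sub (isTestFunction_const b)).const_mul _
  -- both sides have mean zero and the same Laplacian `2 A (S - s)`
  have hsum : ∀ x, u x + v x = 2 * A * (G x - b) := by
    refine eq_of_lap_eq (P := P) (hu.add hv) hgt (fun x => ?_) ?_
    · rw [P.lap_add hu hv, hulap, hvlap, P.lap_const_mul (hGt.sub (isTestFunction_const b)),
        P.lap_sub hGt (isTestFunction_const b), P.lap_const]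
      have := hSG x
      linear_combination (2 * A) * this
    · rw [integral_add (integrable_of_continuous hu.continuous)
        (integrable_of_continuous hv.continuous), hu0, hv0, integral_const_mul,
        integral_sub (integrable_of_continuous hGt.continuous) (integrable_const _),
        integral_const, smul_eq_mul, hb]
      field_simp
      ring
  -- `Δu = (φ + A) S - (c + A) s`, and `S - s = Δ G` turns `s` into `S`
  refine ⟨_, hu.sub (hGt.const_mul (A + c)), fun x => ?_, fun x => ?_⟩
  · rw [P.lap_sub hu (hGt.const_mul _), hulap, P.lap_const_mul hGt]
    have := hSG x
    linear_combination (A + c) * this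
  · have h1 := abs_le.1 (hB m x)
    have h2 := abs_le.1 hbB
    have h3 := abs_le.1 hcA
    have h4 : |2 * A * (G x - b)| ≤ 4 * B * A := by
      rw [abs_mul, abs_of_nonneg (by positivity : 0 ≤ 2 * A)]
      have : |G x - b| ≤ 2 * B := (abs_sub _ _).trans (by linarith [hB m x])
      nlinarith
    have h5 : |(A + c) * G x| ≤ 2 * A * B := by
      rw [abs_mul]
      exact mul_le_mul (abs_le.2 ⟨by linarith, by linarith⟩) (hB m x) (abs_nonneg _) (by positivity)
    have h6 := abs_le.1 h4
    have h7 := abs_le.1 h5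
    have h8 := hsum x
    have h9 := hub x
    have h10 := hvb x
    have h11 : 0 ≤ A * B := by positivity
    rw [abs_le]
    constructor <;> linarith

/-- Decay of correlations, with the uniform norm of the Laplacian in place of the `C²` norm. -/
theorem IsSeed.exists_abs_correlation_le [ConnectedSpace X] {f : X → X} {d : ℕ} {s γ : X → ℝ}
    (h : P.IsSeed f d s γ) (hf : MDifferentiable 𝓘(ℂ) 𝓘(ℂ) f) (hd : 2 ≤ d)
    (hdeg : HasDegree f d) {μ : Measure X}
    (hμ : ∀ ψ : X → ℝ, IsTestFunction ψ → Tendsto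
      (fun n => ∫ x, (P.transfer f d ^ n) s x * ψ x ∂P.vol) atTop (𝓝 (∫ x, ψ x ∂μ))) :
    ∃ C : ℝ, 0 ≤ C ∧ ∀ (φ ψ : X → ℝ) (A L : ℝ), IsTestFunction φ → IsTestFunction ψ →
      (∀ x, |φ x| ≤ A) → (∀ x, |P.lap ψ x| ≤ L) → ∀ n : ℕ,
        |∫ x, ψ x * φ (f^[n] x) ∂μ - (∫ x, φ x ∂μ) * ∫ x, ψ x ∂μ| ≤
          C * L * A * ((d : ℝ) ^ n)⁻¹ := by
  obtain ⟨C, hC0, hC⟩ := h.exists_lap_eq_sub_mul hf hd hdeg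
  refine ⟨C * P.vol.real Set.univ, by positivity, fun φ ψ A L hφ hψ hA hL n => ?_⟩
  have hs := h.isTestFunction_density
  have hφn := hφ.comp_iterate hf n
  have hlim : Tendsto (fun m =>
      ∫ x, (P.transfer f d ^ (m + n)) s x * (ψ x * φ (f^[n] x)) ∂P.vol -
        (∫ x, (P.transfer f d ^ m) s x * φ x ∂P.vol) *
          ∫ x, (P.transfer f d ^ (m + n)) s x * ψ x ∂P.vol) atTop
      (𝓝 (∫ x, ψ x * φ (f^[n] x) ∂μ - (∫ x, φ x ∂μ) * ∫ x, ψ x ∂μ)) :=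
    ((hμ _ (hψ.mul hφn)).comp (tendsto_add_atTop_nat n)).sub
      ((hμ φ hφ).mul ((hμ ψ hψ).comp (tendsto_add_atTop_nat n)))
  refine le_of_tendsto hlim.abs (Eventually.of_forall fun m => ?_)
  obtain ⟨u, hu, hulap, hub⟩ := hC m φ A hφ hA
  set S := (P.transfer f d ^ m) s with hS
  set c := ∫ x, S x * φ x ∂P.vol with hc
  have hSt : IsTestFunction S := P.isTestFunction_transfer_pow hf d hs m
  set S' := (P.transfer f d ^ (m + n)) s with hS'
  have hSt' : IsTestFunction S' := P.isTestFunction_transfer_pow hf d hs _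
  have hun := (hu.comp_iterate hf n).const_mul ((d : ℝ) ^ n)⁻¹
  -- `(φ ∘ f^n - c) S_{m+n}` is the Laplacian of `d^{-n} u ∘ f^n`
  have hkey : ∀ x, P.lap (fun y => ((d : ℝ) ^ n)⁻¹ * u (f^[n] y)) x =
      (φ (f^[n] x) - c) * S' x := by
    intro x
    have h1 : P.lap u = fun x => (φ x - c) * S x := funext hulap
    rw [← P.transfer_pow_lap hf hu, h1, P.transfer_pow_mul f d (fun x => φ x - c) S, hS, hS',
      add_comm m n, pow_add, Module.End.mul_apply]
  have e1 : ∫ x, S' x * (ψ x * φ (f^[n] x)) ∂P.vol - c * ∫ x, S' x * ψ x ∂P.vol =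
      ((d : ℝ) ^ n)⁻¹ * ∫ x, u (f^[n] x) * P.lap ψ x ∂P.vol := by
    rw [← integral_const_mul, ← integral_sub
      (integrable_mul_of_continuous hSt'.continuous (hψ.mul hφn).continuous)
      ((integrable_mul_of_continuous hSt'.continuous hψ.continuous).const_mul c)]
    calc ∫ x, (S' x * (ψ x * φ (f^[n] x)) - c * (S' x * ψ x)) ∂P.vol
        = ∫ x, ψ x * P.lap (fun y => ((d : ℝ) ^ n)⁻¹ * u (f^[n] y)) x ∂P.vol := by
          congr 1; funext x; rw [hkey]; ring
      _ = _ := by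
          rw [P.integral_mul_lap_comm hψ hun, ← integral_const_mul]
          congr 1; funext x; ring
  rw [e1, abs_mul, abs_of_nonneg (by positivity : (0 : ℝ) ≤ ((d : ℝ) ^ n)⁻¹)]
  have hA0 : 0 ≤ A := (abs_nonneg _).trans (hA (Classical.arbitrary X))
  have e2 : |∫ x, u (f^[n] x) * P.lap ψ x ∂P.vol| ≤ C * A * L * P.vol.real Set.univ :=
    norm_integral_le_of_norm_le_const (f := fun x => u (f^[n] x) * P.lap ψ x)
      (Eventually.of_forall fun x => by
        rw [norm_mul]
        exact mul_le_mul (hub _) (hL x) (abs_nonneg _) (by positivity))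
  calc ((d : ℝ) ^ n)⁻¹ * |∫ x, u (f^[n] x) * P.lap ψ x ∂P.vol|
      ≤ ((d : ℝ) ^ n)⁻¹ * (C * A * L * P.vol.real Set.univ) :=
        mul_le_mul_of_nonneg_left e2 (by positivity)
    _ = _ := by ring

/-- The limit of the iterated pull-backs is invariant, by duality between the transfer operator and
composition with `f`. -/
theorem IsSeed.measurePreserving {f : X → X} {d : ℕ} {s γ : X → ℝ}
    (h : P.IsSeed f d s γ) (hf : MDifferentiable 𝓘(ℂ) 𝓘(ℂ) f) (hd : 2 ≤ d)
    (hdeg : HasDegree f d) [Nonempty X] {μ : Measure X} [IsFiniteMeasure μ]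
    (hμ : ∀ ψ : X → ℝ, IsTestFunction ψ → Tendsto
      (fun n => ∫ x, (P.transfer f d ^ n) s x * ψ x ∂P.vol) atTop (𝓝 (∫ x, ψ x ∂μ))) :
    MeasurePreserving f μ μ := by
  refine ⟨hf.continuous.measurable, ?_⟩
  have : IsFiniteMeasure (μ.map f) := inferInstance
  refine measure_eq_of_integral_testFunction_eq fun ψ hψ => ?_
  rw [integral_map hf.continuous.aemeasurable hψ.continuous.aestronglyMeasurable]
  refine tendsto_nhds_unique (f := fun n => ∫ x, (P.transfer f d ^ (n + 1)) s x * ψ (f x) ∂P.vol)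
    ((hμ _ (hψ.comp_holomorphic hf)).comp (tendsto_add_atTop_nat 1)) ?_
  simp_rw [P.integral_transfer_pow_succ_mul hf hd hdeg h.isTestFunction_density h.nonneg
    hψ.continuous]
  exact hμ ψ hψ

/-- The Laplacian is bounded by the `C²` norm. -/
theorem exists_abs_lap_le_c2Norm (P : ChartPartition X) (𝒰 : CompactChartCover X) :
    ∃ C : ℝ, 0 ≤ C ∧ ∀ ψ : X → ℝ, IsTestFunction ψ → ∀ x, |P.lap ψ x| ≤ C * c2Norm 𝒰 ψ := by
  have hD : ∀ i : Fin 𝒰.N, ∃ D : ℝ, ∀ x ∈ 𝒰.K i, ‖(P.volDensity (𝒰.chart i) x)⁻¹‖ ≤ D := fun i =>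
    (𝒰.isCompact_K i).exists_bound_of_continuousOn
      (((P.continuousOn_volDensity (𝒰.chart_mem i)).mono (𝒰.K_subset i)).inv₀ fun x hx =>
        (P.volDensity_pos (𝒰.chart_mem i) (𝒰.K_subset i hx)).ne')
  choose D hD using hD
  set E := ∑ i, |D i| with hE
  have hE0 : 0 ≤ E := Finset.sum_nonneg fun _ _ => abs_nonneg _
  refine ⟨(2 * Real.pi)⁻¹ * 2 * E, by positivity, fun ψ hψ x => ?_⟩
  obtain ⟨i, hi⟩ := Set.mem_iUnion.1 (𝒰.cover ▸ Set.mem_univ x)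
  set u : (i : Fin 𝒰.N) → ℂ → ℝ := fun i => ψ ∘ (𝒰.chart i).symm with hu
  have hcont : ∀ i, ContinuousOn (fun y => ∑ j ∈ Finset.range 3,
      ‖iteratedFDeriv ℝ j (u i) (𝒰.chart i y)‖) (𝒰.K i) := by
    intro i y hy
    refine ContinuousAt.continuousWithinAt ?_
    have hy' := 𝒰.K_subset i hy
    refine tendsto_finsetSum _ fun j hj => ?_
    have h1 := (hψ.contDiffAt_two (𝒰.chart_mem i) ((𝒰.chart i).map_source hy'))
    have h2 : ContinuousAt (iteratedFDeriv ℝ j (u i)) (𝒰.chart i y) :=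
      (h1.iteratedFDeriv_right (m := 0) (i := j) (by
        have : j ≤ 2 := by have := Finset.mem_range.1 hj; omega
        rw [zero_add]; exact_mod_cast this)).continuousAt
    exact (ContinuousAt.comp (f := 𝒰.chart i) h2 ((𝒰.chart i).continuousAt hy')).norm
  choose M hM using fun i => (𝒰.isCompact_K i).exists_bound_of_continuousOn (hcont i)
  have hbdd : BddAbove (Set.range fun p : (i : Fin 𝒰.N) × 𝒰.K i => ∑ j ∈ Finset.range 3,
      ‖iteratedFDeriv ℝ j (ψ ∘ (𝒰.chart p.1).symm) (𝒰.chart p.1 p.2)‖) := by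
    refine ⟨∑ i, |M i|, ?_⟩
    rintro _ ⟨⟨k, y, hy⟩, rfl⟩
    exact (le_abs_self _).trans ((hM k y hy).trans ((le_abs_self _).trans
      (Finset.single_le_sum (f := fun i => |M i|) (fun _ _ => abs_nonneg _) (Finset.mem_univ k))))
  set z := 𝒰.chart i x with hz
  have hnorm : ‖iteratedFDeriv ℝ 2 (u i) z‖ ≤ c2Norm 𝒰 ψ :=
    (Finset.single_le_sum (f := fun j => ‖iteratedFDeriv ℝ j (u i) z‖)
      (fun _ _ => norm_nonneg _) (by simp)).trans (le_ciSup hbdd ⟨i, x, hi⟩)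
  have hΔ : |Δ (u i) z| ≤ 2 * c2Norm 𝒰 ψ := by
    rw [laplacian_eq_iteratedFDeriv_complexPlane]
    have hle : ∀ w : ℂ, ‖w‖ = 1 → |iteratedFDeriv ℝ 2 (u i) z ![w, w]| ≤ c2Norm 𝒰 ψ := by
      intro w hw
      refine ((iteratedFDeriv ℝ 2 (u i) z).le_opNorm ![w, w]).trans ?_
      simpa [Fin.prod_univ_two, hw] using hnorm
    refine (abs_add_le _ _).trans ?_
    linarith [hle 1 (by simp), hle Complex.I (by simp)]
  rw [P.lap_eq hψ (𝒰.chart_mem i) (𝒰.K_subset i hi), div_eq_mul_inv, abs_mul, abs_mul,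
    abs_of_pos (by positivity : (0 : ℝ) < (2 * Real.pi)⁻¹)]
  have hDE : |(P.volDensity (𝒰.chart i) x)⁻¹| ≤ E :=
    ((hD i x hi).trans (le_abs_self _)).trans
      (Finset.single_le_sum (f := fun i => |D i|) (fun _ _ => abs_nonneg _) (Finset.mem_univ i))
  calc (2 * Real.pi)⁻¹ * |Δ (u i) z| * |(P.volDensity (𝒰.chart i) x)⁻¹|
      ≤ (2 * Real.pi)⁻¹ * (2 * c2Norm 𝒰 ψ) * E :=
        mul_le_mul (mul_le_mul_of_nonneg_left hΔ (by positivity)) hDE (abs_nonneg _)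
          (mul_nonneg (by positivity) ((abs_nonneg _).trans hΔ))
    _ = _ := by ring

end ChartPartition

theorem abs_le_supNorm {φ : X → ℝ} (hφ : Continuous φ) (x : X) : |φ x| ≤ supNorm φ := by
  obtain ⟨M, -, hM⟩ := exists_abs_le_of_continuous hφ
  exact le_ciSup (f := fun x => |φ x|) ⟨M, by rintro _ ⟨y, rfl⟩; exact hM y⟩ x

/-- Test functions approximate the indicator functions of Borel sets. -/
theorem exists_isTestFunction_near_indicator (μ : Measure X) [IsFiniteMeasure μ] {A : Set X}
    (hA : MeasurableSet A) {ε : ℝ} (hε : 0 < ε) : ∃ θ, IsTestFunction θ ∧ (∀ x, |θ x| ≤ 1) ∧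
      ∫ x, |θ x - A.indicator 1 x| ∂μ ≤ ε := by
  have := polishSpace_of_surface X
  have hε' : ENNReal.ofReal (ε / 2) ≠ 0 := by simpa using hε
  obtain ⟨K, hKA, hK, hμK⟩ := hA.exists_isClosed_sdiff_lt (measure_ne_top μ A) hε'
  obtain ⟨U, hAU, hU, -, hμU⟩ := hA.exists_isOpen_sdiff_lt (measure_ne_top μ A) hε'
  obtain ⟨θ, hθ, h0, h1, hθK, hθs⟩ := exists_cutoff hK hU (hKA.trans hAU)
  have hUK : MeasurableSet (U \ K) := hU.measurableSet.diff hK.measurableSet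
  refine ⟨θ, hθ, fun x => abs_le.2 ⟨by linarith [h0 x], h1 x⟩, ?_⟩
  have hle : ∀ x, |θ x - A.indicator 1 x| ≤ (U \ K).indicator 1 x := by
    intro x
    by_cases hxK : x ∈ K
    · rw [(hθK x hxK).eq_of_nhds, Set.indicator_of_mem (hKA hxK), Pi.one_apply, sub_self, abs_zero]
      exact Set.indicator_nonneg (fun _ _ => zero_le_one) _
    by_cases hxU : x ∈ U
    · rw [Set.indicator_of_mem (show x ∈ U \ K from ⟨hxU, hxK⟩), Pi.one_apply]
      by_cases hxA : x ∈ A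
      · rw [Set.indicator_of_mem hxA, Pi.one_apply, abs_le]
        constructor <;> linarith [h0 x, h1 x]
      · rw [Set.indicator_of_notMem hxA, sub_zero, abs_of_nonneg (h0 x)]
        exact h1 x
    · rw [image_eq_zero_of_notMem_tsupport fun h => hxU (hθs h),
        Set.indicator_of_notMem fun h => hxU (hAU h), sub_self, abs_zero]
      exact Set.indicator_nonneg (fun _ _ => zero_le_one) _
  have hUK' : μ (U \ K) ≤ ENNReal.ofReal ε := by
    have : U \ K ⊆ (U \ A) ∪ (A \ K) := fun x hx => by
      by_cases hxA : x ∈ A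
      exacts [Or.inr ⟨hxA, hx.2⟩, Or.inl ⟨hx.1, hxA⟩]
    refine (measure_mono this).trans ((measure_union_le _ _).trans ?_)
    rw [← add_halves ε, ENNReal.ofReal_add (by positivity) (by positivity)]
    exact add_le_add hμU.le hμK.le
  calc ∫ x, |θ x - A.indicator 1 x| ∂μ ≤ ∫ x, (U \ K).indicator 1 x ∂μ :=
        integral_mono_of_nonneg (Eventually.of_forall fun x => abs_nonneg _)
          ((integrable_const (1 : ℝ)).indicator hUK) (Eventually.of_forall hle)
    _ = μ.real (U \ K) := integral_indicator_one hUK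
    _ ≤ ε := ENNReal.toReal_le_of_le_ofReal hε.le hUK'

/-- Mixing follows from the decorrelation of test functions. -/
theorem isMixing_of_tendsto {f : X → X} {μ : Measure X} [IsProbabilityMeasure μ]
    (hinv : MeasurePreserving f μ μ)
    (hcorr : ∀ φ ψ : X → ℝ, IsTestFunction φ → IsTestFunction ψ →
      Tendsto (fun n : ℕ => ∫ x, ψ x * φ (f^[n] x) ∂μ) atTop
        (𝓝 ((∫ x, φ x ∂μ) * ∫ x, ψ x ∂μ))) : IsMixing f μ := by
  refine ⟨hinv, fun A B hA hB => ?_⟩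
  have hm : ∀ n, MeasurableSet (f^[n] ⁻¹' A) := fun n => (hinv.iterate n).measurable hA
  suffices h : Tendsto (fun n : ℕ => (μ (f^[n] ⁻¹' A ∩ B)).toReal) atTop
      (𝓝 (μ A * μ B).toReal) from
    (ENNReal.tendsto_toReal_iff (fun n => measure_ne_top _ _)
      (ENNReal.mul_ne_top (measure_ne_top _ _) (measure_ne_top _ _))).1 h
  rw [ENNReal.toReal_mul, Metric.tendsto_atTop]
  intro ε hε
  obtain ⟨φ, hφ, hφ1, hφA⟩ := exists_isTestFunction_near_indicator μ hA (by positivity : 0 < ε / 5)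
  obtain ⟨ψ, hψ, hψ1, hψB⟩ := exists_isTestFunction_near_indicator μ hB (by positivity : 0 < ε / 5)
  set a : X → ℝ := A.indicator 1 with ha
  set b : X → ℝ := B.indicator 1 with hb
  have hai : Integrable a μ := (integrable_const (1 : ℝ)).indicator hA
  have hbi : Integrable b μ := (integrable_const (1 : ℝ)).indicator hB
  have ha1 : ∀ x, |a x| ≤ 1 := fun x => by by_cases hx : x ∈ A <;> simp [ha, hx]
  have hda : Integrable (fun x => |φ x - a x|) μ :=
    ((integrable_of_continuous hφ.continuous).sub hai).abs
  have hdb : Integrable (fun x => |ψ x - b x|) μ :=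
    ((integrable_of_continuous hψ.continuous).sub hbi).abs
  have hintA : ∫ x, a x ∂μ = μ.real A := integral_indicator_one hA
  have hintB : ∫ x, b x ∂μ = μ.real B := integral_indicator_one hB
  have hA' : |∫ x, φ x ∂μ - μ.real A| ≤ ε / 5 := by
    rw [← hintA, ← integral_sub (integrable_of_continuous hφ.continuous) hai]
    exact (abs_integral_le_integral_abs).trans hφA
  have hB' : |∫ x, ψ x ∂μ - μ.real B| ≤ ε / 5 := by
    rw [← hintB, ← integral_sub (integrable_of_continuous hψ.continuous) hbi]
    exact (abs_integral_le_integral_abs).trans hψB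
  have hn : ∀ n : ℕ, |∫ x, ψ x * φ (f^[n] x) ∂μ - μ.real (f^[n] ⁻¹' A ∩ B)| ≤ 2 * (ε / 5) := by
    intro n
    have hmp := hinv.iterate n
    have e1 : μ.real (f^[n] ⁻¹' A ∩ B) = ∫ x, b x * a (f^[n] x) ∂μ := by
      rw [← integral_indicator_one ((hm n).inter hB)]
      congr 1; funext x
      by_cases hx : x ∈ B <;> by_cases hx' : f^[n] x ∈ A <;> simp [ha, hb, hx, hx']
    have hprod : Integrable (fun x => b x * a (f^[n] x)) μ :=
      hbi.mul_bdd (c := 1) ((hmp.integrable_comp hai.aestronglyMeasurable).2 hai).aestronglyMeasurable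
        (Eventually.of_forall fun x => ha1 _)
    have hφm : Measurable fun x => φ (f^[n] x) := hφ.continuous.measurable.comp hmp.measurable
    have hprod' : Integrable (fun x => ψ x * φ (f^[n] x)) μ :=
      (integrable_of_continuous hψ.continuous).mul_bdd (c := 1) hφm.aestronglyMeasurable
        (Eventually.of_forall fun x => hφ1 _)
    have hda' : Integrable (fun x => |φ (f^[n] x) - a (f^[n] x)|) μ :=
      (hmp.integrable_comp hda.aestronglyMeasurable).2 hda
    have hcomp : ∫ x, |φ (f^[n] x) - a (f^[n] x)| ∂μ = ∫ x, |φ x - a x| ∂μ := by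
      have := integral_map (μ := μ) hmp.measurable.aemeasurable
        (f := fun x => |φ x - a x|) (hmp.map_eq.symm ▸ hda.aestronglyMeasurable)
      rw [hmp.map_eq] at this
      exact this.symm
    rw [e1, ← integral_sub hprod' hprod]
    calc |∫ x, (ψ x * φ (f^[n] x) - b x * a (f^[n] x)) ∂μ|
        ≤ ∫ x, (|φ (f^[n] x) - a (f^[n] x)| + |ψ x - b x|) ∂μ := by
          refine norm_integral_le_of_norm_le
            (f := fun x => ψ x * φ (f^[n] x) - b x * a (f^[n] x))
            (g := fun x => |φ (f^[n] x) - a (f^[n] x)| + |ψ x - b x|) (hda'.add hdb)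
            (Eventually.of_forall fun x => ?_)
          have : ψ x * φ (f^[n] x) - b x * a (f^[n] x) =
              ψ x * (φ (f^[n] x) - a (f^[n] x)) + (ψ x - b x) * a (f^[n] x) := by ring
          rw [this]
          refine (norm_add_le _ _).trans (add_le_add ?_ ?_)
          · rw [norm_mul]; exact mul_le_of_le_one_left (norm_nonneg _) (hψ1 x)
          · rw [norm_mul]; exact mul_le_of_le_one_right (norm_nonneg _) (ha1 _)
      _ = ∫ x, |φ x - a x| ∂μ + ∫ x, |ψ x - b x| ∂μ := by rw [integral_add hda' hdb, hcomp]
      _ ≤ 2 * (ε / 5) := by linarith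
  have hprodlim : |(∫ x, φ x ∂μ) * ∫ x, ψ x ∂μ - μ.real A * μ.real B| ≤ 2 * (ε / 5) := by
    have h1 : |∫ x, ψ x ∂μ| ≤ 1 := by
      simpa using norm_integral_le_of_norm_le_const (μ := μ) (f := ψ) (Eventually.of_forall hψ1)
    have h2 : |μ.real A| ≤ 1 := by rw [abs_of_nonneg measureReal_nonneg]; exact measureReal_le_one
    have : (∫ x, φ x ∂μ) * ∫ x, ψ x ∂μ - μ.real A * μ.real B =
        (∫ x, φ x ∂μ - μ.real A) * ∫ x, ψ x ∂μ + μ.real A * (∫ x, ψ x ∂μ - μ.real B) := by ring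
    rw [this]
    refine (abs_add_le _ _).trans ?_
    rw [abs_mul, abs_mul]
    have h3 := mul_le_mul hA' h1 (abs_nonneg _) (by positivity)
    have h4 := mul_le_mul h2 hB' (abs_nonneg _) (by positivity)
    linarith
  obtain ⟨N, hN⟩ := Metric.tendsto_atTop.1 (hcorr φ ψ hφ hψ) (ε / 5) (by positivity)
  refine ⟨N, fun n hnN => ?_⟩
  have h1 := hN n hnN
  rw [Real.dist_eq, abs_lt] at h1
  have h2 := abs_le.1 (hn n)
  have h3 := abs_le.1 hprodlim
  rw [Real.dist_eq, abs_lt]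
  simp only [Measure.real] at h2 h3
  constructor <;> linarith

end Correlations

end RiemannDynamics

end

open RiemannDynamics in
theorem mainTheorem8 {X : Type*} [TopologicalSpace X] [T2Space X] [CompactSpace X]
    [ConnectedSpace X] [ChartedSpace ℂ X] [IsManifold 𝓘(ℂ) ω X]
    [MeasurableSpace X] [BorelSpace X]
    (f : X → X) (hf : MDifferentiable 𝓘(ℂ) 𝓘(ℂ) f)
    (d : ℕ) (hd : 2 ≤ d) (hdeg : RiemannDynamics.HasDegree f d)
    (ω₀ : Measure X) (hω₀ : RiemannDynamics.IsSmoothProbability ω₀) :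
    ∃ μ : Measure X,
      -- the canonical measure exists, is unique, and does not depend on the choice of `ω₀`
      RiemannDynamics.IsCanonicalMeasure f d ω₀ μ ∧
      (∀ ω₁ ν : Measure X, RiemannDynamics.IsSmoothProbability ω₁ →
        RiemannDynamics.IsCanonicalMeasure f d ω₁ ν → ν = μ) ∧
      -- it is mixing
      RiemannDynamics.IsMixing f μ ∧
      -- exponential decay of correlations
      ∀ 𝒰 : RiemannDynamics.CompactChartCover X, ∃ C : ℝ, 0 < C ∧
        ∀ φ ψ : X → ℝ, RiemannDynamics.IsTestFunction φ → RiemannDynamics.IsTestFunction ψ →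
          ∀ n : ℕ,
            |∫ x, ψ x * φ (f^[n] x) ∂μ - (∫ x, φ x ∂μ) * ∫ x, ψ x ∂μ| ≤
              C * RiemannDynamics.c2Norm 𝒰 ψ * RiemannDynamics.supNorm φ * ((d : ℝ) ^ n)⁻¹ := by
  obtain ⟨P⟩ := exists_chartPartition X
  have hone : ∀ {s : X → ℝ}, IsTestFunction s → (∀ x, 0 ≤ s x) →
      IsProbabilityMeasure (P.smoothMeasure s) → ∫ x, s x ∂P.vol = 1 := by
    intro s hs hs0 hprob
    have h := P.integral_smoothMeasure hs.continuous hs0 fun _ => 1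
    simpa using h.symm
  obtain ⟨s, hs, hs0, hωs⟩ := P.exists_density hω₀
  change ω₀ = P.smoothMeasure s at hωs
  have hs1 := hone hs hs0 (hωs ▸ hω₀.prob)
  obtain ⟨γ, hγ⟩ := ChartPartition.exists_isSeed (P := P) hf hd hdeg hs hs0 hs1
  obtain ⟨μ, hμp, hμ⟩ := hγ.exists_limit hf hd hdeg
  obtain ⟨C, hC0, hC⟩ := hγ.exists_abs_correlation_le hf hd hdeg hμ
  refine ⟨μ, ⟨hμp, γ, hγ.isTestFunction_potential, ?_, ?_⟩, ?_, ?_, ?_⟩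
  · rw [hωs]
    exact (ChartPartition.isSeed_iff hf hd hdeg hs hs0 hs1 hγ.isTestFunction_potential).1 hγ
  · rw [hωs]
    exact (hγ.eqAddLaplacian_greenPotential_iff hf hd).2 hμ
  · rintro ω₁ ν hω₁ ⟨hνp, γ', hγ't, hpull, hν⟩
    obtain ⟨t, ht, ht0, hωt⟩ := P.exists_density hω₁
    change ω₁ = P.smoothMeasure t at hωt
    have ht1 := hone ht ht0 (hωt ▸ hω₁.prob)
    rw [hωt] at hpull hν
    have hγ' := (ChartPartition.isSeed_iff hf hd hdeg ht ht0 ht1 hγ't).2 hpull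
    have hν' := (hγ'.eqAddLaplacian_greenPotential_iff hf hd).1 hν
    refine measure_eq_of_integral_testFunction_eq fun ψ hψ => sub_eq_zero.1 ?_
    exact tendsto_nhds_unique ((hν' ψ hψ).sub (hμ ψ hψ))
      (ChartPartition.tendsto_integral_transfer_pow_sub hf hd ht hs (ht1.trans hs1.symm) hψ)
  · refine isMixing_of_tendsto (hγ.measurePreserving hf hd hdeg hμ) fun φ ψ hφ hψ => ?_
    obtain ⟨A, -, hA⟩ := exists_abs_le_of_continuous hφ.continuous
    obtain ⟨L, -, hL⟩ := exists_abs_le_of_continuous (P.isTestFunction_lap hψ).continuous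
    refine tendsto_iff_norm_sub_tendsto_zero.2 (squeeze_zero (fun n => norm_nonneg _)
      (hC φ ψ A L hφ hψ hA hL) ?_)
    simpa only [mul_comm] using (summable_inv_pow_mul hd (C * L * A)).tendsto_atTop_zero
  · intro 𝒰
    obtain ⟨C', hC'0, hC'⟩ := P.exists_abs_lap_le_c2Norm 𝒰
    -- the summand `1` makes the constant positive
    refine ⟨C * C' + 1, by positivity, fun φ ψ hφ hψ n => ?_⟩
    have h1 := hC φ ψ _ _ hφ hψ (abs_le_supNorm hφ.continuous) (hC' ψ hψ) n
    have h2 : 0 ≤ supNorm φ := Real.iSup_nonneg fun _ => abs_nonneg _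
    have h3 : 0 ≤ c2Norm 𝒰 ψ := Real.iSup_nonneg fun _ => Finset.sum_nonneg fun _ _ =>
      norm_nonneg _
    refine h1.trans ?_
    have h4 : 0 ≤ c2Norm 𝒰 ψ * supNorm φ * ((d : ℝ) ^ n)⁻¹ := by positivity
    linarith
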